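/- Conventions. Manifolds are smooth, finite-dimensional of pure dimension, Hausdorff and second countable. A Lie groupoid $\mathcal G\rightrightarrows M$ has source, target $s,t\colon\mathcal G\to M$ (submersions), its dimension is the dimension of the manifold of arrows, and $gh$ is defined when $s(g)=t(h)$. It is *regular* if all its leaves $t(s^{-1}(x))$ have the same dimension. A *resolution* of a Lie groupoid $\mathcal G\rightrightarrows M$ of dimension $n$ is a regular Lie groupoid $\mathcal H\rightrightarrows N$ of dimension $n$ with a morphism of Lie groupoids $\pi\colon\mathcal H\to\mathcal G$ that is surjective, proper, and an isomorphism almost everywhere, i.e. there is an open $U\subseteq M$ such that $M\setminus U$ and $N\setminus\pi^{-1}(U)$ have measure zero and $\pi$ restricts to an isomorphism $\mathcal H|_{\pi^{-1}(U)}\to\mathcal G|_U$. It is an *action resolution* if $h\mapsto(\pi(h),s(h))$ is an isomorphism $\mathcal H\to\mathcal G\times_M N=\{(g,x): s(g)=\pi(x)\}$. A *Morita equivalence* between $\mathcal G'\rightrightarrows M'$ and $\mathcal G\rightrightarrows M$ is a manifold $P$ with smooth moment maps $\alpha'\colon P\to M'$, $\alpha\colon P\to M$ and commuting smooth actions of $\mathcal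 G'$ from the left (along $\alpha'$) and $\mathcal G$ from the right (along $\alpha$), each moment map being invariant under the other action, which is right-principal ($\alpha'$ is a surjective submersion, the $\mathcal G$-action is free and proper, and its orbits are the fibres of $\alpha'$) and left-principal (the same with the two sides exchanged). Proposition. Let $P$ be a Morita equivalence between Lie groupoids $\mathcal G'\rightrightarrows M'$ and $\mathcal G\rightrightarrows M$, and let $\pi\colon\mathcal H\to\mathcal G$, with $\mathcal H\rightrightarrows N$, be an action resolution. Then $\mathcal G'$ admits an action resolution $\pi'\colon\mathcal H'\to\mathcal G'$, with $\mathcal H'\rightrightarrows N'$, such that $\mathcal H'$ is Morita equivalent to $\mathcal H$. More precisely, $(\mathcal H',\pi')$ can be chosen so that the manifold $Q=P\times_M N=\{(p,x):\alpha(p)=\pi(x)\}$, with the right $\mathcal H$-action $(p,x)\cdot h=(p\cdot\pi(h),s(h))$ along $(p,x)\mapsto x$ and a suitable left $\mathcal H'$-action, is a Morita equivalence between $\mathcal H'$ and $\mathcal H$ (so that $N'=Q/\mathcal H$), the projection $Q\to P$ is compatible with the moment maps to $N'$ and $M'$ and is equivariant along $\pi'$, and $\mathcal H'=(Q\times_N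 Q)/\mathcal H$: there is a surjective submersion $Q\times_N Q\to\mathcal H'$, $(q_2,q_1)\mapsto[q_2,q_1]$, whose fibres are the orbits of the diagonal $\mathcal H$-action, such that $s[q_2,q_1]$ and $t[q_2,q_1]$ are the classes of $q_1$ and $q_2$ in $N'$, $[q_3,q_2][q_2,q_1]=[q_3,q_1]$, and $[q_2,q_1]\cdot q_1=q_2$. -/

import Mathlib

open scoped Manifold ContDiff

universe u

noncomputable section

/-! ### Manifolds -/

/-- A smooth manifold of dimension `d`: Hausdorff, second countable, without boundary, possibly
disconnected or empty. -/
structure SmoothMfd (d : ℕ) where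
  carrier : Type u
  [top : TopologicalSpace carrier]
  [charted : ChartedSpace (EuclideanSpace ℝ (Fin d)) carrier]
  [isManifold : IsManifold (𝓡 d) ∞ carrier]
  [t2 : T2Space carrier]
  [secondCountable : SecondCountableTopology carrier]

namespace SmoothMfd

instance (d : ℕ) : CoeSort (SmoothMfd.{u} d) (Type u) := ⟨SmoothMfd.carrier⟩

attribute [instance] SmoothMfd.top SmoothMfd.charted SmoothMfd.isManifold SmoothMfd.t2
  SmoothMfd.secondCountable

/-- A subset of a manifold has measure zero: it has Lebesgue measure zero in charts. -/
def IsNull {d : ℕ} (X : SmoothMfd.{u} d) (S : Set X) : Prop :=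
  ∀ x : X, MeasureTheory.volume
    ((chartAt (EuclideanSpace ℝ (Fin d)) x).target ∩
      (chartAt (EuclideanSpace ℝ (Fin d)) x).symm ⁻¹' S) = 0

end SmoothMfd

section

variable {E F H K X Y : Type*} [NormedAddCommGroup E] [NormedSpace ℝ E] [TopologicalSpace H]
  [NormedAddCommGroup F] [NormedSpace ℝ F] [TopologicalSpace K]
  [TopologicalSpace X] [ChartedSpace H X] [TopologicalSpace Y] [ChartedSpace K Y]

/-- `f` restricts to a diffeomorphism from `A` onto `B`, where `A` and `B` are embedded submanifolds
(for instance open subsets, or fibre products along submersions). On an embedded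
submanifold, `ContMDiffOn` is smoothness for the submanifold structure. -/
def IsDiffeoOn (I : ModelWithCorners ℝ E H) (J : ModelWithCorners ℝ F K)
    (f : X → Y) (A : Set X) (B : Set Y) : Prop :=
  ContMDiffOn I J ∞ f A ∧ Set.MapsTo f A B ∧
    ∃ g : Y → X, ContMDiffOn J I ∞ g B ∧ Set.MapsTo g B A ∧
      Set.LeftInvOn g f A ∧ Set.RightInvOn g f B

end

/-! ### Lie groupoids -/

/-- A Lie groupoid `Arr ⇉ Obj` of dimension `n` (the dimension of the manifold of arrows) over
a base of dimension `m`. The product `mul g h` is meaningful when `src g = tgt h`; its values on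
other pairs are irrelevant. -/
structure LieGroupoid (m n : ℕ) where
  Obj : SmoothMfd.{u} m
  Arr : SmoothMfd.{u} n
  src : Arr → Obj
  tgt : Arr → Obj
  unit : Obj → Arr
  mul : Arr → Arr → Arr
  inv : Arr → Arr
  src_submersion : Manifold.IsSubmersion (𝓡 n) (𝓡 m) ∞ src
  tgt_submersion : Manifold.IsSubmersion (𝓡 n) (𝓡 m) ∞ tgt
  unit_smooth : ContMDiff (𝓡 m) (𝓡 n) ∞ unit
  inv_smooth : ContMDiff (𝓡 n) (𝓡 n) ∞ inv
  mul_smooth : ContMDiffOn ((𝓡 n).prod (𝓡 n)) (𝓡 n) ∞ (fun x : Arr × Arr => mul x.1 x.2)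
    {x | src x.1 = tgt x.2}
  src_unit : ∀ x, src (unit x) = x
  tgt_unit : ∀ x, tgt (unit x) = x
  src_mul : ∀ g h, src g = tgt h → src (mul g h) = src h
  tgt_mul : ∀ g h, src g = tgt h → tgt (mul g h) = tgt g
  mul_assoc : ∀ g h k, src g = tgt h → src h = tgt k → mul (mul g h) k = mul g (mul h k)
  unit_mul : ∀ g, mul (unit (tgt g)) g = g
  mul_unit : ∀ g, mul g (unit (src g)) = g
  src_inv : ∀ g, src (inv g) = tgt g
  tgt_inv : ∀ g, tgt (inv g) = src g
  inv_mul : ∀ g, mul (inv g) g = unit (src g)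
  mul_inv : ∀ g, mul g (inv g) = unit (tgt g)

namespace LieGroupoid

variable {k m n m' n' : ℕ}

/-- The tangent space at `x` of the leaf `t (s⁻¹ x)` through `x`: the image under `dt` of
the tangent space at the unit `1ₓ` of the source fibre `s⁻¹ x`. -/
def leafTangent (G : LieGroupoid.{u} m n) (x : G.Obj) :
    Submodule ℝ (TangentSpace (𝓡 m) (G.tgt (G.unit x))) :=
  Submodule.map (mfderiv (𝓡 n) (𝓡 m) G.tgt (G.unit x)).toLinearMap
    (LinearMap.ker (mfderiv (𝓡 n) (𝓡 m) G.src (G.unit x)).toLinearMap)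

/-- The dimension of the leaf through `x`. -/
def leafDim (G : LieGroupoid.{u} m n) (x : G.Obj) : ℕ := Module.finrank ℝ (G.leafTangent x)

/-- A Lie groupoid is regular if all its leaves have the same dimension. -/
def IsRegular (G : LieGroupoid.{u} m n) : Prop := ∀ x y : G.Obj, G.leafDim x = G.leafDim y

/-- The arrows of the restriction `G|_U` of a groupoid to a set `U` of objects. -/
def restrict (G : LieGroupoid.{u} m n) (U : Set G.Obj) : Set G.Arr :=
  {g | G.src g ∈ U ∧ G.tgt g ∈ U}

/-- A morphism of Lie groupoids: a smooth functor. -/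
structure Hom (H : LieGroupoid.{u} k n) (G : LieGroupoid.{u} m n') where
  obj : H.Obj → G.Obj
  arr : H.Arr → G.Arr
  obj_smooth : ContMDiff (𝓡 k) (𝓡 m) ∞ obj
  arr_smooth : ContMDiff (𝓡 n) (𝓡 n') ∞ arr
  src_arr : ∀ h, G.src (arr h) = obj (H.src h)
  tgt_arr : ∀ h, G.tgt (arr h) = obj (H.tgt h)
  arr_unit : ∀ x, arr (H.unit x) = G.unit (obj x)
  arr_mul : ∀ g h, H.src g = H.tgt h → arr (H.mul g h) = G.mul (arr g) (arr h)

namespace Hom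

/-- `π : H → G` is an isomorphism almost everywhere: there is an open set `U` of objects of `G`
such that `U` and its preimage have complements of measure zero and `π` restricts to an isomorphism
of Lie groupoids from `H|_{π⁻¹ U}` onto `G|_U`. -/
def IsIsoAlmostEverywhere {H : LieGroupoid.{u} k n} {G : LieGroupoid.{u} m n'}
    (π : Hom H G) : Prop :=
  ∃ U : Set G.Obj, IsOpen U ∧ G.Obj.IsNull Uᶜ ∧ H.Obj.IsNull (π.obj ⁻¹' U)ᶜ ∧
    IsDiffeoOn (𝓡 k) (𝓡 m) π.obj (π.obj ⁻¹' U) U ∧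
    IsDiffeoOn (𝓡 n) (𝓡 n') π.arr (H.restrict (π.obj ⁻¹' U)) (G.restrict U)

/-- `(H, π)` is a resolution of `G`: `H` is a regular Lie groupoid of the same dimension `n` as `G`
and `π : H → G` is a surjective proper morphism which is an isomorphism almost everywhere. -/
def IsResolution {H : LieGroupoid.{u} k n} {G : LieGroupoid.{u} m n} (π : Hom H G) : Prop :=
  H.IsRegular ∧ Function.Surjective π.arr ∧ IsProperMap π.arr ∧ π.IsIsoAlmostEverywhere

/-- `(H, π)` is an action resolution of `G`: a resolution such that
`H → G ×_M N`, `h ↦ (π h, s h)`, is an isomorphism, where `N` and `M` are the objects of `H`, `G`.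
(The groupoid structure of `G ×_M N` is the one transported along this map.) -/
def IsActionResolution {H : LieGroupoid.{u} k n} {G : LieGroupoid.{u} m n} (π : Hom H G) : Prop :=
  π.IsResolution ∧
    IsDiffeoOn (𝓡 n) ((𝓡 n).prod (𝓡 k)) (fun h : H.Arr => (π.arr h, H.src h)) Set.univ
      {x : G.Arr × H.Obj | G.src x.1 = π.obj x.2}

end Hom

/-! ### Bibundles and Morita equivalence -/

/-- A bibundle of dimension `d` between `G'` and `G`: a manifold with moment maps to
the objects of `G'` and `G` and commuting smooth actions of `G'` from the left and of `G` from
the right, each moment map being invariant under the other action.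
`actL g p` is meaningful when `src g = momL p`, and `actR p g` when `momR p = tgt g`. -/
structure Bibundle (G' : LieGroupoid.{u} m' n') (G : LieGroupoid.{u} m n) (d : ℕ) where
  Tot : SmoothMfd.{u} d
  momL : Tot → G'.Obj
  momR : Tot → G.Obj
  actL : G'.Arr → Tot → Tot
  actR : Tot → G.Arr → Tot
  momL_smooth : ContMDiff (𝓡 d) (𝓡 m') ∞ momL
  momR_smooth : ContMDiff (𝓡 d) (𝓡 m) ∞ momR
  actL_smooth : ContMDiffOn ((𝓡 n').prod (𝓡 d)) (𝓡 d) ∞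
    (fun x : G'.Arr × Tot => actL x.1 x.2) {x | G'.src x.1 = momL x.2}
  actR_smooth : ContMDiffOn ((𝓡 d).prod (𝓡 n)) (𝓡 d) ∞
    (fun x : Tot × G.Arr => actR x.1 x.2) {x | momR x.1 = G.tgt x.2}
  momL_actL : ∀ g p, G'.src g = momL p → momL (actL g p) = G'.tgt g
  momR_actL : ∀ g p, G'.src g = momL p → momR (actL g p) = momR p
  momR_actR : ∀ p g, momR p = G.tgt g → momR (actR p g) = G.src g
  momL_actR : ∀ p g, momR p = G.tgt g → momL (actR p g) = momL p
  unit_actL : ∀ p, actL (G'.unit (momL p)) p = p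
  actR_unit : ∀ p, actR p (G.unit (momR p)) = p
  mul_actL : ∀ g h p, G'.src g = G'.tgt h → G'.src h = momL p →
    actL (G'.mul g h) p = actL g (actL h p)
  actR_mul : ∀ p g h, momR p = G.tgt g → G.src g = G.tgt h →
    actR p (G.mul g h) = actR (actR p g) h
  act_comm : ∀ g p h, G'.src g = momL p → momR p = G.tgt h →
    actR (actL g p) h = actL g (actR p h)

namespace Bibundle

variable {G' : LieGroupoid.{u} m' n'} {G : LieGroupoid.{u} m n} {d : ℕ}

/-- The left moment map is a surjective submersion, the right action is free and proper, and its
orbits are the fibres of the left moment map. -/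
structure IsRightPrincipal (P : Bibundle G' G d) : Prop where
  surjective : Function.Surjective P.momL
  submersion : Manifold.IsSubmersion (𝓡 d) (𝓡 m') ∞ P.momL
  free : ∀ p g, P.momR p = G.tgt g → P.actR p g = p → g = G.unit (P.momR p)
  proper : IsProperMap (fun x : {x : P.Tot × G.Arr // P.momR x.1 = G.tgt x.2} =>
    (x.1.1, P.actR x.1.1 x.1.2))
  orbit : ∀ p q, P.momL p = P.momL q → ∃ g, P.momR p = G.tgt g ∧ P.actR p g = q

/-- The right moment map is a surjective submersion, the left action is free and proper, and its
orbits are the fibres of the right moment map. -/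
structure IsLeftPrincipal (P : Bibundle G' G d) : Prop where
  surjective : Function.Surjective P.momR
  submersion : Manifold.IsSubmersion (𝓡 d) (𝓡 m) ∞ P.momR
  free : ∀ g p, G'.src g = P.momL p → P.actL g p = p → g = G'.unit (P.momL p)
  proper : IsProperMap (fun x : {x : G'.Arr × P.Tot // G'.src x.1 = P.momL x.2} =>
    (P.actL x.1.1 x.1.2, x.1.2))
  orbit : ∀ p q, P.momR p = P.momR q → ∃ g, G'.src g = P.momL p ∧ P.actL g p = q

/-- `P` is a Morita equivalence between `G'` and `G`. -/
def IsMoritaEquivalence (P : Bibundle G' G d) : Prop := P.IsRightPrincipal ∧ P.IsLeftPrincipal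

/-- The fibre product `P ×_M P` along the right moment map `P → M`. -/
def pairs (P : Bibundle G' G d) : Set (P.Tot × P.Tot) := {x | P.momR x.1 = P.momR x.2}

/-- `δ` exhibits the Lie groupoid `G'` as `(P ×_M P) / G`: as a manifold, `G'` is the quotient of
`P ×_M P` by the diagonal `G`-action (`δ` is a surjective submersion, expressed by local
sections, whose fibres are the orbits), and writing `[p₂, p₁]` for `δ (p₂, p₁)`, the
source of `[p₂, p₁]` is the class of `p₁`, its target is that of `p₂`,
`[p₃, p₂] [p₂, p₁] = [p₃, p₁]` and `[p₂, p₁] · p₁ = p₂`. -/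
structure IsPairQuotient (P : Bibundle G' G d) (δ : P.Tot × P.Tot → G'.Arr) : Prop where
  smooth : ContMDiffOn ((𝓡 d).prod (𝓡 d)) (𝓡 n') ∞ δ P.pairs
  surjective : ∀ g, ∃ x ∈ P.pairs, δ x = g
  localSection : ∀ x ∈ P.pairs, ∃ (W : Set G'.Arr) (σ : G'.Arr → P.Tot × P.Tot),
    IsOpen W ∧ δ x ∈ W ∧ ContMDiffOn (𝓡 n') ((𝓡 d).prod (𝓡 d)) ∞ σ W ∧ σ (δ x) = x ∧
      ∀ g ∈ W, σ g ∈ P.pairs ∧ δ (σ g) = g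
  fibre : ∀ x ∈ P.pairs, ∀ y ∈ P.pairs, δ x = δ y ↔
    ∃ g, P.momR x.1 = G.tgt g ∧ y = (P.actR x.1 g, P.actR x.2 g)
  src_eq : ∀ x ∈ P.pairs, G'.src (δ x) = P.momL x.2
  tgt_eq : ∀ x ∈ P.pairs, G'.tgt (δ x) = P.momL x.1
  mul_eq : ∀ p₃ p₂ p₁, P.momR p₃ = P.momR p₂ → P.momR p₂ = P.momR p₁ →
    G'.mul (δ (p₃, p₂)) (δ (p₂, p₁)) = δ (p₃, p₁)
  act_eq : ∀ x ∈ P.pairs, P.actL (δ x) x.2 = x.1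

/-- Given `P` between `G'` and `G` and morphisms `π : H → G`, `π' : H' → G'`, the map `ι` identifies
the bibundle `Q` between `H'` and `H` with the fibre product `P ×_M N`, on which `H` acts by
`(p, x) · h = (p · π h, s h)` over the projection to `N`, in such a way that the projection
`Q → P` is compatible with `π'`. -/
structure IsPullback {k k' l l' e : ℕ} {H : LieGroupoid.{u} k l} {H' : LieGroupoid.{u} k' l'}
    (P : Bibundle G' G d) (π : Hom H G) (π' : Hom H' G') (Q : Bibundle H' H e)
    (ι : Q.Tot → P.Tot × H.Obj) : Prop where
  diffeo : IsDiffeoOn (𝓡 e) ((𝓡 d).prod (𝓡 k)) ι Set.univ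
    {x : P.Tot × H.Obj | P.momR x.1 = π.obj x.2}
  momR_eq : ∀ q, Q.momR q = (ι q).2
  actR_eq : ∀ q h, Q.momR q = H.tgt h → ι (Q.actR q h) = (P.actR (ι q).1 (π.arr h), H.src h)
  momL_eq : ∀ q, π'.obj (Q.momL q) = P.momL (ι q).1
  actL_eq : ∀ h q, H'.src h = Q.momL q → (ι (Q.actL h q)).1 = P.actL (π'.arr h) (ι q).1

end Bibundle

end LieGroupoid

end

/-! Because `π` is an action resolution, `H` is the action groupoid of an action of `G` on `N`. This
action is carried through `P`: `G'` acts on the balanced product `N' = P ×_G N`, which is the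
quotient of `Q = P ×_M N` by `H`, and `H'` is the action groupoid `G' ⋉ N'`. The groupoid algebra is
formal. The substance lies in four points.

Smooth division. The arrow carrying `p` to `q` has to depend smoothly on the pair. The orbit map
from a source fibre to a fibre of the moment map is smooth and bijective. If its derivative were
nowhere invertible, countably many null sets would cover an open set (`exists_regular_point`). So it
is regular at one arrow, the inverse function theorem gives smooth division there, and translation
spreads this to all pairs (`divL_smooth`). Continuity of division then also yields properness of the
actions on `Q`.

The manifold `N'`. A local section of `P → M'` selects one representative in each class, which gives
a smooth idempotent of an open saturated subset of `Q`, constant on classes. A smooth idempotent is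
linear in suitable coordinates (`exists_splitting_germ`), so its image supplies charts of the
quotient. Its rank could a priori vary from point to point, but over the dense set where `π` is a
local diffeomorphism the quotient looks like `M'`, which forces the rank to be `m'` everywhere
(`exists_quotient`). The quotient is Hausdorff because the quotient map is open and the relation is
closed, again by continuity of division.

The resolution properties. The arrows of `H'` are the base change of `N' → M'` along the source of
`G'`, and the pullback of `N' → M'` to `P` is `Q → P`, itself the base change of `N → M`.
Surjectivity and properness therefore pass from `N → M` to `N' → M'` by means of local sections of
`P → M'`. The good open set of `M'` is the image of the preimage of `U` in `P`; its complement and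
that of its preimage in `N'` are null because submersions pull null sets back to null sets, and
surjective ones detect them.

Regularity. Corresponding leaves of Morita equivalent groupoids have the same codimension
(`leafDim_add`), so `H'` inherits regularity from `H`. -/

open Set Filter Topology

noncomputable section

/-! ### Maps that are smooth near a point -/

section SmoothNear

variable {E E' E'' H H' H'' X Y Z : Type*}
  [NormedAddCommGroup E] [NormedSpace ℝ E] [TopologicalSpace H]
  [NormedAddCommGroup E'] [NormedSpace ℝ E'] [TopologicalSpace H']
  [NormedAddCommGroup E''] [NormedSpace ℝ E''] [TopologicalSpace H'']
  [TopologicalSpace X] [ChartedSpace H X] [TopologicalSpace Y] [ChartedSpace H' Y]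
  [TopologicalSpace Z] [ChartedSpace H'' Z]
  {I : ModelWithCorners ℝ E H} {J : ModelWithCorners ℝ E' H'} {K : ModelWithCorners ℝ E'' H''}

variable (I J) in
/-- `f` is smooth on a neighbourhood of `x`. -/
def SmoothNear (f : X → Y) (x : X) : Prop := ∀ᶠ y in 𝓝 x, ContMDiffAt I J ∞ f y

namespace SmoothNear

variable {f g : X → Y} {x : X}

lemma contMDiffAt (h : SmoothNear I J f x) : ContMDiffAt I J ∞ f x := h.self_of_nhds

lemma continuousAt (h : SmoothNear I J f x) : ContinuousAt f x := h.contMDiffAt.continuousAt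

lemma tendsto (h : SmoothNear I J f x) {y : Y} (hy : f x = y) : Tendsto f (𝓝 x) (𝓝 y) :=
  hy ▸ h.continuousAt

lemma eventually_mem (h : SmoothNear I J f x) {y : Y} (hy : f x = y) {s : Set Y} (hs : s ∈ 𝓝 y) :
    ∀ᶠ z in 𝓝 x, f z ∈ s := h.tendsto hy hs

lemma eventually (h : SmoothNear I J f x) : ∀ᶠ y in 𝓝 x, SmoothNear I J f y :=
  eventually_eventually_nhds.2 h

lemma congr (h : SmoothNear I J f x) (hfg : f =ᶠ[𝓝 x] g) : SmoothNear I J g x := by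
  filter_upwards [h, eventually_eventually_nhds.2 hfg] with y hy hy'
  exact hy.congr_of_eventuallyEq (hy'.mono fun _ h => h.symm)

lemma comp {g : Y → Z} (hg : SmoothNear J K g (f x)) (hf : SmoothNear I J f x) :
    SmoothNear I K (fun y => g (f y)) x := by
  filter_upwards [hf, hf.continuousAt.eventually hg] with y hy hy'
  exact hy'.comp y hy

lemma prodMk {g : X → Z} (hf : SmoothNear I J f x) (hg : SmoothNear I K g x) :
    SmoothNear I (J.prod K) (fun y => (f y, g y)) x := by
  filter_upwards [hf, hg] with y hy hy'
  exact hy.prodMk hy'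

lemma fst {f : X → Y × Z} (hf : SmoothNear I (J.prod K) f x) :
    SmoothNear I J (fun y => (f y).1) x := hf.mono fun _ hy => hy.fst

lemma snd {f : X → Y × Z} (hf : SmoothNear I (J.prod K) f x) :
    SmoothNear I K (fun y => (f y).2) x := hf.mono fun _ hy => hy.snd

lemma exists_isOpen (hf : SmoothNear I J f x) :
    ∃ U, IsOpen U ∧ x ∈ U ∧ ContMDiffOn I J ∞ f U := by
  obtain ⟨U, hU, hUo, hx⟩ := eventually_nhds_iff.1 hf
  exact ⟨U, hUo, hx, fun y hy => (hU y hy).contMDiffWithinAt⟩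

end SmoothNear

lemma ContMDiffOn.smoothNear {f : X → Y} {s : Set X} {x : X} (hf : ContMDiffOn I J ∞ f s)
    (hs : s ∈ 𝓝 x) : SmoothNear I J f x := by
  filter_upwards [eventually_eventually_nhds.2 hs] with y hy
  exact (hf y hy.self_of_nhds).contMDiffAt hy

lemma ContMDiff.smoothNear {f : X → Y} (hf : ContMDiff I J ∞ f) (x : X) : SmoothNear I J f x :=
  Eventually.of_forall fun y => hf y

lemma contMDiff_of_smoothNear {f : X → Y} (hf : ∀ x, SmoothNear I J f x) : ContMDiff I J ∞ f :=
  fun x => (hf x).contMDiffAt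

lemma smoothNear_id {x : X} : SmoothNear I I (fun y : X => y) x := contMDiff_id.smoothNear x

lemma smoothNear_const {x : X} {c : Y} : SmoothNear I J (fun _ : X => c) x :=
  contMDiff_const.smoothNear x

/-- Composition of a map smooth near `x` with a map smooth on a set containing its values. -/
lemma ContMDiffOn.comp_smoothNear {f : X → Y} {g : Y → Z} {s : Set Y} {x : X}
    (hg : ContMDiffOn J K ∞ g s) (hf : SmoothNear I J f x) (hs : ∀ᶠ y in 𝓝 x, f y ∈ s) :
    SmoothNear I K (fun y => g (f y)) x := by
  filter_upwards [hf, eventually_eventually_nhds.2 hs] with y hy hy'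
  have h1 : ContMDiffWithinAt I K ∞ (g ∘ f) (f ⁻¹' s) y :=
    (hg (f y) hy'.self_of_nhds).comp y hy.contMDiffWithinAt fun _ h => h
  exact h1.contMDiffAt hy'

/-- A map which is the restriction to `s` of maps smooth near the points of `s` is smooth on `s`. -/
lemma contMDiffOn_of_smoothNear {f : X → Y} {s : Set X}
    (h : ∀ x ∈ s, ∃ g : X → Y, SmoothNear I J g x ∧ ∀ᶠ y in 𝓝 x, y ∈ s → g y = f y) :
    ContMDiffOn I J ∞ f s := by
  intro x hx
  obtain ⟨g, hg, hgf⟩ := h x hx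
  refine hg.contMDiffAt.contMDiffWithinAt.congr_of_eventuallyEq ?_ (hgf.self_of_nhds hx).symm
  filter_upwards [nhdsWithin_le_nhds hgf, self_mem_nhdsWithin] with y hy hys
  exact (hy hys).symm

lemma smoothNear_iff_contDiff {f : E → E'} {x : E} :
    SmoothNear 𝓘(ℝ, E) 𝓘(ℝ, E') f x ↔ ∀ᶠ y in 𝓝 x, ContDiffAt ℝ ∞ f y := by
  simp only [SmoothNear, contMDiffAt_iff_contDiffAt]

end SmoothNear

/-! ### The inverse function theorem and splittings of smooth idempotents -/

/-- The usual inverse function theorem gives smoothness of the inverse at one point only. Invertible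
operators form an open set, so after shrinking the source the derivative is invertible throughout
and the inverse is smooth on the whole target. -/
theorem SmoothNear.exists_openPartialHomeomorph {E F : Type*} [NormedAddCommGroup E]
    [NormedSpace ℝ E] [CompleteSpace E] [NormedAddCommGroup F] [NormedSpace ℝ F]
    {f : E → F} {a : E} (hf : SmoothNear 𝓘(ℝ, E) 𝓘(ℝ, F) f a) (f' : E ≃L[ℝ] F)
    (hf' : HasFDerivAt f (f' : E →L[ℝ] F) a) :
    ∃ e : OpenPartialHomeomorph E F, a ∈ e.source ∧ (∀ x, e x = f x) ∧
      ContDiffOn ℝ ∞ e e.source ∧ ContDiffOn ℝ ∞ e.symm e.target := by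
  rw [smoothNear_iff_contDiff] at hf
  have h0 := hf.self_of_nhds
  have hn : (∞ : WithTop ℕ∞) ≠ 0 := by simp
  have hc : ContinuousAt (fderiv ℝ f) a := by
    have : ContDiffAt ℝ 0 (fderiv ℝ f) a := h0.fderiv_right (m := 0) (by simp)
    exact this.continuousAt
  have hr : ∀ᶠ x in 𝓝 a, fderiv ℝ f x ∈ range ((↑) : (E ≃L[ℝ] F) → E →L[ℝ] F) := by
    refine hc.eventually (ContinuousLinearEquiv.isOpen.mem_nhds ?_)
    exact ⟨f', hf'.fderiv.symm⟩
  obtain ⟨U, hU, hUo, haU⟩ := eventually_nhds_iff.1 (hf.and hr)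
  set e := (h0.toOpenPartialHomeomorph f hf' hn).restrOpen U hUo with he
  have hef : ∀ x, e x = f x := fun x => by
    rw [he]; rfl
  have hsrc : ∀ x ∈ e.source, x ∈ U := fun x hx => by
    rw [he, OpenPartialHomeomorph.restrOpen_source] at hx; exact hx.2
  have hef' : (e : E → F) = f := funext hef
  refine ⟨e, ?_, hef, ?_, ?_⟩
  · rw [he, OpenPartialHomeomorph.restrOpen_source]
    exact ⟨h0.mem_toOpenPartialHomeomorph_source hf' hn, haU⟩
  · intro x hx
    rw [hef']
    exact (hU x (hsrc x hx)).1.contDiffWithinAt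
  · intro y hy
    obtain ⟨hs, g', hg'⟩ := hU _ (hsrc _ (e.map_target hy))
    refine (e.contDiffAt_symm (f₀' := g') hy ?_ ?_).contDiffWithinAt
    · rw [hef', hg']; exact (hs.differentiableAt hn).hasFDerivAt
    · rw [hef']; exact hs

section Charts

variable {d : ℕ} {X : Type*} [TopologicalSpace X] [ChartedSpace (EuclideanSpace ℝ (Fin d)) X]
  [IsManifold (𝓡 d) ∞ X]

lemma smoothNear_chartAt (x : X) {y : X} (hy : y ∈ (chartAt (EuclideanSpace ℝ (Fin d)) x).source) :
    SmoothNear (𝓡 d) (𝓡 d) (chartAt (EuclideanSpace ℝ (Fin d)) x) y :=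
  contMDiffOn_chart.smoothNear ((chartAt _ x).open_source.mem_nhds hy)

lemma smoothNear_chartAt_symm (x : X) {y : EuclideanSpace ℝ (Fin d)}
    (hy : y ∈ (chartAt (EuclideanSpace ℝ (Fin d)) x).target) :
    SmoothNear (𝓡 d) (𝓡 d) (chartAt (EuclideanSpace ℝ (Fin d)) x).symm y :=
  contMDiffOn_chart_symm.smoothNear ((chartAt _ x).open_target.mem_nhds hy)

lemma smoothNear_continuousLinearMap {E F : Type*} [NormedAddCommGroup E]
    [NormedSpace ℝ E] [NormedAddCommGroup F] [NormedSpace ℝ F] (L : E →L[ℝ] F) (x : E) :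
    SmoothNear 𝓘(ℝ, E) 𝓘(ℝ, F) L x := L.contMDiff.smoothNear x

/-- A smooth idempotent splits near a fixed point through a Euclidean space. -/
theorem exists_splitting_germ {ρ : X → X} {x : X} (hρ : SmoothNear (𝓡 d) (𝓡 d) ρ x)
    (hx : ρ x = x) (hid : ∀ᶠ y in 𝓝 x, ρ (ρ y) = ρ y) :
    ∃ (r : ℕ) (a : X → EuclideanSpace ℝ (Fin r)) (b : EuclideanSpace ℝ (Fin r) → X),
      SmoothNear (𝓡 d) (𝓡 r) a x ∧ SmoothNear (𝓡 r) (𝓡 d) b (a x) ∧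
      (∀ᶠ y in 𝓝 x, b (a y) = ρ y) ∧ ∀ᶠ v in 𝓝 (a x), a (b v) = v := by
  set φ := chartAt (EuclideanSpace ℝ (Fin d)) x with hφ
  have hxs : x ∈ φ.source := mem_chart_source _ x
  have hz : φ x ∈ φ.target := φ.map_source hxs
  set z := φ x with hzdef
  have hφz : φ.symm z = x := φ.left_inv hxs
  have hφs : SmoothNear (𝓡 d) (𝓡 d) φ.symm z := smoothNear_chartAt_symm x hz
  have hφf : SmoothNear (𝓡 d) (𝓡 d) φ x := smoothNear_chartAt x hxs
  set R : EuclideanSpace ℝ (Fin d) → EuclideanSpace ℝ (Fin d) := fun y => φ (ρ (φ.symm y)) with hR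
  have hRs : SmoothNear (𝓡 d) (𝓡 d) R z := by
    refine SmoothNear.comp (J := 𝓡 d) (f := fun y => ρ (φ.symm y)) ?_
      (SmoothNear.comp (J := 𝓡 d) ?_ hφs)
    · rw [hφz, hx]; exact hφf
    · rw [hφz]; exact hρ
  have hRz : R z = z := by simp only [hR, hφz, hx]; rfl
  have hev1 : ∀ᶠ y in 𝓝 x, ρ y ∈ φ.source :=
    hρ.continuousAt.eventually (by rw [hx]; exact φ.open_source.mem_nhds hxs)
  have hφsz : Tendsto φ.symm (𝓝 z) (𝓝 x) := by
    have := hφs.continuousAt; rwa [ContinuousAt, hφz] at this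
  have hRR : ∀ᶠ y in 𝓝 z, R (R y) = R y := by
    filter_upwards [hφsz.eventually hev1, hφsz.eventually hid] with y h1 h2
    simp only [hR]
    rw [φ.left_inv h1, h2]
  have hRd : HasFDerivAt R (fderiv ℝ R z) z :=
    ((smoothNear_iff_contDiff.1 hRs).self_of_nhds.differentiableAt (by simp)).hasFDerivAt
  set A := fderiv ℝ R z with hA
  have hAA : A.comp A = A := by
    have h1 : HasFDerivAt (fun y => R (R y)) (A.comp A) z := by
      refine HasFDerivAt.comp (g := R) z ?_ hRd
      rw [hRz]; exact hRd
    exact (h1.congr_of_eventuallyEq (hRR.mono fun _ h => h.symm)).unique hRd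
  have hAA' : ∀ v, A (A v) = A v := fun v => by
    conv_rhs => rw [← hAA]
    rfl
  -- `Φ = A R + (1 - A)(1 - R)`. Its derivative at `z` is `A² + (1 - A)² = 1` since `A` is
  -- idempotent, and `Φ R = A Φ` since `R` is. Thus `Φ` is a coordinate change that conjugates `R`
  -- to the linear projection `A`.
  set Φ : EuclideanSpace ℝ (Fin d) → EuclideanSpace ℝ (Fin d) :=
    fun y => A (R y) + ((y - R y) - A (y - R y)) with hΦ
  have hΦs : SmoothNear (𝓡 d) (𝓡 d) Φ z := by
    rw [smoothNear_iff_contDiff] at hRs ⊢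
    filter_upwards [hRs] with y hy
    simp only [hΦ]
    fun_prop
  have hΦd : HasFDerivAt Φ (ContinuousLinearEquiv.refl ℝ (EuclideanSpace ℝ (Fin d)) :
      EuclideanSpace ℝ (Fin d) →L[ℝ] EuclideanSpace ℝ (Fin d)) z := by
    have h1 : HasFDerivAt Φ (A.comp A + ((ContinuousLinearMap.id ℝ _ - A) -
        A.comp (ContinuousLinearMap.id ℝ _ - A))) z := by
      have h2 := (hasFDerivAt_id (𝕜 := ℝ) z).sub hRd
      exact (A.hasFDerivAt.comp z hRd).add (h2.sub (A.hasFDerivAt.comp z h2))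
    convert h1 using 1
    ext1 v
    simp [hAA']
  obtain ⟨e, hze, hef, he1, he2⟩ := hΦs.exists_openPartialHomeomorph _ hΦd
  have hAΦ : ∀ y, A (Φ y) = A (R y) := fun y => by simp [hΦ, hAA']
  have hΦR : ∀ᶠ y in 𝓝 z, Φ (R y) = A (Φ y) := by
    filter_upwards [hRR] with y hy
    rw [hAΦ]; simp [hΦ, hy]
  have hez : e z ∈ e.target := e.map_source hze
  -- The splitting of `R` is now the linear one: `A` factors through its range, identified with a
  -- Euclidean space, as `Li ∘ LA` with `LA ∘ Li = 1`.
  let S := LinearMap.range (A : EuclideanSpace ℝ (Fin d) →ₗ[ℝ] EuclideanSpace ℝ (Fin d))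
  let L : S ≃L[ℝ] EuclideanSpace ℝ (Fin (Module.finrank ℝ S)) :=
    ContinuousLinearEquiv.ofFinrankEq (by simp)
  let AS : EuclideanSpace ℝ (Fin d) →L[ℝ] S := A.codRestrict S fun v => ⟨v, rfl⟩
  have hASv : ∀ v, ((AS v : S) : EuclideanSpace ℝ (Fin d)) = A v := fun v => rfl
  have hAS : ∀ w : S, AS (w : EuclideanSpace ℝ (Fin d)) = w := by
    rintro ⟨w, v, rfl⟩
    exact Subtype.ext (hAA' v)
  let LA := L.toContinuousLinearMap.comp AS
  let Li := S.subtypeL.comp L.symm.toContinuousLinearMap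
  have hLi : ∀ v, Li (LA v) = A v := fun v => by simp [LA, Li, hASv]
  have hLA : ∀ v, LA (Li v) = v := fun v => by simp [LA, Li, hAS]
  have hΦz : A (Φ z) = e z := by
    rw [hef, ← hΦR.self_of_nhds, hRz]
  refine ⟨_, fun y => LA (Φ (φ y)), fun v => φ.symm (e.symm (Li v)), ?_, ?_, ?_, ?_⟩
  · exact (smoothNear_continuousLinearMap LA _).comp (hΦs.comp hφf)
  · have h1 : e.symm (Li (LA (Φ (φ x)))) = z := by
      rw [hLi, ← hzdef, hΦz, e.left_inv hze]
    refine SmoothNear.comp (J := 𝓡 d) (f := fun v => e.symm (Li v)) ?_ (SmoothNear.comp (J := 𝓡 d) ?_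
      (smoothNear_continuousLinearMap Li _))
    · rw [h1]; exact hφs
    · rw [hLi, ← hzdef, hΦz]
      exact (contMDiffOn_iff_contDiffOn.2 he2).smoothNear (e.open_target.mem_nhds hez)
  · have h3 : ∀ᶠ y in 𝓝 z, R y ∈ e.source :=
      hRs.continuousAt.eventually (by rw [hRz]; exact e.open_source.mem_nhds hze)
    filter_upwards [hev1, hφf.continuousAt.eventually hΦR, hφf.continuousAt.eventually h3,
      φ.open_source.mem_nhds hxs] with y h1 h2 h3 h4
    rw [hLi, ← h2, ← hef, e.left_inv h3]
    simp only [hR]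
    rw [φ.left_inv h4, φ.left_inv h1]
  · have h1 : Tendsto Li (𝓝 (LA (Φ (φ x)))) (𝓝 (e z)) := by
      have := Li.continuous.tendsto (LA (Φ (φ x)))
      rwa [hLi, ← hzdef, hΦz] at this
    have h2 : Tendsto (fun v => e.symm (Li v)) (𝓝 (LA (Φ (φ x)))) (𝓝 z) := by
      have := (e.continuousAt_symm hez).tendsto.comp h1
      rwa [e.left_inv hze] at this
    filter_upwards [h1.eventually (e.open_target.mem_nhds hez),
      h2.eventually (φ.open_target.mem_nhds hz)] with v hv hv'
    rw [φ.right_inv hv', ← hef, e.right_inv hv, hLA]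

/-- A smooth idempotent splits on an arbitrarily small neighbourhood of a fixed point through an
open subset of a Euclidean space. -/
theorem exists_splitting {ρ : X → X} {x : X} (hρ : SmoothNear (𝓡 d) (𝓡 d) ρ x)
    (hx : ρ x = x) (hid : ∀ᶠ y in 𝓝 x, ρ (ρ y) = ρ y) {O : Set X} (hO : O ∈ 𝓝 x) :
    ∃ (r : ℕ) (a : X → EuclideanSpace ℝ (Fin r)) (b : EuclideanSpace ℝ (Fin r) → X)
      (N : Set X) (V : Set (EuclideanSpace ℝ (Fin r))),
      IsOpen N ∧ IsOpen V ∧ x ∈ N ∧ N ⊆ O ∧ ContMDiffOn (𝓡 d) (𝓡 r) ∞ a N ∧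
      ContMDiffOn (𝓡 r) (𝓡 d) ∞ b V ∧ MapsTo a N V ∧ MapsTo b V N ∧
      (∀ y ∈ N, b (a y) = ρ y) ∧ ∀ v ∈ V, a (b v) = v := by
  obtain ⟨r, a, b, ha, hb, hba, hab⟩ := exists_splitting_germ hρ hx hid
  have hbax : b (a x) = x := by rw [hba.self_of_nhds, hx]
  obtain ⟨N₁, hN₁, hN₁o, hxN⟩ := eventually_nhds_iff.1 ((ha.and hba).and hO)
  have hO' : ∀ y ∈ N₁, y ∈ O := fun y hy => (hN₁ y hy).2
  have hbN : ∀ᶠ v in 𝓝 (a x), b v ∈ N₁ :=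
    hb.continuousAt.eventually (by rw [hbax]; exact hN₁o.mem_nhds hxN)
  obtain ⟨V, hV, hVo, hxV⟩ := eventually_nhds_iff.1 ((hb.and hab).and hbN)
  have haN : ContMDiffOn (𝓡 d) (𝓡 r) ∞ a N₁ := fun y hy => (hN₁ y hy).1.1.contMDiffWithinAt
  -- Cutting the source down to the preimage of `V` keeps the image of `b` inside it, because `a (b
  -- v) = v`.
  refine ⟨r, a, b, N₁ ∩ a ⁻¹' V, V, haN.continuousOn.isOpen_inter_preimage hN₁o hVo, hVo,
    ⟨hxN, hxV⟩, fun y hy => hO' y hy.1, haN.mono inter_subset_left,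
    fun v hv => (hV v hv).1.1.contMDiffWithinAt, fun y hy => hy.2, fun v hv => ⟨(hV v hv).2, ?_⟩,
    fun y hy => (hN₁ y hy.1).1.2, fun v hv => (hV v hv).1.2⟩
  rw [mem_preimage, (hV v hv).1.2]; exact hv

end Charts

/-- The manifold defined by a family of smoothly compatible charts. -/
def SmoothMfd.ofCharts {d : ℕ} (X : Type u) [TopologicalSpace X] [T2Space X]
    [SecondCountableTopology X] (c : X → OpenPartialHomeomorph X (EuclideanSpace ℝ (Fin d)))
    (hc : ∀ x, x ∈ (c x).source)
    (hcc : ∀ x y, ContDiffOn ℝ ∞ ((c x).symm ≫ₕ c y) ((c x).symm ≫ₕ c y).source) :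
    SmoothMfd.{u} d :=
  letI cs : ChartedSpace (EuclideanSpace ℝ (Fin d)) X :=
    { atlas := range c
      chartAt := c
      mem_chart_source := hc
      chart_mem_atlas := fun x => ⟨x, rfl⟩ }
  haveI : IsManifold (𝓡 d) ∞ X := isManifold_of_contDiffOn _ _ _ (by
    rintro _ _ ⟨x, rfl⟩ ⟨y, rfl⟩
    simpa using hcc x y)
  { carrier := X }

/-! ### Submersions -/

section Submersion

variable {n m : ℕ} {X Y : Type*}
  [TopologicalSpace X] [ChartedSpace (EuclideanSpace ℝ (Fin n)) X]
  [TopologicalSpace Y] [ChartedSpace (EuclideanSpace ℝ (Fin m)) Y]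

variable (n m) in
/-- Near `x`, the maps `(f, pr)` and `κ` are mutually inverse diffeomorphisms between `X` and
`Y × ℝᶜ`. -/
structure IsLocalProduct (f : X → Y) (x : X) {c : ℕ} (pr : X → EuclideanSpace ℝ (Fin c))
    (κ : Y × EuclideanSpace ℝ (Fin c) → X) : Prop where
  smooth : SmoothNear (𝓡 n) (𝓡 m) f x
  smooth_pr : SmoothNear (𝓡 n) (𝓡 c) pr x
  smooth_κ : SmoothNear ((𝓡 m).prod (𝓡 c)) (𝓡 n) κ (f x, pr x)
  left_inv : ∀ᶠ z in 𝓝 x, κ (f z, pr z) = z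
  right_inv : ∀ᶠ w in 𝓝 (f x, pr x), f (κ w) = w.1 ∧ pr (κ w) = w.2

/-- A submersion is locally a projection `Y × ℝᶜ → Y`. -/
theorem Manifold.IsSubmersionAt.exists_isLocalProduct [IsManifold (𝓡 n) ∞ X]
    [IsManifold (𝓡 m) ∞ Y] {f : X → Y} {x : X}
    (hf : IsSubmersionAt (𝓡 n) (𝓡 m) ∞ f x) :
    m ≤ n ∧ ∃ (pr : X → EuclideanSpace ℝ (Fin (n - m)))
      (κ : Y × EuclideanSpace ℝ (Fin (n - m)) → X), IsLocalProduct n m f x pr κ := by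
  obtain ⟨F, _, _, h⟩ := hf
  have : FiniteDimensional ℝ F := by
    have : FiniteDimensional ℝ (EuclideanSpace ℝ (Fin m) × F) :=
      h.equiv.toLinearEquiv.finiteDimensional
    exact Module.Finite.of_surjective (LinearMap.snd ℝ (EuclideanSpace ℝ (Fin m)) F)
      LinearMap.snd_surjective
  have hdim : n = m + Module.finrank ℝ F := by
    have := h.equiv.toLinearEquiv.finrank_eq
    simpa [Module.finrank_prod] using this
  refine ⟨by omega, ?_⟩
  let L : F ≃L[ℝ] EuclideanSpace ℝ (Fin (n - m)) :=
    ContinuousLinearEquiv.ofFinrankEq (by simp; omega)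
  have hx := h.mem_domChart_source
  have hfx := h.mem_codChart_source
  have hφ := contMDiffOn_of_mem_maximalAtlas h.domChart_mem_maximalAtlas
  have hφ' := contMDiffOn_symm_of_mem_maximalAtlas h.domChart_mem_maximalAtlas
  have hψ := contMDiffOn_of_mem_maximalAtlas h.codChart_mem_maximalAtlas
  have hw : ∀ u ∈ h.domChart.target, h.codChart (f (h.domChart.symm u)) = (h.equiv u).1 := by
    intro u hu
    have h0 : u ∈ (h.domChart.extend (𝓡 n)).target := by simpa using hu
    have := h.writtenInCharts h0
    simpa using this
  have hsrc := h.source_subset_preimage_source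
  set φ := h.domChart
  set ψ := h.codChart
  set e := h.equiv
  have hw' : ∀ z ∈ φ.source, ψ (f z) = (e (φ z)).1 := fun z hz => by
    rw [← hw _ (φ.map_source hz), φ.left_inv hz]
  have hφx := hφ.smoothNear (φ.open_source.mem_nhds hx)
  have hφx' := hφ'.smoothNear (φ.open_target.mem_nhds (φ.map_source hx))
  have hψx := hψ.smoothNear (ψ.open_source.mem_nhds hfx)
  have hfs : SmoothNear (𝓡 n) (𝓡 m) f x :=
    h.contMDiffOn.smoothNear (φ.open_source.mem_nhds hx)
  have key : ∀ z ∈ φ.source, e.symm (ψ (f z), L.symm (L (e (φ z)).2)) = φ z := fun z hz => by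
    rw [hw' z hz, L.symm_apply_apply, Prod.mk.eta, e.symm_apply_apply]
  let E₂ := (ContinuousLinearMap.snd ℝ (EuclideanSpace ℝ (Fin m)) F).comp e.toContinuousLinearMap
  let M : EuclideanSpace ℝ (Fin m) × EuclideanSpace ℝ (Fin (n - m)) →L[ℝ]
      EuclideanSpace ℝ (Fin n) := e.symm.toContinuousLinearMap.comp
    ((ContinuousLinearMap.fst ℝ _ _).prod
      (L.symm.toContinuousLinearMap.comp (ContinuousLinearMap.snd ℝ _ _)))
  have hM : SmoothNear ((𝓡 m).prod (𝓡 (n - m))) (𝓡 n) M (ψ (f x), L (e (φ x)).2) := by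
    have := M.contMDiff.smoothNear (ψ (f x), L (e (φ x)).2)
    rwa [modelWithCornersSelf_prod, ← chartedSpaceSelf_prod] at this
  have hin : SmoothNear ((𝓡 m).prod (𝓡 (n - m))) (𝓡 n)
      (fun w : Y × EuclideanSpace ℝ (Fin (n - m)) => M (ψ w.1, w.2)) (f x, L (e (φ x)).2) := by
    refine SmoothNear.comp (J := (𝓡 m).prod (𝓡 (n - m))) (g := M)
      (f := fun w : Y × EuclideanSpace ℝ (Fin (n - m)) => (ψ w.1, w.2)) hM ?_
    exact SmoothNear.prodMk (SmoothNear.comp (J := 𝓡 m) hψx smoothNear_id.fst) smoothNear_id.snd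
  have hMx : M (ψ (f x), L (e (φ x)).2) = φ x := key x hx
  refine ⟨fun z => L (e (φ z)).2, fun w => φ.symm (M (ψ w.1, w.2)), hfs, ?_, ?_, ?_, ?_⟩
  · exact (smoothNear_continuousLinearMap (L.toContinuousLinearMap.comp E₂) _).comp hφx
  · refine SmoothNear.comp (J := 𝓡 n) (g := φ.symm) ?_ hin
    rw [hMx]; exact hφx'
  · filter_upwards [φ.open_source.mem_nhds hx] with z hz
    exact (congrArg φ.symm (key z hz)).trans (φ.left_inv hz)
  · have h1 : ∀ᶠ w in 𝓝 (f x, L (e (φ x)).2), M (ψ w.1, w.2) ∈ φ.target := by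
      refine hin.continuousAt.eventually (p := fun u => u ∈ φ.target) ?_
      change φ.target ∈ 𝓝 (M (ψ (f x), L (e (φ x)).2))
      rw [hMx]
      exact φ.open_target.mem_nhds (φ.map_source hx)
    have h2 : ∀ᶠ w in 𝓝 (f x, L (e (φ x)).2), w.1 ∈ ψ.source :=
      continuousAt_fst.eventually (ψ.open_source.mem_nhds hfx)
    filter_upwards [h1, h2] with w hw1 hw2
    have h3 : e (M (ψ w.1, w.2)) = (ψ w.1, L.symm w.2) := e.apply_symm_apply _
    constructor
    · refine ψ.injOn (hsrc (φ.map_target hw1)) hw2 ?_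
      rw [hw _ hw1, h3]
    · rw [φ.right_inv hw1, h3, L.apply_symm_apply]

namespace IsLocalProduct

variable {f : X → Y} {x : X} {c : ℕ} {pr : X → EuclideanSpace ℝ (Fin c)}
  {κ : Y × EuclideanSpace ℝ (Fin c) → X}

lemma κ_apply (h : IsLocalProduct n m f x pr κ) : κ (f x, pr x) = x := h.left_inv.self_of_nhds

/-- The local section through `x` of a local product. -/
lemma exists_localSection (h : IsLocalProduct n m f x pr κ) :
    ∃ σ : Y → X, SmoothNear (𝓡 m) (𝓡 n) σ (f x) ∧ σ (f x) = x ∧ ∀ᶠ y in 𝓝 (f x), f (σ y) = y := by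
  have hs : SmoothNear (𝓡 m) ((𝓡 m).prod (𝓡 c)) (fun y : Y => (y, pr x)) (f x) :=
    smoothNear_id.prodMk smoothNear_const
  exact ⟨fun y => κ (y, pr x), h.smooth_κ.comp (f := fun y : Y => (y, pr x)) hs, h.κ_apply,
    (hs.continuousAt.eventually h.right_inv).mono fun _ hy => hy.1⟩

end IsLocalProduct

theorem Manifold.IsSubmersion.exists_localSection [IsManifold (𝓡 n) ∞ X]
    [IsManifold (𝓡 m) ∞ Y] {f : X → Y} (hf : IsSubmersion (𝓡 n) (𝓡 m) ∞ f) (x : X) :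
    ∃ σ : Y → X, SmoothNear (𝓡 m) (𝓡 n) σ (f x) ∧ σ (f x) = x ∧
      ∀ᶠ y in 𝓝 (f x), f (σ y) = y := by
  obtain ⟨-, pr, κ, h⟩ := (hf.isSubmersionAt x).exists_isLocalProduct
  exact h.exists_localSection

/-- A smooth map with a smooth local section through a point is a submersion at this point. -/
theorem isSubmersionAtOfComplement_of_localSection [IsManifold (𝓡 n) ∞ X]
    [IsManifold (𝓡 m) ∞ Y] {f : X → Y} {x : X} (hf : SmoothNear (𝓡 n) (𝓡 m) f x)
    {σ : Y → X} (hσ : SmoothNear (𝓡 m) (𝓡 n) σ (f x)) (hσx : σ (f x) = x)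
    (hfσ : ∀ᶠ y in 𝓝 (f x), f (σ y) = y) :
    Manifold.IsSubmersionAtOfComplement (EuclideanSpace ℝ (Fin (n - m))) (𝓡 n) (𝓡 m) ∞ f x := by
  set φ := chartAt (EuclideanSpace ℝ (Fin n)) x
  set ψ := chartAt (EuclideanSpace ℝ (Fin m)) (f x)
  have hxs : x ∈ φ.source := mem_chart_source _ x
  have hys : f x ∈ ψ.source := mem_chart_source _ (f x)
  have hφx : φ.symm (φ x) = x := φ.left_inv hxs
  have hψx : ψ.symm (ψ (f x)) = f x := ψ.left_inv hys
  have hφ : SmoothNear (𝓡 n) (𝓡 n) φ x := smoothNear_chartAt x hxs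
  have hφ' : SmoothNear (𝓡 n) (𝓡 n) φ.symm (φ x) := smoothNear_chartAt_symm x (φ.map_source hxs)
  have hψ : SmoothNear (𝓡 m) (𝓡 m) ψ (f x) := smoothNear_chartAt _ hys
  have hψ' : SmoothNear (𝓡 m) (𝓡 m) ψ.symm (ψ (f x)) :=
    smoothNear_chartAt_symm _ (ψ.map_source hys)
  set F : EuclideanSpace ℝ (Fin n) → EuclideanSpace ℝ (Fin m) :=
    fun u => ψ (f (φ.symm u)) with hF
  set G : EuclideanSpace ℝ (Fin m) → EuclideanSpace ℝ (Fin n) :=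
    fun v => φ (σ (ψ.symm v)) with hG
  have hFs : SmoothNear (𝓡 n) (𝓡 m) F (φ x) := by
    refine SmoothNear.comp (J := 𝓡 m) (f := fun u => f (φ.symm u)) ?_
      (SmoothNear.comp (J := 𝓡 n) ?_ hφ')
    · rw [hφx]; exact hψ
    · rw [hφx]; exact hf
  have hGs : SmoothNear (𝓡 m) (𝓡 n) G (ψ (f x)) := by
    refine SmoothNear.comp (J := 𝓡 n) (f := fun u => σ (ψ.symm u)) ?_
      (SmoothNear.comp (J := 𝓡 m) ?_ hψ')
    · rw [hψx, hσx]; exact hφ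
    · rw [hψx]; exact hσ
  have hFx : F (φ x) = ψ (f x) := by simp only [hF, hφx]
  have hGx : G (ψ (f x)) = φ x := by simp only [hG, hψx, hσx]
  have hFG : ∀ᶠ v in 𝓝 (ψ (f x)), F (G v) = v := by
    have h1 : Tendsto ψ.symm (𝓝 (ψ (f x))) (𝓝 (f x)) := by
      have := hψ'.continuousAt; rwa [ContinuousAt, hψx] at this
    have h2 : ∀ᶠ y in 𝓝 (f x), σ y ∈ φ.source :=
      hσ.continuousAt.eventually (by rw [hσx]; exact φ.open_source.mem_nhds hxs)
    filter_upwards [h1.eventually h2, h1.eventually hfσ,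
      ψ.open_target.mem_nhds (ψ.map_source hys)] with v h3 h4 h5
    simp only [hF, hG]
    rw [φ.left_inv h3, h4, ψ.right_inv h5]
  have hdiff {k l : ℕ} {q : EuclideanSpace ℝ (Fin k) → EuclideanSpace ℝ (Fin l)}
      {z : EuclideanSpace ℝ (Fin k)} (hq : SmoothNear (𝓡 k) (𝓡 l) q z) :
      HasFDerivAt q (fderiv ℝ q z) z :=
    ((smoothNear_iff_contDiff.1 hq).self_of_nhds.differentiableAt (by simp)).hasFDerivAt
  set B := fderiv ℝ F (φ x) with hB
  set S := fderiv ℝ G (ψ (f x)) with hS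
  have hBS : ∀ v, B (S v) = v := by
    have h1 : HasFDerivAt (fun v => F (G v)) (B.comp S) (ψ (f x)) := by
      refine HasFDerivAt.comp (g := F) _ ?_ (hdiff hGs)
      rw [hGx]; exact hdiff hFs
    have h2 := (h1.congr_of_eventuallyEq (hFG.mono fun _ h => h.symm)).unique (hasFDerivAt_id _)
    intro v
    exact congrArg (fun T : EuclideanSpace ℝ (Fin m) →L[ℝ] EuclideanSpace ℝ (Fin m) => T v) h2
  -- A correction of the chart: `B ∘ Φ = F` because `B S = 1`, and the derivative at the base point
  -- is `S B + (1 - S B) = 1`. In the coordinates `Φ` the map becomes the linear surjection `B`.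
  set Φ : EuclideanSpace ℝ (Fin n) → EuclideanSpace ℝ (Fin n) :=
    fun u => S (F u) + (u - S (B u)) with hΦ
  have hΦs : SmoothNear (𝓡 n) (𝓡 n) Φ (φ x) := by
    have hFs' := hFs
    rw [smoothNear_iff_contDiff] at hFs' ⊢
    filter_upwards [hFs'] with y hy
    simp only [hΦ]
    fun_prop
  have hΦd : HasFDerivAt Φ (ContinuousLinearEquiv.refl ℝ (EuclideanSpace ℝ (Fin n)) :
      EuclideanSpace ℝ (Fin n) →L[ℝ] EuclideanSpace ℝ (Fin n)) (φ x) := by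
    have h1 : HasFDerivAt Φ (S.comp B + (ContinuousLinearMap.id ℝ _ - S.comp B)) (φ x) :=
      (S.hasFDerivAt.comp _ (hdiff hFs)).add ((hasFDerivAt_id _).sub (S.comp B).hasFDerivAt)
    convert h1 using 1
    ext1 v
    simp
  have hBΦ : ∀ u, B (Φ u) = F u := fun u => by simp [hΦ, hBS]
  obtain ⟨e, hxe, hef, he1, he2⟩ := hΦs.exists_openPartialHomeomorph _ hΦd
  obtain ⟨U, hUo, hxU, hfU⟩ := hf.exists_isOpen
  have hker : Module.finrank ℝ B.ker = n - m := by
    have h1 : Function.Surjective B.toLinearMap := fun v => ⟨S v, hBS v⟩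
    have h2 := LinearMap.finrank_range_add_finrank_ker B.toLinearMap
    rw [LinearMap.range_eq_top.2 h1] at h2
    simp at h2
    omega
  let L : B.ker ≃L[ℝ] EuclideanSpace ℝ (Fin (n - m)) :=
    ContinuousLinearEquiv.ofFinrankEq (by rw [hker]; simp)
  let eq : EuclideanSpace ℝ (Fin n) ≃L[ℝ]
      EuclideanSpace ℝ (Fin m) × EuclideanSpace ℝ (Fin (n - m)) :=
    (ContinuousLinearEquiv.equivOfRightInverse B S hBS).trans
      ((ContinuousLinearEquiv.refl ℝ _).prodCongr L)
  have he : φ ≫ₕ e ∈ IsManifold.maximalAtlas (𝓡 n) ∞ X := by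
    refine OpenPartialHomeomorph.mem_maximalAtlas_of_contMDiffOn (I := 𝓡 n) (φ ≫ₕ e) ?_ ?_
    · rw [OpenPartialHomeomorph.trans_source]
      exact (contMDiffOn_iff_contDiffOn.2 he1).comp (contMDiffOn_chart.mono inter_subset_left)
        fun y hy => hy.2
    · rw [OpenPartialHomeomorph.trans_target]
      exact contMDiffOn_chart_symm.comp
        ((contMDiffOn_iff_contDiffOn.2 he2).mono inter_subset_left) fun y hy => hy.2
  refine Manifold.IsSubmersionAtOfComplement.mk_of_continuousAt hf.continuousAt eq (φ ≫ₕ e) ψ ?_ hys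
    he (IsManifold.chart_mem_maximalAtlas _) ?_
  · rw [OpenPartialHomeomorph.trans_source]
    exact ⟨hxs, hxe⟩
  · intro v hv
    have hv' : v ∈ (φ ≫ₕ e).target := by simpa using hv
    rw [OpenPartialHomeomorph.trans_target] at hv'
    have h1 : (eq v).1 = B v := rfl
    have h2 : F (e.symm v) = B v := by rw [← hBΦ, ← hef, e.right_inv hv'.1]
    simpa [h1, hF] using h2

/-- A map which is smooth and has smooth local sections through every point is a submersion. -/
theorem isSubmersion_of_localSections [IsManifold (𝓡 n) ∞ X]
    [IsManifold (𝓡 m) ∞ Y] {f : X → Y} (hf : ContMDiff (𝓡 n) (𝓡 m) ∞ f)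
    (h : ∀ x, ∃ σ : Y → X, SmoothNear (𝓡 m) (𝓡 n) σ (f x) ∧ σ (f x) = x ∧
      ∀ᶠ y in 𝓝 (f x), f (σ y) = y) :
    Manifold.IsSubmersion (𝓡 n) (𝓡 m) ∞ f := by
  refine Manifold.IsSubmersionOfComplement.isSubmersion
    (F := EuclideanSpace ℝ (Fin (n - m))) fun x => ?_
  obtain ⟨σ, h1, h2, h3⟩ := h x
  exact isSubmersionAtOfComplement_of_localSection (hf.smoothNear x) h1 h2 h3

/-- Submersions are open maps: a local version. -/
lemma isOpenMap_of_localSections {f : X → Y}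
    (h : ∀ x, ∃ σ : Y → X, SmoothNear (𝓡 m) (𝓡 n) σ (f x) ∧ σ (f x) = x ∧
      ∀ᶠ y in 𝓝 (f x), f (σ y) = y) : IsOpenMap f := by
  refine IsOpenMap.of_nhds_le fun x => ?_
  obtain ⟨σ, h1, h2, h3⟩ := h x
  intro s hs
  have h4 := h1.continuousAt
  rw [ContinuousAt, h2] at h4
  filter_upwards [h3, h4 hs] with y hy hy'
  rw [← hy]; exact hy'

lemma Manifold.IsSubmersion.isOpenMap [IsManifold (𝓡 n) ∞ X] [IsManifold (𝓡 m) ∞ Y] {f : X → Y}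
    (hf : IsSubmersion (𝓡 n) (𝓡 m) ∞ f) : IsOpenMap f :=
  isOpenMap_of_localSections hf.exists_localSection

end Submersion

/-! ### Embedded submanifolds and fibre products -/

section Slice

variable {E H : Type*} [NormedAddCommGroup E] [NormedSpace ℝ E] [TopologicalSpace H]
  {Z : Type u} [TopologicalSpace Z] [ChartedSpace H Z]

/-- The restrictions of `c` to `S ∩ O` and of `d` to `V` are mutually inverse, and `c` and `d` are
smooth on the open sets `O` and `V`: a chart of `S` as an embedded submanifold. -/
structure IsSliceChart (I : ModelWithCorners ℝ E H) {e : ℕ} (S O : Set Z)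
    (V : Set (EuclideanSpace ℝ (Fin e)))
    (c : Z → EuclideanSpace ℝ (Fin e)) (d : EuclideanSpace ℝ (Fin e) → Z) : Prop where
  isOpen_source : IsOpen O
  isOpen_target : IsOpen V
  smooth : ContMDiffOn I (𝓡 e) ∞ c O
  smooth_symm : ContMDiffOn (𝓡 e) I ∞ d V
  mapsTo : MapsTo c (S ∩ O) V
  mapsTo_symm : MapsTo d V (S ∩ O)
  left_inv : ∀ z ∈ S ∩ O, d (c z) = z
  right_inv : ∀ v ∈ V, c (d v) = v

open Classical in
/-- The chart of the subtype `S` defined by a slice chart. -/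
def IsSliceChart.toOpenPartialHomeomorph {I : ModelWithCorners ℝ E H} {e : ℕ} {S O : Set Z}
    {V : Set (EuclideanSpace ℝ (Fin e))}
    {c : Z → EuclideanSpace ℝ (Fin e)} {d : EuclideanSpace ℝ (Fin e) → Z}
    (h : IsSliceChart I S O V c d) (s₀ : S) :
    OpenPartialHomeomorph S (EuclideanSpace ℝ (Fin e)) where
  toFun s := c s
  invFun v := if hv : d v ∈ S then ⟨d v, hv⟩ else s₀
  source := {s | (s : Z) ∈ O}
  target := V
  map_source' s hs := h.mapsTo ⟨s.2, hs⟩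
  map_target' v hv := by
    simp only [(h.mapsTo_symm hv).1, dif_pos, mem_ofPred_eq]
    exact (h.mapsTo_symm hv).2
  left_inv' s hs := by
    have h1 := h.left_inv s ⟨s.2, hs⟩
    simp only [h1, s.2, dif_pos]
  right_inv' v hv := by
    simp only [(h.mapsTo_symm hv).1, dif_pos]
    exact h.right_inv v hv
  open_source := h.isOpen_source.preimage continuous_subtype_val
  open_target := h.isOpen_target
  continuousOn_toFun := h.smooth.continuousOn.comp continuous_subtype_val.continuousOn
    fun _ hs => hs
  continuousOn_invFun := by
    rw [Topology.IsInducing.subtypeVal.continuousOn_iff]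
    refine h.smooth_symm.continuousOn.congr fun v hv => ?_
    simp only [Function.comp_apply, (h.mapsTo_symm hv).1, dif_pos]

/-- A subset with slice charts around all of its points is a manifold. -/
theorem exists_smoothMfd_of_isSliceChart (I : ModelWithCorners ℝ E H) {e : ℕ} [T2Space Z]
    [SecondCountableTopology Z] (S : Set Z) (hne : Nonempty Z → S.Nonempty)
    (h : ∀ z ∈ S, ∃ O V c d, z ∈ O ∧ IsSliceChart I (e := e) S O V c d) :
    ∃ (T : SmoothMfd.{u} e) (ι : T → Z), IsDiffeoOn (𝓡 e) I ι univ S := by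
  classical
  choose! O V c d hzO hs using h
  have hsymm : ∀ (t : S), ∀ v ∈ V t,
      ((((hs t t.2).toOpenPartialHomeomorph t).symm v : S) : Z) = d t v := by
    intro t v hv
    change ((if hv : d t v ∈ S then (⟨d t v, hv⟩ : S) else t : S) : Z) = d t v
    simp only [((hs t t.2).mapsTo_symm hv).1, dif_pos]
  let T : SmoothMfd.{u} e := SmoothMfd.ofCharts S
    (fun s => (hs s s.2).toOpenPartialHomeomorph s) (fun s => hzO s s.2) (by
      intro s t v hv
      have hv1 : v ∈ V s := hv.1
      have hv2 : d s v ∈ O t := by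
        have : ((((hs s s.2).toOpenPartialHomeomorph s).symm v : S) : Z) ∈ O t := hv.2
        rwa [hsymm s v hv1] at this
      have h1 : SmoothNear (𝓡 e) (𝓡 e) (fun v => c t (d s v)) v :=
        ((hs t t.2).smooth.smoothNear ((hs t t.2).isOpen_source.mem_nhds hv2)).comp
          ((hs s s.2).smooth_symm.smoothNear ((hs s s.2).isOpen_target.mem_nhds hv1))
      refine ((smoothNear_iff_contDiff.1 h1).self_of_nhds.congr_of_eventuallyEq
        ?_).contDiffWithinAt
      filter_upwards [(hs s s.2).isOpen_target.mem_nhds hv1] with w hw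
      exact congrArg (c t) (hsymm s w hw))
  let ι : T → Z := fun t => (t : S).1
  have hιS : ∀ t : T, ι t ∈ S := fun t => (t : S).2
  -- The inverse must be defined on all of `Z`, hence the default value off `S`; this is where `hne`
  -- is needed.
  let mk' : Z → S := fun z => if hz : z ∈ S then ⟨z, hz⟩ else
    ⟨(hne ⟨z⟩).some, (hne ⟨z⟩).some_mem⟩
  have hmk' : ∀ z, ∀ hz : z ∈ S, mk' z = ⟨z, hz⟩ := fun z hz => dif_pos hz
  let mk : Z → T := mk'
  have hmk : ∀ z ∈ S, ι (mk z) = z := fun z hz => congrArg Subtype.val (hmk' z hz)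
  refine ⟨T, ι, ?_, fun t _ => hιS t, mk, ?_, fun _ _ => mem_univ _, fun t _ => ?_, hmk⟩
  · refine contMDiffOn_univ.2 (contMDiff_of_smoothNear fun t => ?_)
    have ht := hs (ι t) (hιS t)
    have h2 := smoothNear_chartAt (d := e) t (mem_chart_source _ t)
    have h3 : SmoothNear (𝓡 e) I (d (ι t)) (chartAt (EuclideanSpace ℝ (Fin e)) t t) :=
      ht.smooth_symm.smoothNear (ht.isOpen_target.mem_nhds
        (ht.mapsTo ⟨hιS t, hzO (ι t) (hιS t)⟩))
    refine (h3.comp h2).congr ?_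
    filter_upwards [(chartAt (EuclideanSpace ℝ (Fin e)) t).open_source.mem_nhds
      (mem_chart_source _ t)] with t' ht'
    exact ht.left_inv (ι t') ⟨hιS t', ht'⟩
  · refine contMDiffOn_of_smoothNear fun z hz => ?_
    have ht := hs z hz
    let t : T := (⟨z, hz⟩ : S)
    have h2 := smoothNear_chartAt_symm (d := e) t (mem_chart_target _ t)
    have h3 : SmoothNear I (𝓡 e) (c z) z :=
      ht.smooth.smoothNear (ht.isOpen_source.mem_nhds (hzO z hz))
    refine ⟨fun z' => (chartAt (EuclideanSpace ℝ (Fin e)) t).symm (c z z'),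
      SmoothNear.comp (J := 𝓡 e) h2 h3, ?_⟩
    filter_upwards [ht.isOpen_source.mem_nhds (hzO z hz)] with z' hz' hzS
    have h4 : mk z' = (⟨z', hzS⟩ : S) := hmk' z' hzS
    rw [h4]
    exact (chartAt (EuclideanSpace ℝ (Fin e)) t).left_inv (x := (⟨z', hzS⟩ : S)) hz'
  · exact Subtype.ext (hmk _ (hιS t))

end Slice

/-- The fibre product of a submersion and a smooth map is a manifold. -/
theorem exists_fibreProduct {a b m e : ℕ} (X : SmoothMfd.{u} a) (Y : SmoothMfd.{u} b)
    (B : SmoothMfd.{u} m) {f : X → B} (hf : Manifold.IsSubmersion (𝓡 a) (𝓡 m) ∞ f)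
    {g : Y → B} (hg : ContMDiff (𝓡 b) (𝓡 m) ∞ g)
    (hne : Nonempty (X × Y) → {z : X × Y | f z.1 = g z.2}.Nonempty)
    (he : ∀ x y, f x = g y → e + m = a + b) :
    ∃ (T : SmoothMfd.{u} e) (ι : T → X × Y),
      IsDiffeoOn (𝓡 e) ((𝓡 a).prod (𝓡 b)) ι univ {z | f z.1 = g z.2} := by
  refine exists_smoothMfd_of_isSliceChart ((𝓡 a).prod (𝓡 b)) (Z := X × Y) _ hne ?_
  rintro ⟨x₀, y₀⟩ (hz : f x₀ = g y₀)
  have hdim := he x₀ y₀ hz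
  obtain ⟨hma, pr, κ, hlp⟩ := (hf.isSubmersionAt x₀).exists_isLocalProduct
  have hfin : Module.finrank ℝ (EuclideanSpace ℝ (Fin (a - m)) × EuclideanSpace ℝ (Fin b)) =
      Module.finrank ℝ (EuclideanSpace ℝ (Fin e)) := by
    rw [Module.finrank_prod, finrank_euclideanSpace_fin, finrank_euclideanSpace_fin,
      finrank_euclideanSpace_fin]
    omega
  let L : (EuclideanSpace ℝ (Fin (a - m)) × EuclideanSpace ℝ (Fin b)) ≃L[ℝ]
      EuclideanSpace ℝ (Fin e) := ContinuousLinearEquiv.ofFinrankEq hfin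
  obtain ⟨U, hU, hUo, hxU⟩ := eventually_nhds_iff.1 (hlp.smooth_pr.and hlp.left_inv)
  obtain ⟨V, hV, hVo, hxV⟩ := eventually_nhds_iff.1 (hlp.smooth_κ.and hlp.right_inv)
  set φ := chartAt (EuclideanSpace ℝ (Fin b)) y₀ with hφ
  have hφo : ContMDiffOn (𝓡 b) (𝓡 b) ∞ φ φ.source := contMDiffOn_chart
  have hφs : ContMDiffOn (𝓡 b) (𝓡 b) ∞ φ.symm φ.target := contMDiffOn_chart_symm
  have hy₀ : y₀ ∈ φ.source := mem_chart_source _ y₀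
  have hfc : Continuous f := hf.contMDiff.continuous
  have hprU : ContMDiffOn (𝓡 a) (𝓡 (a - m)) ∞ pr U := fun x hx => (hU x hx).1.contMDiffWithinAt
  have hκV : ContMDiffOn ((𝓡 m).prod (𝓡 (a - m))) (𝓡 a) ∞ κ V :=
    fun x hx => (hV x hx).1.contMDiffWithinAt
  have hUV : IsOpen (U ∩ (fun x => (f x, pr x)) ⁻¹' V) :=
    (hfc.continuousOn.prodMk hprU.continuousOn).isOpen_inter_preimage hUo hVo
  -- A point `(x, y)` of the fibre product is determined by `y` and the fibre coordinate of `x`: the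
  -- value `f x` is read off as `g y`, and `κ ∘ q` then recovers `x`.
  let q : EuclideanSpace ℝ (Fin e) → B × EuclideanSpace ℝ (Fin (a - m)) :=
    fun v => (g (φ.symm (L.symm v).2), (L.symm v).1)
  have hL1 : ContMDiff (𝓡 e) (𝓡 (a - m)) ∞ fun v => (L.symm v).1 :=
    ((ContinuousLinearMap.fst ℝ _ _).comp L.symm.toContinuousLinearMap).contMDiff
  have hL2 : ContMDiff (𝓡 e) (𝓡 b) ∞ fun v => (L.symm v).2 :=
    ((ContinuousLinearMap.snd ℝ _ _).comp L.symm.toContinuousLinearMap).contMDiff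
  have hV₁o : IsOpen ((fun v => (L.symm v).2) ⁻¹' φ.target) :=
    φ.open_target.preimage hL2.continuous
  have hy : ContMDiffOn (𝓡 e) (𝓡 b) ∞ (fun v => φ.symm (L.symm v).2)
      ((fun v => (L.symm v).2) ⁻¹' φ.target) := hφs.comp hL2.contMDiffOn fun v hv => hv
  have hq : ContMDiffOn (𝓡 e) ((𝓡 m).prod (𝓡 (a - m))) ∞ q
      ((fun v => (L.symm v).2) ⁻¹' φ.target) :=
    (hg.comp_contMDiffOn hy).prodMk hL1.contMDiffOn
  have hV₂o := hq.continuousOn.isOpen_inter_preimage hV₁o hVo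
  have hκq : ContMDiffOn (𝓡 e) (𝓡 a) ∞ (fun v => κ (q v))
      ((fun v => (L.symm v).2) ⁻¹' φ.target ∩ q ⁻¹' V) :=
    hκV.comp (hq.mono inter_subset_left) fun v hv => hv.2
  have hV₃o := hκq.continuousOn.isOpen_inter_preimage hV₂o hUo
  have hkey : ∀ z ∈ {z : X × Y | f z.1 = g z.2} ∩
      ((U ∩ (fun x => (f x, pr x)) ⁻¹' V) ×ˢ φ.source), κ (q (L (pr z.1, φ z.2))) = z.1 ∧
      q (L (pr z.1, φ z.2)) = (f z.1, pr z.1) := by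
    rintro ⟨x, y⟩ ⟨hxy, ⟨hx, hx'⟩, hy⟩
    have h1 : q (L (pr x, φ y)) = (f x, pr x) := by
      simp only [q, L.symm_apply_apply]
      rw [φ.left_inv hy, (show f x = g y from hxy)]
    exact ⟨by rw [h1, (hU x hx).2], h1⟩
  refine ⟨(U ∩ (fun x => (f x, pr x)) ⁻¹' V) ×ˢ φ.source,
    ((fun v => (L.symm v).2) ⁻¹' φ.target ∩ q ⁻¹' V) ∩ (fun v => κ (q v)) ⁻¹' U,
    fun z => L (pr z.1, φ z.2), fun v => (κ (q v), φ.symm (L.symm v).2),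
    ⟨⟨hxU, hxV⟩, hy₀⟩, ?_⟩
  refine ⟨hUV.prod φ.open_source, hV₃o, ?_, ?_, ?_, ?_, ?_, ?_⟩
  · have h1 : ContMDiffOn ((𝓡 a).prod (𝓡 b)) ((𝓡 (a - m)).prod (𝓡 b)) ∞
        (fun z : X × Y => (pr z.1, φ z.2)) ((U ∩ (fun x => (f x, pr x)) ⁻¹' V) ×ˢ φ.source) :=
      (hprU.comp contMDiffOn_fst fun z hz => hz.1.1).prodMk
        (hφo.comp contMDiffOn_snd fun z hz => hz.2)
    have h2 : ContMDiff ((𝓡 (a - m)).prod (𝓡 b)) (𝓡 e) ∞ L := by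
      have := L.toContinuousLinearMap.contMDiff (n := ∞)
      rwa [modelWithCornersSelf_prod, ← chartedSpaceSelf_prod] at this
    exact h2.comp_contMDiffOn h1
  · exact (hκq.mono inter_subset_left).prodMk (hy.mono fun v hv => hv.1.1)
  · rintro ⟨x, y⟩ hz
    obtain ⟨h1, h2⟩ := hkey _ hz
    refine ⟨⟨?_, ?_⟩, ?_⟩
    · simp only [mem_preimage, L.symm_apply_apply]; exact φ.map_source hz.2.2
    · rw [mem_preimage, h2]; exact hz.2.1.2
    · rw [mem_preimage, h1]; exact hz.2.1.1
  · rintro v ⟨⟨h1, h2⟩, h3⟩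
    have h4 := (hV _ h2).2
    refine ⟨h4.1, ⟨h3, ?_⟩, φ.map_target h1⟩
    rw [mem_preimage, h4.1, h4.2]; exact h2
  · rintro ⟨x, y⟩ hz
    obtain ⟨h1, h2⟩ := hkey _ hz
    refine Prod.ext h1 ?_
    simp only [L.symm_apply_apply]
    exact φ.left_inv hz.2.2
  · rintro v ⟨⟨h1, h2⟩, h3⟩
    have h4 := (hV _ h2).2
    simp only
    rw [h4.2, φ.right_inv h1]
    exact L.apply_symm_apply v

/-! ### Quotient manifolds -/

/-- A submersion does not increase the dimension. -/
lemma le_of_localSection {n m : ℕ} {X Y : Type*}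
    [TopologicalSpace X] [ChartedSpace (EuclideanSpace ℝ (Fin n)) X] [IsManifold (𝓡 n) ∞ X]
    [TopologicalSpace Y] [ChartedSpace (EuclideanSpace ℝ (Fin m)) Y] [IsManifold (𝓡 m) ∞ Y]
    {f : X → Y} {x : X} (hf : SmoothNear (𝓡 n) (𝓡 m) f x)
    {σ : Y → X} (hσ : SmoothNear (𝓡 m) (𝓡 n) σ (f x)) (hσx : σ (f x) = x)
    (hfσ : ∀ᶠ y in 𝓝 (f x), f (σ y) = y) : m ≤ n :=
  (isSubmersionAtOfComplement_of_localSection hf hσ hσx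
    hfσ).isSubmersionAt.exists_isLocalProduct.1

/-- Smooth maps `α : O → V` and `b : V → O` that define a chart of the quotient of `Q` by `s`:
`α` is invariant, and `α` and `b` induce mutually inverse maps between the image of `O` and `V`. -/
structure IsQuotientChart {d k : ℕ} {Q : SmoothMfd.{u} d} (s : Setoid Q) (O : Set Q)
    (V : Set (EuclideanSpace ℝ (Fin k))) (α : Q → EuclideanSpace ℝ (Fin k))
    (b : EuclideanSpace ℝ (Fin k) → Q) : Prop where
  isOpen_source : IsOpen O
  isOpen_target : IsOpen V
  saturated : ∀ y y', s y y' → y ∈ O → y' ∈ O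
  smooth : ContMDiffOn (𝓡 d) (𝓡 k) ∞ α O
  smooth_symm : ContMDiffOn (𝓡 k) (𝓡 d) ∞ b V
  invariant : ∀ y ∈ O, ∀ y', s y y' → α y = α y'
  mapsTo : MapsTo α O V
  mapsTo_symm : MapsTo b V O
  rel : ∀ y ∈ O, s (b (α y)) y
  right_inv : ∀ v ∈ V, α (b v) = v

namespace IsQuotientChart

variable {d k : ℕ} {Q : SmoothMfd.{u} d} {s : Setoid Q} {O : Set Q}
  {V : Set (EuclideanSpace ℝ (Fin k))} {α : Q → EuclideanSpace ℝ (Fin k)}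
  {b : EuclideanSpace ℝ (Fin k) → Q}

/-- The chart of the quotient is evaluated on chosen representatives; saturation of `O`, like
invariance of `α` below, makes the choice harmless. -/
lemma out_mem (h : IsQuotientChart s O V α b) {y : Q} :
    (Quotient.mk s y).out ∈ O ↔ y ∈ O :=
  ⟨fun hy => h.saturated _ _ (Quotient.mk_out y) hy,
    fun hy => h.saturated _ _ (s.symm (Quotient.mk_out y)) hy⟩

lemma apply_out (h : IsQuotientChart s O V α b) {y : Q} (hy : y ∈ O) :
    α (Quotient.mk s y).out = α y :=
  (h.invariant y hy _ (s.symm (Quotient.mk_out y))).symm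

/-- The chart of the quotient space defined by a quotient chart. -/
def toOpenPartialHomeomorph (h : IsQuotientChart s O V α b) :
    OpenPartialHomeomorph (Quotient s) (EuclideanSpace ℝ (Fin k)) where
  toFun t := α t.out
  invFun v := Quotient.mk s (b v)
  source := {t | t.out ∈ O}
  target := V
  map_source' _ ht := h.mapsTo ht
  map_target' _ hv := h.out_mem.2 (h.mapsTo_symm hv)
  left_inv' t ht := by
    conv_rhs => rw [← Quotient.out_eq t]
    exact Quotient.sound (h.rel _ ht)
  right_inv' v hv := by rw [h.apply_out (h.mapsTo_symm hv), h.right_inv v hv]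
  open_source := by
    refine (isQuotientMap_quotient_mk' (s := s)).isOpen_preimage.1 ?_
    convert h.isOpen_source using 1
    ext y
    exact h.out_mem
  open_target := h.isOpen_target
  continuousOn_toFun := by
    have ho : IsOpen {t : Quotient s | t.out ∈ O} := by
      refine (isQuotientMap_quotient_mk' (s := s)).isOpen_preimage.1 ?_
      convert h.isOpen_source using 1
      ext y
      exact h.out_mem
    refine ((isQuotientMap_quotient_mk' (s := s)).continuousOn_isOpen_iff ho).2 ?_
    have h1 : (Quotient.mk s) ⁻¹' {t : Quotient s | t.out ∈ O} = O := by
      ext y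
      exact h.out_mem
    change ContinuousOn _ ((Quotient.mk s) ⁻¹' _)
    rw [h1]
    exact h.smooth.continuousOn.congr fun y hy => h.apply_out hy
  continuousOn_invFun :=
    (isQuotientMap_quotient_mk' (s := s)).continuous.comp_continuousOn h.smooth_symm.continuousOn

end IsQuotientChart

/-- The quotient of a manifold by an equivalence relation with quotient charts around all
points is a manifold, and the quotient map is a surjective submersion. -/
theorem exists_quotient_of_isQuotientChart {d k : ℕ} (Q : SmoothMfd.{u} d) (s : Setoid Q)
    (hopen : IsOpenMap (Quotient.mk s)) [T2Space (Quotient s)]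
    (h : ∀ y₀ : Q, ∃ O V α b, y₀ ∈ O ∧ b (α y₀) = y₀ ∧ IsQuotientChart (k := k) s O V α b) :
    ∃ (T : SmoothMfd.{u} k) (q : Q → T), ContMDiff (𝓡 d) (𝓡 k) ∞ q ∧ Function.Surjective q ∧
      (∀ y y', q y = q y' ↔ s y y') ∧
      ∀ y, ∃ σ : T → Q, SmoothNear (𝓡 k) (𝓡 d) σ (q y) ∧ σ (q y) = y ∧
        ∀ᶠ t in 𝓝 (q y), q (σ t) = t := by
  have hqm : IsQuotientMap (Quotient.mk s) := isQuotientMap_quotient_mk'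
  have : SecondCountableTopology (Quotient s) := hqm.secondCountableTopology hopen
  choose O V α b hyO hbα hs using h
  let T : SmoothMfd.{u} k := SmoothMfd.ofCharts (Quotient s)
    (fun t => (hs t.out).toOpenPartialHomeomorph) (fun t => hyO t.out) (by
      intro t t' v hv
      have hv1 : v ∈ V t.out := hv.1
      have hv2 : b t.out v ∈ O t'.out := (hs t'.out).out_mem.1 hv.2
      have h1 : SmoothNear (𝓡 k) (𝓡 k) (fun v => α t'.out (b t.out v)) v :=
        ((hs _).smooth.smoothNear ((hs _).isOpen_source.mem_nhds hv2)).comp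
          ((hs _).smooth_symm.smoothNear ((hs _).isOpen_target.mem_nhds hv1))
      refine ((smoothNear_iff_contDiff.1 h1).self_of_nhds.congr_of_eventuallyEq
        ?_).contDiffWithinAt
      have h2 : ∀ᶠ w in 𝓝 v, b t.out w ∈ O t'.out :=
        ((hs _).smooth_symm.continuousOn.continuousAt
          ((hs _).isOpen_target.mem_nhds hv1)).eventually ((hs _).isOpen_source.mem_nhds hv2)
      filter_upwards [h2] with w hw
      exact (hs t'.out).apply_out hw)
  let q : Q → T := Quotient.mk s
  let out : T → Q := fun t => Quotient.out (s := s) t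
  have hout : ∀ t, q (out t) = t := fun t => Quotient.out_eq (s := s) t
  have hsec : ∀ t : T, ∃ σ : T → Q, SmoothNear (𝓡 k) (𝓡 d) σ t ∧ ∀ᶠ t' in 𝓝 t, q (σ t') = t' := by
    intro t
    have hv : α (out t) (out t) ∈ V (out t) := (hs _).mapsTo (hyO _)
    refine ⟨fun t' => b (out t) (chartAt (EuclideanSpace ℝ (Fin k)) t t'),
      SmoothNear.comp (J := 𝓡 k) (g := b (out t)) ((hs _).smooth_symm.smoothNear
        ((hs _).isOpen_target.mem_nhds hv)) (smoothNear_chartAt t (mem_chart_source _ t)), ?_⟩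
    filter_upwards [(chartAt (EuclideanSpace ℝ (Fin k)) t).open_source.mem_nhds
      (mem_chart_source _ t)] with t' ht'
    exact (chartAt (EuclideanSpace ℝ (Fin k)) t).left_inv ht'
  have hqs : ContMDiff (𝓡 d) (𝓡 k) ∞ q := by
    refine contMDiff_of_smoothNear fun y => ?_
    have hyt : y ∈ O (out (q y)) := (hs _).out_mem.1 (hyO _)
    have h1 : SmoothNear (𝓡 d) (𝓡 k) (α (out (q y))) y :=
      (hs _).smooth.smoothNear ((hs _).isOpen_source.mem_nhds hyt)
    have h2 : SmoothNear (𝓡 d) (𝓡 k) (fun y' => (chartAt (EuclideanSpace ℝ (Fin k)) (q y)).symm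
        (α (out (q y)) y')) y := by
      refine SmoothNear.comp (J := 𝓡 k)
        (g := (chartAt (EuclideanSpace ℝ (Fin k)) (q y)).symm) ?_ h1
      exact smoothNear_chartAt_symm _ ((hs _).mapsTo hyt)
    refine h2.congr ?_
    filter_upwards [(hs _).isOpen_source.mem_nhds hyt] with y' hy'
    exact Quotient.sound ((hs _).rel y' hy')
  refine ⟨T, q, hqs, Quotient.mk_surjective, fun y y' => Quotient.eq (r := s), fun y => ?_⟩
  obtain ⟨σ, h1, h2⟩ := hsec (q y)
  have hσO : σ (q y) ∈ O y :=
    (hs y).saturated y _ (s.symm (Quotient.exact (h2.self_of_nhds : _))) (hyO y)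
  have hσO' : ∀ᶠ t in 𝓝 (q y), σ t ∈ O y :=
    h1.continuousAt.eventually ((hs y).isOpen_source.mem_nhds hσO)
  have hin : ∀ t, σ t ∈ O y → α y (σ t) ∈ V y := fun t ht => (hs y).mapsTo ht
  -- The section `σ` comes from the chart around the chosen representative and need not pass through
  -- `y`. Replacing its values by the representatives of the chart at `y` corrects this, since `b y
  -- (α y y) = y`.
  refine ⟨fun t => b y (α y (σ t)), ?_, ?_, ?_⟩
  · refine SmoothNear.comp (J := 𝓡 k) (g := b y) (f := fun t => α y (σ t)) ?_
      (SmoothNear.comp (J := 𝓡 d) (g := α y) ?_ h1)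
    · exact (hs y).smooth_symm.smoothNear ((hs y).isOpen_target.mem_nhds (hin _ hσO))
    · exact (hs y).smooth.smoothNear ((hs y).isOpen_source.mem_nhds hσO)
  · have h3 : α y (σ (q y)) = α y y := (hs y).invariant _ hσO _
      (Quotient.exact (h2.self_of_nhds : _))
    exact (congrArg (b y) h3).trans (hbα y)
  · filter_upwards [h2, hσO'] with t ht ht'
    exact (Quotient.sound ((hs y).rel _ ht') : q _ = q (σ t)).trans ht

/-- The quotient of a manifold by an equivalence relation that has, locally on saturated open
sets, smooth choices of representatives. The dimension of the quotient is computed at the points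
of a dense set, over which the quotient is identified with a manifold of dimension `k`. -/
theorem exists_quotient {d k : ℕ} (Q : SmoothMfd.{u} d) (s : Setoid Q)
    (hopen : IsOpenMap (Quotient.mk s)) [T2Space (Quotient s)]
    (hret : ∀ y₀ : Q, ∃ (W : Set Q) (ρ : Q → Q), IsOpen W ∧ y₀ ∈ W ∧
      (∀ y y', s y y' → y ∈ W → y' ∈ W) ∧ ContMDiffOn (𝓡 d) (𝓡 d) ∞ ρ W ∧
      (∀ y ∈ W, s (ρ y) y) ∧ (∀ y ∈ W, ∀ y', s y y' → ρ y = ρ y') ∧ ρ y₀ = y₀)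
    (Y : SmoothMfd.{u} k) {c : Q → Y} (hc : ContMDiff (𝓡 d) (𝓡 k) ∞ c)
    (hcs : ∀ y y', s y y' → c y = c y') {D : Set Q} (hD : Dense D)
    (hDe : ∀ y ∈ D, ∃ e : Y → Q, SmoothNear (𝓡 k) (𝓡 d) e (c y) ∧
      ∀ᶠ w in 𝓝 (c y), c (e w) = w ∧ ∀ y', c y' = w → s y' (e w)) :
    ∃ (T : SmoothMfd.{u} k) (q : Q → T), ContMDiff (𝓡 d) (𝓡 k) ∞ q ∧ Function.Surjective q ∧
      (∀ y y', q y = q y' ↔ s y y') ∧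
      ∀ y, ∃ σ : T → Q, SmoothNear (𝓡 k) (𝓡 d) σ (q y) ∧ σ (q y) = y ∧
        ∀ᶠ t in 𝓝 (q y), q (σ t) = t := by
  refine exists_quotient_of_isQuotientChart Q s hopen fun y₀ => ?_
  obtain ⟨W, ρ, hWo, hyW, hWs, hρ, hρr, hρi, hρy⟩ := hret y₀
  have hρρ : ∀ y ∈ W, ρ (ρ y) = ρ y := fun y hy =>
    (hρi y hy _ (s.symm (hρr y hy))).symm
  obtain ⟨r, a, b, N, V, hNo, hVo, hyN, hNW, ha, hb, haN, hbV, hba, hab⟩ :=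
    exists_splitting (hρ.smoothNear (hWo.mem_nhds hyW)) hρy
      (by filter_upwards [hWo.mem_nhds hyW] with y hy using hρρ y hy) (hWo.mem_nhds hyW)
  have hρb : ∀ v ∈ V, ρ (b v) = b v := fun v hv => by rw [← hba _ (hbV hv), hab v hv]
  -- The neighbourhood `N` meets the dense set `D`. At such a point `v ↦ c (b v)` and `w ↦ a (ρ (e
  -- w))` are mutually inverse germs between `ℝʳ` and `Y`, so each is a section of the other and the
  -- dimensions agree.
  have hrk : r = k := by
    obtain ⟨y, hyN', hyD⟩ := hD.inter_open_nonempty N hNo ⟨y₀, hyN⟩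
    obtain ⟨e, he, hec⟩ := hDe y hyD
    have hyW' := hNW hyN'
    have hvV : a y ∈ V := haN hyN'
    have hbw : b (a y) = ρ y := hba y hyN'
    have hcb : c (b (a y)) = c y := by rw [hbw]; exact hcs _ _ (hρr y hyW')
    have hA : SmoothNear (𝓡 r) (𝓡 k) (fun v => c (b v)) (a y) :=
      SmoothNear.comp (J := 𝓡 d) (hc.smoothNear _) (hb.smoothNear (hVo.mem_nhds hvV))
    have hye : s y (e (c y)) := hec.self_of_nhds.2 y rfl
    have heW : e (c y) ∈ W := hWs _ _ hye hyW'
    have hρe : ρ (e (c y)) = b (a y) := by rw [hbw]; exact (hρi y hyW' _ hye).symm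
    have hρeN : ρ (e (c y)) ∈ N := by rw [hρe]; exact hbV hvV
    have heW' : ∀ᶠ w in 𝓝 (c y), e w ∈ W := he.continuousAt.eventually (hWo.mem_nhds heW)
    have hρe' : SmoothNear (𝓡 k) (𝓡 d) (fun w => ρ (e w)) (c y) :=
      SmoothNear.comp (J := 𝓡 d) (hρ.smoothNear (hWo.mem_nhds heW)) he
    have hρeN' : ∀ᶠ w in 𝓝 (c y), ρ (e w) ∈ N :=
      hρe'.continuousAt.eventually (hNo.mem_nhds hρeN)
    have hB : SmoothNear (𝓡 k) (𝓡 r) (fun w => a (ρ (e w))) (c y) :=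
      SmoothNear.comp (J := 𝓡 d) (f := fun w => ρ (e w))
        (ha.smoothNear (hNo.mem_nhds hρeN)) hρe'
    have hBv : a (ρ (e (c y))) = a y := by rw [hρe, hab _ hvV]
    have hAB : ∀ᶠ w in 𝓝 (c y), c (b (a (ρ (e w)))) = w := by
      filter_upwards [hec, heW', hρeN'] with w h1 h2 h3
      rw [hba _ h3, hρρ _ h2, hcs _ _ (hρr _ h2), h1.1]
    have hBA : ∀ᶠ v in 𝓝 (a y), a (ρ (e (c (b v)))) = v := by
      have h1 : Tendsto (fun v => c (b v)) (𝓝 (a y)) (𝓝 (c y)) := by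
        have := hA.continuousAt; rwa [ContinuousAt, hcb] at this
      filter_upwards [h1.eventually hec, hVo.mem_nhds hvV] with v h2 h3
      rw [← hρi _ (hNW (hbV h3)) _ (h2.2 _ rfl), hρb v h3, hab v h3]
    refine le_antisymm ?_ ?_
    · refine le_of_localSection hB (σ := fun v => c (b v)) (by rwa [hBv]) ?_ (by rwa [hBv])
      simp only [hBv, hcb]
    · refine le_of_localSection hA (σ := fun w => a (ρ (e w))) ?_ ?_ ?_
      · simp only [hcb]; exact hB
      · simp only [hcb, hBv]
      · simp only [hcb]; exact hAB
  subst hrk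
  have hO : IsOpen (W ∩ ρ ⁻¹' N) := hρ.continuousOn.isOpen_inter_preimage hWo hNo
  refine ⟨W ∩ ρ ⁻¹' N, V, fun y => a (ρ y), b, ⟨hyW, by rwa [mem_preimage, hρy]⟩, ?_, hO, hVo,
    ?_, ?_, hb, ?_, ?_, ?_, ?_, ?_⟩
  · simp only [hρy, hba _ hyN]
  · rintro y y' hyy' ⟨h1, h2⟩
    exact ⟨hWs _ _ hyy' h1, by rwa [mem_preimage, ← hρi y h1 _ hyy']⟩
  · exact ha.comp (hρ.mono inter_subset_left) fun y hy => hy.2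
  · intro y hy y' hyy'
    simp only [hρi y hy.1 y' hyy']
  · exact fun y hy => haN hy.2
  · intro v hv
    exact ⟨hNW (hbV hv), by rw [mem_preimage, hρb v hv]; exact hbV hv⟩
  · intro y hy
    simp only [hba _ hy.2, hρρ _ hy.1]
    exact hρr y hy.1
  · intro v hv
    simp only [hρb v hv, hab v hv]

/-! ### Sets of measure zero -/

section Null

open MeasureTheory

/-- The push-forward of Lebesgue measure is a Haar measure, and any two Haar measures have the same
null sets; no determinant has to be computed. -/
lemma volume_preimage_continuousLinearEquiv {n m c : ℕ}
    (L : EuclideanSpace ℝ (Fin n) ≃L[ℝ] (EuclideanSpace ℝ (Fin m) × EuclideanSpace ℝ (Fin c)))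
    (A : Set (EuclideanSpace ℝ (Fin m) × EuclideanSpace ℝ (Fin c))) :
    volume (L ⁻¹' A) = 0 ↔ volume A = 0 := by
  have h1 : (volume : Measure (EuclideanSpace ℝ (Fin n))).map L A = volume (L ⁻¹' A) :=
    L.toHomeomorph.toMeasurableEquiv.map_apply A
  have h2 : ((volume : Measure (EuclideanSpace ℝ (Fin n))).map L).IsAddHaarMeasure :=
    L.isAddHaarMeasure_map volume
  have h3 : ((volume : Measure (EuclideanSpace ℝ (Fin m))).prod
    (volume : Measure (EuclideanSpace ℝ (Fin c)))).IsAddHaarMeasure := inferInstance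
  rw [← Measure.volume_eq_prod] at h3
  rw [← h1]
  exact ⟨fun h => Measure.absolutelyContinuous_isAddHaarMeasure _ _ h,
    fun h => Measure.absolutelyContinuous_isAddHaarMeasure _ _ h⟩

namespace SmoothMfd

variable {d : ℕ} {X : SmoothMfd.{u} d} {S : Set X}

/-- Nullity can be checked in arbitrary local parametrizations. -/
lemma isNull_of_local
    (h : ∀ x : X, ∃ (φ : EuclideanSpace ℝ (Fin d) → X) (χ : X → EuclideanSpace ℝ (Fin d)),
      SmoothNear (𝓡 d) (𝓡 d) φ (χ x) ∧ SmoothNear (𝓡 d) (𝓡 d) χ x ∧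
      (∀ᶠ y in 𝓝 x, φ (χ y) = y) ∧ ∃ u ∈ 𝓝 (χ x), volume (u ∩ φ ⁻¹' S) = 0) :
    X.IsNull S := by
  intro x₀
  set ψ := chartAt (EuclideanSpace ℝ (Fin d)) x₀
  refine measure_null_of_locally_null _ fun z hz => ?_
  obtain ⟨φ, χ, hφ, hχ, hφχ, u, hu, hu0⟩ := h (ψ.symm z)
  have hψ' : SmoothNear (𝓡 d) (𝓡 d) ψ.symm z := smoothNear_chartAt_symm x₀ hz.1
  have hφx : φ (χ (ψ.symm z)) = ψ.symm z := hφχ.self_of_nhds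
  have hψ : SmoothNear (𝓡 d) (𝓡 d) ψ (φ (χ (ψ.symm z))) := by
    rw [hφx]; exact smoothNear_chartAt x₀ (ψ.map_target hz.1)
  have hg : SmoothNear (𝓡 d) (𝓡 d) (fun w => ψ (φ w)) (χ (ψ.symm z)) :=
    SmoothNear.comp (J := 𝓡 d) hψ hφ
  have hh : SmoothNear (𝓡 d) (𝓡 d) (fun w => χ (ψ.symm w)) z :=
    SmoothNear.comp (J := 𝓡 d) hχ hψ'
  rw [smoothNear_iff_contDiff] at hg
  set u' := u ∩ {w | ContDiffAt ℝ ∞ (fun w => ψ (φ w)) w}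
  have hu' : u' ∈ 𝓝 (χ (ψ.symm z)) := inter_mem hu hg
  -- The coordinate change is differentiable between spaces of equal dimension, so it maps null sets
  -- to null sets.
  refine ⟨(fun w => ψ (φ w)) '' (u' ∩ φ ⁻¹' S), ?_, ?_⟩
  · filter_upwards [self_mem_nhdsWithin, nhdsWithin_le_nhds (hh.continuousAt hu'),
      nhdsWithin_le_nhds (hψ'.continuousAt.eventually hφχ)] with w hw1 hw2 hw3
    refine ⟨χ (ψ.symm w), ⟨hw2, ?_⟩, ?_⟩
    · rw [mem_preimage, hw3]; exact hw1.2
    · simp only [hw3]; exact ψ.right_inv hw1.1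
  · refine addHaar_image_eq_zero_of_differentiableOn_of_addHaar_eq_zero _ ?_
      (measure_mono_null (inter_subset_inter_left _ inter_subset_left) hu0)
    intro w hw
    have hw' : ContDiffAt ℝ ∞ (fun w => ψ (φ w)) w := hw.1.2
    exact (hw'.differentiableAt (by simp)).differentiableWithinAt

/-- A null set has measure zero near the points of arbitrary local parametrizations. -/
lemma IsNull.exists_volume_eq_zero (hS : X.IsNull S) {φ : EuclideanSpace ℝ (Fin d) → X}
    {χ : X → EuclideanSpace ℝ (Fin d)} {z : EuclideanSpace ℝ (Fin d)}
    (hφ : SmoothNear (𝓡 d) (𝓡 d) φ z) (hχ : SmoothNear (𝓡 d) (𝓡 d) χ (φ z))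
    (hχφ : ∀ᶠ w in 𝓝 z, χ (φ w) = w) : ∃ u ∈ 𝓝 z, volume (u ∩ φ ⁻¹' S) = 0 := by
  set ψ := chartAt (EuclideanSpace ℝ (Fin d)) (φ z)
  have hzs : φ z ∈ ψ.source := mem_chart_source _ _
  have hψz : ψ.symm (ψ (φ z)) = φ z := ψ.left_inv hzs
  have hψ : SmoothNear (𝓡 d) (𝓡 d) ψ (φ z) := smoothNear_chartAt _ hzs
  have hψ' : SmoothNear (𝓡 d) (𝓡 d) ψ.symm (ψ (φ z)) :=
    smoothNear_chartAt_symm _ (ψ.map_source hzs)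
  have hg : SmoothNear (𝓡 d) (𝓡 d) (fun w => χ (ψ.symm w)) (ψ (φ z)) := by
    refine SmoothNear.comp (J := 𝓡 d) ?_ hψ'
    rwa [hψz]
  rw [smoothNear_iff_contDiff] at hg
  have hc : Tendsto (fun w => ψ (φ w)) (𝓝 z) (𝓝 (ψ (φ z))) :=
    (SmoothNear.comp (J := 𝓡 d) hψ hφ).continuousAt
  have h0 : volume ((fun w => χ (ψ.symm w)) '' ((ψ.target ∩ ψ.symm ⁻¹' S) ∩
      {w | ContDiffAt ℝ ∞ (fun w => χ (ψ.symm w)) w})) = 0 := by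
    refine addHaar_image_eq_zero_of_differentiableOn_of_addHaar_eq_zero _ ?_
      (measure_mono_null inter_subset_left (hS (φ z)))
    intro w hw
    have hw' : ContDiffAt ℝ ∞ (fun w => χ (ψ.symm w)) w := hw.2
    exact (hw'.differentiableAt (by simp)).differentiableWithinAt
  refine ⟨{w | χ (φ w) = w ∧ ContDiffAt ℝ ∞ (fun w => χ (ψ.symm w)) (ψ (φ w)) ∧ φ w ∈ ψ.source},
    ?_, measure_mono_null ?_ h0⟩
  · filter_upwards [hχφ, hc.eventually hg,
      hφ.continuousAt.eventually (ψ.open_source.mem_nhds hzs)] with w h1 h2 h3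
    exact ⟨h1, h2, h3⟩
  · rintro w ⟨⟨h1, h2, h3⟩, hw⟩
    refine ⟨ψ (φ w), ⟨⟨ψ.map_source h3, ?_⟩, h2⟩, ?_⟩
    · rw [mem_preimage, ψ.left_inv h3]; exact hw
    · simp only [ψ.left_inv h3, h1]

end SmoothMfd

/-- Near every point, a submersion is a linear projection in suitable local parametrizations. -/
lemma Manifold.IsSubmersion.exists_parametrization {n m : ℕ} {X : SmoothMfd.{u} n}
    {Y : SmoothMfd.{u} m} {f : X → Y} (hf : IsSubmersion (𝓡 n) (𝓡 m) ∞ f) (x : X) :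
    ∃ (L : EuclideanSpace ℝ (Fin n) ≃L[ℝ]
        (EuclideanSpace ℝ (Fin m) × EuclideanSpace ℝ (Fin (n - m))))
      (φ : EuclideanSpace ℝ (Fin n) → X) (χ : X → EuclideanSpace ℝ (Fin n)),
      SmoothNear (𝓡 n) (𝓡 n) φ (χ x) ∧ SmoothNear (𝓡 n) (𝓡 n) χ x ∧
      (∀ᶠ y in 𝓝 x, φ (χ y) = y) ∧ (∀ᶠ v in 𝓝 (χ x), χ (φ v) = v) ∧
      (L (χ x)).1 = chartAt (EuclideanSpace ℝ (Fin m)) (f x) (f x) ∧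
      ∀ᶠ v in 𝓝 (χ x), (L v).1 ∈ (chartAt (EuclideanSpace ℝ (Fin m)) (f x)).target ∧
        f (φ v) = (chartAt (EuclideanSpace ℝ (Fin m)) (f x)).symm (L v).1 := by
  obtain ⟨hmn, pr, κ, h⟩ := (hf.isSubmersionAt x).exists_isLocalProduct
  have hfin : Module.finrank ℝ (EuclideanSpace ℝ (Fin n)) =
      Module.finrank ℝ (EuclideanSpace ℝ (Fin m) × EuclideanSpace ℝ (Fin (n - m))) := by
    rw [Module.finrank_prod, finrank_euclideanSpace_fin, finrank_euclideanSpace_fin,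
      finrank_euclideanSpace_fin]
    omega
  let L : EuclideanSpace ℝ (Fin n) ≃L[ℝ]
      (EuclideanSpace ℝ (Fin m) × EuclideanSpace ℝ (Fin (n - m))) :=
    ContinuousLinearEquiv.ofFinrankEq hfin
  set ψ := chartAt (EuclideanSpace ℝ (Fin m)) (f x)
  have hfs : f x ∈ ψ.source := mem_chart_source _ _
  have hψ : SmoothNear (𝓡 m) (𝓡 m) ψ (f x) := smoothNear_chartAt _ hfs
  have hψ' : SmoothNear (𝓡 m) (𝓡 m) ψ.symm (ψ (f x)) :=
    smoothNear_chartAt_symm _ (ψ.map_source hfs)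
  have hχ : SmoothNear (𝓡 n) (𝓡 n) (fun z => L.symm (ψ (f z), pr z)) x := by
    have h1 : ContMDiff ((𝓡 m).prod (𝓡 (n - m))) (𝓡 n) ∞ L.symm := by
      have := L.symm.toContinuousLinearMap.contMDiff (n := ∞)
      rwa [modelWithCornersSelf_prod, ← chartedSpaceSelf_prod] at this
    exact SmoothNear.comp (J := (𝓡 m).prod (𝓡 (n - m))) (h1.smoothNear _)
      ((SmoothNear.comp (J := 𝓡 m) hψ h.smooth).prodMk h.smooth_pr)
  have hLχ : L (L.symm (ψ (f x), pr x)) = (ψ (f x), pr x) := L.apply_symm_apply _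
  have hL1 : SmoothNear (𝓡 n) (𝓡 m) (fun v => (L v).1) (L.symm (ψ (f x), pr x)) :=
    smoothNear_continuousLinearMap
      ((ContinuousLinearMap.fst ℝ _ _).comp L.toContinuousLinearMap) _
  have hL2 : SmoothNear (𝓡 n) (𝓡 (n - m)) (fun v => (L v).2) (L.symm (ψ (f x), pr x)) :=
    smoothNear_continuousLinearMap
      ((ContinuousLinearMap.snd ℝ _ _).comp L.toContinuousLinearMap) _
  have hq : SmoothNear (𝓡 n) ((𝓡 m).prod (𝓡 (n - m))) (fun v => (ψ.symm (L v).1, (L v).2))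
      (L.symm (ψ (f x), pr x)) := by
    refine SmoothNear.prodMk (SmoothNear.comp (J := 𝓡 m) ?_ hL1) hL2
    rw [hLχ]; exact hψ'
  have hqx : (ψ.symm (L (L.symm (ψ (f x), pr x))).1, (L (L.symm (ψ (f x), pr x))).2) =
      (f x, pr x) := by
    rw [hLχ, ψ.left_inv hfs]
  have hqt : Tendsto (fun v => (ψ.symm (L v).1, (L v).2)) (𝓝 (L.symm (ψ (f x), pr x)))
      (𝓝 (f x, pr x)) := by
    have := hq.continuousAt; rwa [ContinuousAt, hqx] at this
  have hL1t : ∀ᶠ v in 𝓝 (L.symm (ψ (f x), pr x)), (L v).1 ∈ ψ.target :=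
    hL1.eventually_mem (by rw [hLχ]) (ψ.open_target.mem_nhds (ψ.map_source hfs))
  refine ⟨L, fun v => κ (ψ.symm (L v).1, (L v).2), fun z => L.symm (ψ (f z), pr z), ?_, hχ,
    ?_, ?_, ?_, ?_⟩
  · refine SmoothNear.comp (J := (𝓡 m).prod (𝓡 (n - m))) (g := κ) ?_ hq
    rw [hqx]; exact h.smooth_κ
  · filter_upwards [h.left_inv, h.smooth.continuousAt.eventually (ψ.open_source.mem_nhds hfs)]
      with z h1 h2
    rw [L.apply_symm_apply, ψ.left_inv h2, h1]
  · filter_upwards [hqt.eventually h.right_inv, hL1t] with v h1 h2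
    rw [h1.1, h1.2, ψ.right_inv h2, Prod.mk.eta, L.symm_apply_apply]
  · rw [hLχ]
  · filter_upwards [hqt.eventually h.right_inv, hL1t] with v h1 h2
    exact ⟨h2, h1.1⟩

/-- The preimage of a null set under a submersion is a null set. -/
theorem SmoothMfd.IsNull.preimage {n m : ℕ} {X : SmoothMfd.{u} n} {Y : SmoothMfd.{u} m} {f : X → Y}
    (hf : Manifold.IsSubmersion (𝓡 n) (𝓡 m) ∞ f) {S : Set Y} (hS : Y.IsNull S) :
    X.IsNull (f ⁻¹' S) := by
  refine isNull_of_local fun x => ?_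
  obtain ⟨L, φ, χ, h1, h2, h3, -, -, h4⟩ := hf.exists_parametrization x
  refine ⟨φ, χ, h1, h2, h3, _, h4, ?_⟩
  -- In coordinates where the submersion is a linear projection, the preimage is a cylinder over a
  -- null set.
  have h5 : volume (L ⁻¹' (((chartAt (EuclideanSpace ℝ (Fin m)) (f x)).target ∩
      (chartAt (EuclideanSpace ℝ (Fin m)) (f x)).symm ⁻¹' S) ×ˢ univ)) = 0 := by
    rw [volume_preimage_continuousLinearEquiv, Measure.volume_eq_prod, Measure.prod_prod,
      hS (f x), zero_mul]
  refine measure_mono_null ?_ h5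
  rintro v ⟨⟨hv1, hv2⟩, hv3⟩
  refine ⟨⟨hv1, ?_⟩, mem_univ _⟩
  rw [mem_preimage, ← hv2]; exact hv3

/-- A set is null if its preimage under a surjective submersion is null. -/
theorem SmoothMfd.IsNull.of_preimage {n m : ℕ} {X : SmoothMfd.{u} n} {Y : SmoothMfd.{u} m}
    {f : X → Y} (hf : Manifold.IsSubmersion (𝓡 n) (𝓡 m) ∞ f) (hs : Function.Surjective f)
    {S : Set Y} (hS : X.IsNull (f ⁻¹' S)) : Y.IsNull S := by
  refine isNull_of_local fun y => ?_
  obtain ⟨x, rfl⟩ := hs y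
  obtain ⟨L, φ, χ, h1, h2, h3, h4, h5, h6⟩ := hf.exists_parametrization x
  set ψ := chartAt (EuclideanSpace ℝ (Fin m)) (f x)
  have hφx : φ (χ x) = x := h3.self_of_nhds
  have hfs : f x ∈ ψ.source := mem_chart_source _ _
  refine ⟨ψ.symm, ψ, smoothNear_chartAt_symm _ (ψ.map_source hfs), smoothNear_chartAt _ hfs,
    by filter_upwards [ψ.open_source.mem_nhds hfs] with y hy using ψ.left_inv hy, ?_⟩
  obtain ⟨u, hu, hu0⟩ := hS.exists_volume_eq_zero h1 (by rwa [hφx]) h4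
  have h7 : L.symm ⁻¹' (u ∩ {v | (L v).1 ∈ ψ.target ∧ f (φ v) = ψ.symm (L v).1}) ∈
      𝓝 (L (χ x)) := by
    refine L.symm.continuous.continuousAt ?_
    rw [L.symm_apply_apply]
    exact inter_mem hu h6
  rw [← Prod.mk.eta (p := L (χ x)), mem_nhds_prod_iff'] at h7
  obtain ⟨B₁, B₂, hB₁, hx₁, hB₂, hx₂, hB⟩ := h7
  refine ⟨B₁, hB₁.mem_nhds (by rwa [← h5]), ?_⟩
  -- A null product set has a null factor, and the open nonempty factor `B₂` has positive measure.
  have h8 : volume (L ⁻¹' ((B₁ ∩ ψ.symm ⁻¹' S) ×ˢ B₂)) = 0 := by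
    refine measure_mono_null ?_ hu0
    rintro v ⟨⟨hv1, hv2⟩, hv3⟩
    have h9 := hB ⟨hv1, hv3⟩
    rw [mem_preimage, L.symm_apply_apply] at h9
    refine ⟨h9.1, ?_⟩
    change f (φ v) ∈ S
    rw [h9.2.2]; exact hv2
  rw [volume_preimage_continuousLinearEquiv, Measure.volume_eq_prod, Measure.prod_prod,
    mul_eq_zero] at h8
  exact h8.resolve_right (hB₂.measure_ne_zero _ ⟨_, hx₂⟩)

/-- The complement of a null set is dense. -/
lemma SmoothMfd.IsNull.dense_compl {d : ℕ} {X : SmoothMfd.{u} d} {S : Set X} (hS : X.IsNull S) :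
    Dense Sᶜ := by
  rw [← interior_eq_empty_iff_dense_compl, ← not_nonempty_iff_eq_empty]
  rintro ⟨x, hx⟩
  set ψ := chartAt (EuclideanSpace ℝ (Fin d)) x
  have hxs : x ∈ ψ.source := mem_chart_source _ _
  have ho : IsOpen (ψ.target ∩ ψ.symm ⁻¹' interior S) :=
    ψ.symm.isOpen_inter_preimage isOpen_interior
  refine ho.measure_ne_zero volume ⟨ψ x, ψ.map_source hxs, ?_⟩ (measure_mono_null ?_ (hS x))
  · rw [mem_preimage, ψ.left_inv hxs]; exact hx
  · exact inter_subset_inter_right _ (preimage_mono interior_subset)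

end Null

/-! ### Regular points of injective smooth families covering an open set -/

/-- A smooth injective map does not decrease the dimension. -/
theorem le_of_contDiffOn_injOn {e c : ℕ} {f : EuclideanSpace ℝ (Fin c) → Fin e → ℝ}
    {O : Set (EuclideanSpace ℝ (Fin c))} (hO : IsOpen O) (hne : O.Nonempty)
    (hf : ContDiffOn ℝ ∞ f O) (hinj : InjOn f O) : c ≤ e := by
  induction e generalizing c with
  | zero =>
    by_contra! hc
    obtain ⟨x, hx⟩ := hne
    have : Nontrivial (EuclideanSpace ℝ (Fin c)) :=
      Module.nontrivial_of_finrank_pos (R := ℝ) (by simpa using hc)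
    have h1 : O = {x} := by
      ext y
      exact ⟨fun hy => hinj hy hx (Subsingleton.elim _ _), fun hy => hy ▸ hx⟩
    rw [h1] at hO
    exact not_isOpen_singleton x hO
  | succ e ih =>
    -- If the derivative vanishes identically, `f` is locally constant, and injectivity leaves only
    -- `c = 0`. Otherwise some component `f i` has nonzero derivative at a point. Straightening it
    -- identifies its level set with an open part of `ℝᶜ⁻¹`, on which the other `e` components are
    -- still jointly injective, and induction applies.
    by_cases h0 : ∀ x ∈ O, fderiv ℝ f x = 0
    · by_contra! hc
      have : Nontrivial (EuclideanSpace ℝ (Fin c)) :=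
        Module.nontrivial_of_finrank_pos (R := ℝ) (by rw [finrank_euclideanSpace_fin]; omega)
      obtain ⟨x, hx⟩ := hne
      obtain ⟨ε, hε, hb⟩ := Metric.isOpen_iff.1 hO x hx
      have h1 : ∀ y ∈ Metric.ball x ε, f y = f x := by
        intro y hy
        refine (Metric.isOpen_ball.is_const_of_fderiv_eq_zero (𝕜 := ℝ)
          (convex_ball x ε).isPreconnected ?_ ?_ hy (Metric.mem_ball_self hε))
        · exact (hf.differentiableOn (by simp)).mono hb
        · intro z hz; exact h0 z (hb hz)
      have h2 : Metric.ball x ε = {x} := by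
        ext y
        refine ⟨fun hy => hinj (hb hy) hx (h1 y hy), fun hy => ?_⟩
        rw [mem_singleton_iff.1 hy]; exact Metric.mem_ball_self hε
      have h3 := Metric.isOpen_ball (x := x) (ε := ε)
      rw [h2] at h3
      exact not_isOpen_singleton x h3
    · push Not at h0
      obtain ⟨x, hx, hfx⟩ := h0
      have hfd : HasFDerivAt f (fderiv ℝ f x) x :=
        ((hf.contDiffAt (hO.mem_nhds hx)).differentiableAt (by simp)).hasFDerivAt
      obtain ⟨i, hi⟩ : ∃ i, (ContinuousLinearMap.proj (R := ℝ) i).comp (fderiv ℝ f x) ≠ 0 := by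
        by_contra! h
        refine hfx (ContinuousLinearMap.ext fun v => funext fun i => ?_)
        exact congrArg (fun T : EuclideanSpace ℝ (Fin c) →L[ℝ] ℝ => T v) (h i)
      set ℓ : EuclideanSpace ℝ (Fin c) →L[ℝ] ℝ :=
        (ContinuousLinearMap.proj (R := ℝ) i).comp (fderiv ℝ f x) with hℓ
      obtain ⟨v, hv⟩ : ∃ v, ℓ v ≠ 0 := by
        by_contra! h
        exact hi (ContinuousLinearMap.ext h)
      set s : ℝ →L[ℝ] EuclideanSpace ℝ (Fin c) :=
        ContinuousLinearMap.toSpanSingleton ℝ ((ℓ v)⁻¹ • v)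
      have hs : Function.RightInverse s ℓ := fun t => by simp [s, hv]
      have hker : Module.finrank ℝ ℓ.ker = c - 1 := by
        have h1 : Function.Surjective ℓ.toLinearMap := fun t => ⟨s t, hs t⟩
        have h2 := LinearMap.finrank_range_add_finrank_ker ℓ.toLinearMap
        rw [LinearMap.range_eq_top.2 h1] at h2
        simp at h2
        omega
      let Lk : ℓ.ker ≃L[ℝ] EuclideanSpace ℝ (Fin (c - 1)) :=
        ContinuousLinearEquiv.ofFinrankEq (by rw [hker]; simp)
      let L : EuclideanSpace ℝ (Fin c) ≃L[ℝ] (ℝ × EuclideanSpace ℝ (Fin (c - 1))) :=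
        (ContinuousLinearEquiv.equivOfRightInverse ℓ s hs).trans
          ((ContinuousLinearEquiv.refl ℝ _).prodCongr Lk)
      have hL1 : ∀ w, (L w).1 = ℓ w := fun w => rfl
      set L₂ := (ContinuousLinearMap.snd ℝ ℝ (EuclideanSpace ℝ (Fin (c - 1)))).comp
        L.toContinuousLinearMap
      have hL2 : ∀ w, L₂ w = (L w).2 := fun w => rfl
      -- `Ψ` replaces the linear coordinate `ℓ` by the function `f i`, whose derivative at `x` is
      -- `ℓ`; hence the derivative of `Ψ` there is the identity.
      set Ψ : EuclideanSpace ℝ (Fin c) → EuclideanSpace ℝ (Fin c) :=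
        fun y => L.symm (f y i, L₂ y) with hΨ
      have hfi : ContDiffOn ℝ ∞ (fun y => f y i) O := contDiffOn_pi.1 hf i
      have hΨs : SmoothNear (𝓡 c) (𝓡 c) Ψ x := by
        rw [smoothNear_iff_contDiff]
        filter_upwards [hO.mem_nhds hx] with y hy
        have h1 := hfi.contDiffAt (hO.mem_nhds hy)
        exact L.symm.contDiff.contDiffAt.comp y (h1.prodMk L₂.contDiff.contDiffAt)
      have hΨd : HasFDerivAt Ψ (ContinuousLinearEquiv.refl ℝ (EuclideanSpace ℝ (Fin c)) :
          EuclideanSpace ℝ (Fin c) →L[ℝ] EuclideanSpace ℝ (Fin c)) x := by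
        have h1 : HasFDerivAt (fun y => f y i) ℓ x :=
          (ContinuousLinearMap.proj (R := ℝ) (φ := fun _ : Fin (e + 1) => ℝ) i).hasFDerivAt.comp
            x hfd
        have h2 := L.symm.toContinuousLinearMap.hasFDerivAt.comp x (h1.prodMk L₂.hasFDerivAt)
        have h3 : (ContinuousLinearEquiv.refl ℝ (EuclideanSpace ℝ (Fin c)) :
            EuclideanSpace ℝ (Fin c) →L[ℝ] EuclideanSpace ℝ (Fin c)) =
            L.symm.toContinuousLinearMap.comp (ℓ.prod L₂) := by
          refine ContinuousLinearMap.ext fun w => ?_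
          change w = L.symm (ℓ w, L₂ w)
          rw [← hL1, hL2, Prod.mk.eta, L.symm_apply_apply]
        rw [h3]
        exact h2
      obtain ⟨E, hxE, hE, hE1, hE2⟩ := hΨs.exists_openPartialHomeomorph _ hΨd
      let j : EuclideanSpace ℝ (Fin (c - 1)) → EuclideanSpace ℝ (Fin c) :=
        fun w => L.symm (f x i, w)
      have hj : ContDiff ℝ ∞ j :=
        L.symm.contDiff.comp (contDiff_const.prodMk contDiff_id)
      have hO₁ : IsOpen (j ⁻¹' E.target) := E.open_target.preimage hj.continuous
      have hEj : ContDiffOn ℝ ∞ (fun w => E.symm (j w)) (j ⁻¹' E.target) :=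
        hE2.comp hj.contDiffOn fun w hw => hw
      have hO₂ := hEj.continuousOn.isOpen_inter_preimage hO₁ hO
      have hjx : j (L₂ x) = E x := by rw [hE]
      have hkey : ∀ w ∈ j ⁻¹' E.target, f (E.symm (j w)) i = f x i ∧ L₂ (E.symm (j w)) = w := by
        intro w hw
        have h1 : Ψ (E.symm (j w)) = j w := by rw [← hE, E.right_inv hw]
        have h2 := L.symm.injective h1
        exact Prod.mk.inj h2
      have := ih (c := c - 1) (f := fun w k => f (E.symm (j w)) (i.succAbove k)) hO₂
        ⟨L₂ x, ?_, ?_⟩ ?_ ?_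
      · omega
      · rw [mem_preimage, hjx]; exact E.map_source hxE
      · rw [mem_preimage, hjx, E.left_inv hxE]; exact hx
      · have h1 := hf.comp (hEj.mono inter_subset_left) fun w hw => hw.2
        exact contDiffOn_pi.2 fun k => contDiffOn_pi.1 h1 (i.succAbove k)
      · intro w hw w' hw' hww
        have h1 : f (E.symm (j w)) = f (E.symm (j w')) := by
          funext k
          rcases Fin.eq_self_or_eq_succAbove i k with rfl | ⟨k, rfl⟩
          · rw [(hkey w hw.1).1, (hkey w' hw'.1).1]
          · exact congrFun hww k
        have h2 := hinj hw.2 hw'.2 h1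
        exact (hkey w hw.1).2.symm.trans ((congrArg L₂ h2).trans (hkey w' hw'.1).2)

/-- Countably many injective smooth maps whose images cover an open set: the derivative of one of
them is invertible at some point. -/
theorem exists_regular_point {e c : ℕ} {T : Type*} [Countable T]
    {h : T → EuclideanSpace ℝ (Fin c) → EuclideanSpace ℝ (Fin e)}
    {S : T → Set (EuclideanSpace ℝ (Fin c))} (hS : ∀ i, IsOpen (S i))
    (hh : ∀ i, ContDiffOn ℝ ∞ (h i) (S i)) (hinj : ∀ i, InjOn (h i) (S i))
    {B : Set (EuclideanSpace ℝ (Fin e))} (hB : IsOpen B) (hne : B.Nonempty)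
    (hcov : B ⊆ ⋃ i, h i '' S i) :
    ∃ i, ∃ v ∈ S i, ∃ D : EuclideanSpace ℝ (Fin c) ≃L[ℝ] EuclideanSpace ℝ (Fin e),
      HasFDerivAt (h i) (D : EuclideanSpace ℝ (Fin c) →L[ℝ] EuclideanSpace ℝ (Fin e)) v := by
  have hce : c ≤ e := by
    obtain ⟨w, hw⟩ := hne
    obtain ⟨i, v, hv, -⟩ := mem_iUnion.1 (hcov hw)
    let Φ := (EuclideanSpace.equiv (Fin e) ℝ)
    refine le_of_contDiffOn_injOn (f := fun v => Φ (h i v)) (hS i) ⟨v, hv⟩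
      (Φ.contDiff.comp_contDiffOn (hh i)) fun v hv w hw hvw => hinj i hv hw (Φ.injective hvw)
  -- Precomposition with a linear surjection makes source and target of equal dimension, so that
  -- images of sets of vanishing Jacobian are null.
  obtain ⟨L, hL⟩ : ∃ L : EuclideanSpace ℝ (Fin e) →L[ℝ] EuclideanSpace ℝ (Fin c),
      Function.Surjective L := by
    refine ⟨((EuclideanSpace.equiv (Fin c) ℝ).symm.toLinearMap ∘ₗ
      (LinearMap.funLeft ℝ ℝ (Fin.castLE hce)) ∘ₗ
      (EuclideanSpace.equiv (Fin e) ℝ).toLinearMap).toContinuousLinearMap, ?_⟩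
    exact (EuclideanSpace.equiv (Fin c) ℝ).symm.surjective.comp
      ((LinearMap.funLeft_surjective_of_injective ℝ ℝ _ (Fin.castLE_injective hce)).comp
        (EuclideanSpace.equiv (Fin e) ℝ).surjective)
  by_contra! hcon
  have hnull : ∀ i, MeasureTheory.volume ((fun u => h i (L u)) '' (L ⁻¹' S i)) = 0 := by
    intro i
    have hd : ∀ u ∈ L ⁻¹' S i, HasFDerivAt (h i) (fderiv ℝ (h i) (L u)) (L u) := fun u hu =>
      (((hh i).contDiffAt ((hS i).mem_nhds hu)).differentiableAt (by simp)).hasFDerivAt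
    refine MeasureTheory.addHaar_image_eq_zero_of_det_fderivWithin_eq_zero _
      (f' := fun u => (fderiv ℝ (h i) (L u)).comp L)
      (fun u hu => ((hd u hu).comp u L.hasFDerivAt).hasFDerivWithinAt) fun u hu => ?_
    -- A nonzero Jacobian makes the derivative of `h i` surjective; together with `c ≤ e` this gives
    -- `c = e`, and the derivative is invertible, against `hcon`.
    by_contra hdet
    have hsurj : Function.Surjective (fderiv ℝ (h i) (L u)) := by
      have h1 : IsUnit (((fderiv ℝ (h i) (L u)).comp L : EuclideanSpace ℝ (Fin e) →L[ℝ]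
          EuclideanSpace ℝ (Fin e)) : EuclideanSpace ℝ (Fin e) →ₗ[ℝ]
          EuclideanSpace ℝ (Fin e)) := by
        rw [LinearMap.isUnit_iff_isUnit_det]
        exact isUnit_iff_ne_zero.2 hdet
      have h2 := ((Module.End.isUnit_iff _).1 h1).2
      exact Function.Surjective.of_comp (g := L) h2
    have hec : e ≤ c := by
      have := LinearMap.finrank_le_finrank_of_surjective
        (f := (fderiv ℝ (h i) (L u)).toLinearMap) hsurj
      simpa using this
    have hinj' : Function.Injective (fderiv ℝ (h i) (L u)) :=
      (LinearMap.injective_iff_surjective_of_finrank_eq_finrank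
        (f := (fderiv ℝ (h i) (L u)).toLinearMap) (by simp; omega)).2 hsurj
    refine hcon i (L u) hu (ContinuousLinearEquiv.ofBijective (fderiv ℝ (h i) (L u))
      (LinearMap.ker_eq_bot.2 hinj') (LinearMap.range_eq_top.2 hsurj)) ?_
    rw [ContinuousLinearEquiv.coe_ofBijective]
    exact hd u hu
  refine hB.measure_ne_zero MeasureTheory.volume hne (MeasureTheory.measure_mono_null hcov ?_)
  refine MeasureTheory.measure_iUnion_null fun i => MeasureTheory.measure_mono_null ?_ (hnull i)
  rintro _ ⟨v, hv, rfl⟩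
  obtain ⟨u, rfl⟩ := hL v
  exact ⟨u, hv, rfl⟩

/-! ### Algebra of groupoids and bibundles -/

namespace LieGroupoid

variable {k m n m' n' d : ℕ}

section Algebra

variable (G : LieGroupoid.{u} m n)

lemma inv_unique {g h : G.Arr} (hgh : G.src g = G.tgt h) (h1 : G.mul g h = G.unit (G.src h)) :
    g = G.inv h := by
  have h2 : G.mul (G.mul g h) (G.inv h) = G.mul g (G.mul h (G.inv h)) :=
    G.mul_assoc _ _ _ hgh (G.tgt_inv h).symm
  rw [G.mul_inv, ← hgh, G.mul_unit, h1] at h2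
  rw [← h2]
  conv_rhs => rw [← G.unit_mul (G.inv h), G.tgt_inv]

lemma inv_inv (g : G.Arr) : G.inv (G.inv g) = g :=
  (G.inv_unique (G.tgt_inv g).symm (by rw [G.mul_inv, G.src_inv])).symm

lemma inv_unit (x : G.Obj) : G.inv (G.unit x) = G.unit x := by
  refine (G.inv_unique (by rw [G.src_unit, G.tgt_unit]) ?_).symm
  have := G.mul_unit (G.unit x)
  rwa [G.src_unit] at this ⊢

lemma inv_mul_rev {g h : G.Arr} (hgh : G.src g = G.tgt h) :
    G.inv (G.mul g h) = G.mul (G.inv h) (G.inv g) := by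
  have h0 : G.src (G.inv h) = G.tgt (G.inv g) := by rw [G.src_inv, G.tgt_inv, hgh]
  refine (G.inv_unique ?_ ?_).symm
  · rw [G.src_mul _ _ h0, G.src_inv, G.tgt_mul _ _ hgh]
  · rw [G.mul_assoc _ _ _ h0 (by rw [G.src_inv, G.tgt_mul _ _ hgh]),
      ← G.mul_assoc (G.inv g) g h (G.src_inv g) hgh, G.inv_mul, hgh, G.unit_mul, G.inv_mul,
      G.src_mul _ _ hgh]

lemma mul_inv_cancel_left {g h : G.Arr} (hgh : G.tgt g = G.tgt h) :
    G.mul g (G.mul (G.inv g) h) = h := by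
  rw [← G.mul_assoc _ _ _ (G.tgt_inv g).symm (by rw [G.src_inv, hgh]), G.mul_inv, hgh, G.unit_mul]

end Algebra

namespace Bibundle

variable {G' : LieGroupoid.{u} m' n'} {G : LieGroupoid.{u} m n}

lemma inv_actL (P : Bibundle G' G d) {g : G'.Arr} {p : P.Tot} (h : G'.src g = P.momL p) :
    P.actL (G'.inv g) (P.actL g p) = p := by
  rw [← P.mul_actL _ _ _ (G'.src_inv g) h, G'.inv_mul, h, P.unit_actL]

lemma actR_inv (P : Bibundle G' G d) {g : G.Arr} {p : P.Tot} (h : P.momR p = G.tgt g) :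
    P.actR (P.actR p g) (G.inv g) = p := by
  rw [← P.actR_mul _ _ _ h (G.tgt_inv g).symm, G.mul_inv, ← h, P.actR_unit]

/-- The opposite bibundle, in which the two actions are exchanged. -/
abbrev op (P : Bibundle G' G d) : Bibundle G G' d where
  Tot := P.Tot
  momL := P.momR
  momR := P.momL
  actL g p := P.actR p (G.inv g)
  actR p g := P.actL (G'.inv g) p
  momL_smooth := P.momR_smooth
  momR_smooth := P.momL_smooth
  actL_smooth := by
    refine P.actR_smooth.comp (f := fun x : G.Arr × P.Tot => (x.2, G.inv x.1))
      (contMDiffOn_snd.prodMk (G.inv_smooth.comp_contMDiffOn contMDiffOn_fst)) fun x hx => ?_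
    exact hx.symm.trans (G.tgt_inv _).symm
  actR_smooth := by
    refine P.actL_smooth.comp (f := fun x : P.Tot × G'.Arr => (G'.inv x.2, x.1))
      ((G'.inv_smooth.comp_contMDiffOn contMDiffOn_snd).prodMk contMDiffOn_fst) fun x hx => ?_
    exact (G'.src_inv _).trans hx.symm
  momL_actL g p h := by rw [P.momR_actR _ _ (by rw [G.tgt_inv, h]), G.src_inv]
  momR_actL g p h := P.momL_actR _ _ (by rw [G.tgt_inv, h])
  momR_actR p g h := by rw [P.momL_actL _ _ (by rw [G'.src_inv, h]), G'.tgt_inv]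
  momL_actR p g h := P.momR_actL _ _ (by rw [G'.src_inv, h])
  unit_actL p := by rw [G.inv_unit, P.actR_unit]
  actR_unit p := by rw [G'.inv_unit, P.unit_actL]
  mul_actL g h p h1 h2 := by
    rw [G.inv_mul_rev h1, P.actR_mul _ _ _ (by rw [G.tgt_inv, h2])
      (by rw [G.src_inv, G.tgt_inv, h1])]
  actR_mul p g h h1 h2 := by
    rw [G'.inv_mul_rev h2, P.mul_actL _ _ _ (by rw [G'.src_inv, G'.tgt_inv, h2])
      (by rw [G'.src_inv, h1])]
  act_comm g p h h1 h2 :=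
    (P.act_comm _ _ _ (by rw [G'.src_inv, h2]) (by rw [G.tgt_inv, h1])).symm

/-- The left action is free and transitive on the fibres of the right moment map, which is a
submersion. -/
structure IsLeftTorsor (P : Bibundle G' G d) : Prop where
  submersion : Manifold.IsSubmersion (𝓡 d) (𝓡 m) ∞ P.momR
  free : ∀ g p, G'.src g = P.momL p → P.actL g p = p → g = G'.unit (P.momL p)
  orbit : ∀ p q, P.momR p = P.momR q → ∃ g, G'.src g = P.momL p ∧ P.actL g p = q

lemma IsLeftPrincipal.isLeftTorsor {P : Bibundle G' G d} (h : P.IsLeftPrincipal) :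
    P.IsLeftTorsor := ⟨h.submersion, h.free, h.orbit⟩

/-- Passing to the opposite bibundle turns statements about right division into those about left
division, so the analysis is carried out only once. -/
lemma IsRightPrincipal.isLeftTorsor_op {P : Bibundle G' G d} (h : P.IsRightPrincipal) :
    P.op.IsLeftTorsor where
  submersion := h.submersion
  free g p h1 h2 := by
    have h3 := h.free p (G.inv g) (h1.symm.trans (G.tgt_inv g).symm) h2
    rw [← G.inv_inv g, h3, G.inv_unit]
  orbit p q hpq := by
    obtain ⟨g, h1, h2⟩ := h.orbit p q hpq
    exact ⟨G.inv g, (G.src_inv g).trans h1.symm, by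
      change P.actR p (G.inv (G.inv g)) = q; rw [G.inv_inv, h2]⟩

namespace IsLeftTorsor

variable {P : Bibundle G' G d}

lemma actL_injective (hP : P.IsLeftTorsor) {g g' : G'.Arr} {p : P.Tot} (hg : G'.src g = P.momL p)
    (hg' : G'.src g' = P.momL p) (h : P.actL g p = P.actL g' p) : g = g' := by
  have ht : G'.tgt g' = G'.tgt g := by
    rw [← P.momL_actL g p hg, h, P.momL_actL g' p hg']
  have h0 : G'.src (G'.inv g') = G'.tgt g := by rw [G'.src_inv, ht]
  have h1 : P.actL (G'.mul (G'.inv g') g) p = p := by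
    rw [P.mul_actL _ _ _ h0 hg, h, P.inv_actL hg']
  have h2 := hP.free _ _ (by rw [G'.src_mul _ _ h0, hg]) h1
  rw [← G'.mul_inv_cancel_left ht, h2, ← hg', G'.mul_unit]

open Classical in
/-- The division map of a left torsor: `divL q p` is the arrow with `divL q p · p = q`. -/
def divL (_ : P.IsLeftTorsor) (q p : P.Tot) : G'.Arr :=
  if h : ∃ g, G'.src g = P.momL p ∧ P.actL g p = q then h.choose else G'.unit (P.momL p)

lemma divL_spec (hP : P.IsLeftTorsor) {q p : P.Tot} (h : P.momR q = P.momR p) :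
    G'.src (hP.divL q p) = P.momL p ∧ P.actL (hP.divL q p) p = q := by
  have h' := hP.orbit p q h.symm
  rw [divL, dif_pos h']
  exact h'.choose_spec

lemma src_divL (hP : P.IsLeftTorsor) {q p : P.Tot} (h : P.momR q = P.momR p) :
    G'.src (hP.divL q p) = P.momL p := (hP.divL_spec h).1

lemma actL_divL (hP : P.IsLeftTorsor) {q p : P.Tot} (h : P.momR q = P.momR p) :
    P.actL (hP.divL q p) p = q := (hP.divL_spec h).2

lemma tgt_divL (hP : P.IsLeftTorsor) {q p : P.Tot} (h : P.momR q = P.momR p) :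
    G'.tgt (hP.divL q p) = P.momL q := by
  rw [← P.momL_actL _ _ (hP.src_divL h), hP.actL_divL h]

lemma divL_eq (hP : P.IsLeftTorsor) {g : G'.Arr} {q p : P.Tot} (hg : G'.src g = P.momL p)
    (h : P.actL g p = q) : hP.divL q p = g := by
  have h1 : P.momR q = P.momR p := by rw [← h, P.momR_actL _ _ hg]
  exact hP.actL_injective (hP.src_divL h1) hg (by rw [hP.actL_divL h1, h])

end IsLeftTorsor

/-! ### Smoothness of the division map -/

namespace IsLeftTorsor

variable {P : Bibundle G' G d}

/-- A local parametrization of the source fibres, acting on points near `p`. -/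
lemma smoothNear_actL_κ {c : ℕ} {κ : G'.Obj × EuclideanSpace ℝ (Fin c) → G'.Arr}
    {v : EuclideanSpace ℝ (Fin c)} {p : P.Tot}
    (hκ : SmoothNear ((𝓡 m').prod (𝓡 c)) (𝓡 n') κ (P.momL p, v))
    (hsrc : ∀ᶠ w in 𝓝 (P.momL p, v), G'.src (κ w) = w.1) :
    SmoothNear ((𝓡 d).prod (𝓡 c)) (𝓡 d)
      (fun z : P.Tot × EuclideanSpace ℝ (Fin c) => P.actL (κ (P.momL z.1, z.2)) z.1) (p, v) := by
  have h1 : SmoothNear ((𝓡 d).prod (𝓡 c)) ((𝓡 m').prod (𝓡 c))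
      (fun z : P.Tot × EuclideanSpace ℝ (Fin c) => (P.momL z.1, z.2)) (p, v) :=
    SmoothNear.prodMk (SmoothNear.comp (J := 𝓡 d) (P.momL_smooth.smoothNear _) smoothNear_id.fst)
      smoothNear_id.snd
  have h2 : SmoothNear ((𝓡 d).prod (𝓡 c)) ((𝓡 n').prod (𝓡 d))
      (fun z : P.Tot × EuclideanSpace ℝ (Fin c) => (κ (P.momL z.1, z.2), z.1)) (p, v) :=
    SmoothNear.prodMk (SmoothNear.comp (J := (𝓡 m').prod (𝓡 c))
      (f := fun z : P.Tot × EuclideanSpace ℝ (Fin c) => (P.momL z.1, z.2)) hκ h1) smoothNear_id.fst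
  exact P.actL_smooth.comp_smoothNear h2 (h1.continuousAt.eventually hsrc)

/-- The orbit map through a point has an invertible derivative at some arrow. -/
lemma exists_regular_arrow (hP : P.IsLeftTorsor) (p₀ : P.Tot)
    {pr₀ : P.Tot → EuclideanSpace ℝ (Fin (d - m))}
    {κ₀ : G.Obj × EuclideanSpace ℝ (Fin (d - m)) → P.Tot}
    (h₀ : IsLocalProduct d m P.momR p₀ pr₀ κ₀) :
    ∃ (κ : G'.Obj × EuclideanSpace ℝ (Fin (n' - m')) → G'.Arr)
      (v : EuclideanSpace ℝ (Fin (n' - m')))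
      (T : EuclideanSpace ℝ (Fin (n' - m')) ≃L[ℝ] EuclideanSpace ℝ (Fin (d - m))),
      SmoothNear ((𝓡 m').prod (𝓡 (n' - m'))) (𝓡 n') κ (P.momL p₀, v) ∧
      (∀ᶠ w in 𝓝 (P.momL p₀, v), G'.src (κ w) = w.1) ∧
      (∀ᶠ q in 𝓝 (P.actL (κ (P.momL p₀, v)) p₀), κ₀ (P.momR q, pr₀ q) = q) ∧
      SmoothNear (𝓡 d) (𝓡 (d - m)) pr₀ (P.actL (κ (P.momL p₀, v)) p₀) ∧
      HasFDerivAt (fun w => pr₀ (P.actL (κ (P.momL p₀, w)) p₀))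
        (T : EuclideanSpace ℝ (Fin (n' - m')) →L[ℝ] EuclideanSpace ℝ (Fin (d - m))) v := by
  -- On `N` the fibre coordinate `pr₀` is smooth and, together with `momR`, determines the point.
  obtain ⟨N, hN, hNo, hpN⟩ := eventually_nhds_iff.1 (h₀.smooth_pr.and h₀.left_inv)
  choose pr κ hκ using fun g : G'.Arr => ((G'.src_submersion.isSubmersionAt g).exists_isLocalProduct).2
  set x₀ := P.momL p₀ with hx₀
  let A : Set G'.Arr := {g | G'.src g = x₀}
  have hV : ∀ g : G'.Arr, ∃ V : Set (EuclideanSpace ℝ (Fin (n' - m'))), IsOpen V ∧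
      (g ∈ A → pr g g ∈ V) ∧ ∀ v ∈ V,
      SmoothNear ((𝓡 m').prod (𝓡 (n' - m'))) (𝓡 n') (κ g) (x₀, v) ∧
      ∀ᶠ w in 𝓝 (x₀, v), G'.src (κ g w) = w.1 ∧ pr g (κ g w) = w.2 := by
    intro g
    by_cases hg : g ∈ A
    · have h1 : ∀ᶠ w in 𝓝 (x₀, pr g g),
          SmoothNear ((𝓡 m').prod (𝓡 (n' - m'))) (𝓡 n') (κ g) w ∧
          ∀ᶠ w' in 𝓝 w, G'.src (κ g w') = w'.1 ∧ pr g (κ g w') = w'.2 := by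
        rw [← (show G'.src g = x₀ from hg)]
        exact (hκ g).smooth_κ.eventually.and (eventually_eventually_nhds.2 (hκ g).right_inv)
      have h2 : Tendsto (fun v => (x₀, v)) (𝓝 (pr g g)) (𝓝 (x₀, pr g g)) :=
        (Continuous.prodMk_right x₀).continuousAt
      obtain ⟨V, h3, h4, h5⟩ := eventually_nhds_iff.1 (h2.eventually h1)
      exact ⟨V, h4, fun _ => h5, h3⟩
    · exact ⟨∅, isOpen_empty, fun h => (hg h).elim, fun v hv => hv.elim⟩
  choose V hVo hgV hVκ using hV
  let act : G'.Arr → EuclideanSpace ℝ (Fin (n' - m')) → P.Tot :=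
    fun g v => P.actL (κ g (x₀, v)) p₀
  have hact : ∀ g, ∀ v ∈ V g, SmoothNear (𝓡 (n' - m')) (𝓡 d) (act g) v := by
    intro g v hv
    have h1 := smoothNear_actL_κ (P := P) (p := p₀) (hVκ g v hv).1
      ((hVκ g v hv).2.mono fun _ h => h.1)
    exact SmoothNear.comp (J := (𝓡 d).prod (𝓡 (n' - m')))
      (f := fun v => (p₀, v)) h1 (smoothNear_const.prodMk smoothNear_id)
  have hactV : ∀ g, ContinuousOn (act g) (V g) := fun g v hv =>
    (hact g v hv).continuousAt.continuousWithinAt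
  let S : G'.Arr → Set (EuclideanSpace ℝ (Fin (n' - m'))) := fun g => V g ∩ act g ⁻¹' N
  have hSo : ∀ g, IsOpen (S g) := fun g => (hactV g).isOpen_inter_preimage (hVo g) hNo
  have hsrc : ∀ g, ∀ v ∈ V g, G'.src (κ g (x₀, v)) = x₀ ∧ pr g (κ g (x₀, v)) = v :=
    fun g v hv => (hVκ g v hv).2.self_of_nhds
  -- The Lindelöf property: countably many parametrized pieces cover the source fibre `A`.
  obtain ⟨C, hCA, hCc, hAC⟩ := TopologicalSpace.countable_cover_nhdsWithin (s := A)
    (f := fun g => {g' | g' ∈ A → pr g g' ∈ V g ∧ κ g (x₀, pr g g') = g'}) fun g hg => by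
      refine nhdsWithin_le_nhds ?_
      filter_upwards [(hκ g).left_inv,
        (hκ g).smooth_pr.eventually_mem rfl ((hVo g).mem_nhds (hgV g hg))] with g' h1 h2 hg'
      exact ⟨h2, by rw [← (show G'.src g' = x₀ from hg'), h1]⟩
  have hw : ∀ᶠ w in 𝓝 (pr₀ p₀), κ₀ (P.momR p₀, w) ∈ N ∧
      P.momR (κ₀ (P.momR p₀, w)) = P.momR p₀ ∧ pr₀ (κ₀ (P.momR p₀, w)) = w := by
    have h2 : Tendsto (fun v => (P.momR p₀, v)) (𝓝 (pr₀ p₀)) (𝓝 (P.momR p₀, pr₀ p₀)) :=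
      (Continuous.prodMk_right _).continuousAt
    filter_upwards [h2.eventually (h₀.smooth_κ.eventually_mem h₀.κ_apply (hNo.mem_nhds hpN)),
      h2.eventually h₀.right_inv] with w h3 h4
    exact ⟨h3, h4⟩
  obtain ⟨B, hB, hBo, hpB⟩ := eventually_nhds_iff.1 hw
  have := hCc.to_subtype
  -- The countable family consists of the orbit map through `p₀`, written in parameters of the
  -- source fibre and in the fibre coordinate `pr₀`. Injectivity is freeness of the action; covering
  -- the open set `B` is transitivity on the fibre of `momR`.
  obtain ⟨⟨g, hgC⟩, v, hv, T, hT⟩ := exists_regular_point (T := C)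
    (h := fun g v => pr₀ (act g v)) (S := fun g => S g) (fun g => hSo g)
    (fun g v hv => by
      have h1 : SmoothNear (𝓡 (n' - m')) (𝓡 (d - m)) (fun v => pr₀ (act g v)) v :=
        SmoothNear.comp (J := 𝓡 d) (Eventually.mono (hNo.mem_nhds hv.2) fun q hq => (hN q hq).1)
          (hact g v hv.1)
      exact (smoothNear_iff_contDiff.1 h1).self_of_nhds.contDiffWithinAt)
    (fun g v hv v' hv' hvv => by
      have h1 := (hN _ hv.2).2
      have h2 := (hN _ hv'.2).2
      have h3 : P.momR (act g v) = P.momR (act g v') :=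
        (P.momR_actL _ _ (hsrc g v hv.1).1).trans (P.momR_actL _ _ (hsrc g v' hv'.1).1).symm
      have h4 : act g v = act g v' := by
        rw [← h1, ← h2, h3]; exact congrArg (fun w => κ₀ (_, w)) hvv
      have h5 := hP.actL_injective (hsrc g v hv.1).1 (hsrc g v' hv'.1).1 h4
      rw [← (hsrc g v hv.1).2, h5, (hsrc g v' hv'.1).2])
    hBo ⟨_, hpB⟩ (fun w hw => by
      obtain ⟨h1, h2, h3⟩ := hB w hw
      obtain ⟨g', hg', hgp⟩ := hP.orbit p₀ (κ₀ (P.momR p₀, w)) h2.symm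
      obtain ⟨g, hgC, hg⟩ := mem_iUnion₂.1 (hAC hg')
      obtain ⟨h4, h5⟩ := hg hg'
      have h6 : act g (pr g g') = κ₀ (P.momR p₀, w) := by
        change P.actL (κ g (x₀, pr g g')) p₀ = _
        rw [h5, hgp]
      refine mem_iUnion.2 ⟨⟨g, hgC⟩, pr g g', ⟨h4, ?_⟩, ?_⟩
      · rw [mem_preimage, h6]; exact h1
      · change pr₀ (act g (pr g g')) = w
        rw [h6, h3])
  refine ⟨κ g, v, T, (hVκ g v hv.1).1, (hVκ g v hv.1).2.mono fun _ h => h.1, ?_, ?_, hT⟩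
  · exact Eventually.mono (hNo.mem_nhds hv.2) fun q hq => (hN q hq).2
  · exact Eventually.mono (hNo.mem_nhds hv.2) fun q hq => (hN q hq).1

/-- The division map is smooth near some point over every point. -/
lemma exists_smooth_divL_point (hP : P.IsLeftTorsor) (p₀ : P.Tot) :
    ∃ g₀, G'.src g₀ = P.momL p₀ ∧ ∃ D : P.Tot × P.Tot → G'.Arr,
      SmoothNear ((𝓡 d).prod (𝓡 d)) (𝓡 n') D (P.actL g₀ p₀, p₀) ∧
      ∀ᶠ x in 𝓝 (P.actL g₀ p₀, p₀), P.momR x.1 = P.momR x.2 → D x = hP.divL x.1 x.2 := by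
  obtain ⟨-, pr₀, κ₀, h₀⟩ := (hP.submersion.isSubmersionAt p₀).exists_isLocalProduct
  obtain ⟨κ, v, T, hκ, hsrc, hκ₀, hpr₀, hT⟩ := hP.exists_regular_arrow p₀ h₀
  have hsrc₀ : G'.src (κ (P.momL p₀, v)) = P.momL p₀ := hsrc.self_of_nhds
  set q₀ := P.actL (κ (P.momL p₀, v)) p₀ with hq₀
  have hactκ := smoothNear_actL_κ (P := P) (p := p₀) hκ hsrc
  set ψ := chartAt (EuclideanSpace ℝ (Fin d)) p₀
  have hps : p₀ ∈ ψ.source := mem_chart_source _ p₀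
  have hψp : ψ.symm (ψ p₀) = p₀ := ψ.left_inv hps
  have hψ : SmoothNear (𝓡 d) (𝓡 d) ψ p₀ := smoothNear_chartAt p₀ hps
  have hψ' : SmoothNear (𝓡 d) (𝓡 d) ψ.symm (ψ p₀) := smoothNear_chartAt_symm p₀ (ψ.map_source hps)
  let Em := EuclideanSpace ℝ (Fin d)
  let Ec := EuclideanSpace ℝ (Fin (n' - m'))
  let Ee := EuclideanSpace ℝ (Fin (d - m))
  -- `F (u, v)` is the fibre coordinate of the translate of the point with coordinates `u` by the
  -- arrow with parameter `v`. Its partial derivative in `v` is the invertible `T`, so `Θ (u, v) =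
  -- (u, F (u, v))` has an invertible triangular derivative. Solving `Θ (u, v) = (ψ p, pr₀ q)` for
  -- `v` produces the arrow from `p` to `q`.
  let F : Em × Ec → Ee := fun z => pr₀ (P.actL (κ (P.momL (ψ.symm z.1), z.2)) (ψ.symm z.1))
  have hF : SmoothNear ((𝓡 d).prod (𝓡 (n' - m'))) (𝓡 (d - m)) F (ψ p₀, v) := by
    have h1 : SmoothNear ((𝓡 d).prod (𝓡 (n' - m'))) ((𝓡 d).prod (𝓡 (n' - m')))
        (fun z : Em × Ec => (ψ.symm z.1, z.2)) (ψ p₀, v) :=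
      SmoothNear.prodMk (SmoothNear.comp (J := 𝓡 d) hψ' smoothNear_id.fst) smoothNear_id.snd
    have h2 := SmoothNear.comp (J := (𝓡 d).prod (𝓡 (n' - m'))) (g := fun z : P.Tot × Ec =>
      P.actL (κ (P.momL z.1, z.2)) z.1) (f := fun z : Em × Ec => (ψ.symm z.1, z.2))
      (x := (ψ p₀, v)) (by simp only [hψp]; exact hactκ) h1
    refine SmoothNear.comp (J := 𝓡 d) (g := pr₀)
      (f := fun z : Em × Ec => P.actL (κ (P.momL (ψ.symm z.1), z.2)) (ψ.symm z.1)) ?_ h2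
    simp only [hψp]; exact hpr₀
  have hF' : SmoothNear 𝓘(ℝ, Em × Ec) 𝓘(ℝ, Ee) F (ψ p₀, v) := by
    rwa [modelWithCornersSelf_prod, ← chartedSpaceSelf_prod]
  have hFd : HasFDerivAt F (fderiv ℝ F (ψ p₀, v)) (ψ p₀, v) :=
    ((smoothNear_iff_contDiff.1 hF').self_of_nhds.differentiableAt (by simp)).hasFDerivAt
  have hT' : ∀ w, fderiv ℝ F (ψ p₀, v) (0, w) = T w := by
    have h1 : HasFDerivAt (fun w : Ec => F (ψ p₀, w))
        ((fderiv ℝ F (ψ p₀, v)).comp (ContinuousLinearMap.inr ℝ Em Ec)) v :=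
      HasFDerivAt.comp (g := F) v hFd (hasFDerivAt_prodMk_right (ψ p₀) v)
    have h2 : (fun w : Ec => F (ψ p₀, w)) = fun w => pr₀ (P.actL (κ (P.momL p₀, w)) p₀) := by
      funext w; simp only [F, hψp]
    rw [h2] at h1
    intro w
    exact congrArg (fun L : Ec →L[ℝ] Ee => L w) (h1.unique hT)
  let Θ : Em × Ec → Em × Ee := fun z => (z.1, F z)
  let A : Em →L[ℝ] Ee := (fderiv ℝ F (ψ p₀, v)).comp (ContinuousLinearMap.inl ℝ Em Ec)
  let Θ' : (Em × Ec) ≃L[ℝ] (Em × Ee) :=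
    (ContinuousLinearEquiv.refl ℝ Em).skewProd T A
  have hΘd : HasFDerivAt Θ (Θ' : Em × Ec →L[ℝ] Em × Ee) (ψ p₀, v) := by
    have h1 : HasFDerivAt Θ ((ContinuousLinearMap.fst ℝ Em Ec).prod (fderiv ℝ F (ψ p₀, v)))
        (ψ p₀, v) := hasFDerivAt_fst.prodMk hFd
    have h2 : (Θ' : Em × Ec →L[ℝ] Em × Ee) =
        (ContinuousLinearMap.fst ℝ Em Ec).prod (fderiv ℝ F (ψ p₀, v)) := by
      refine ContinuousLinearMap.ext fun z => Prod.ext rfl ?_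
      change T z.2 + fderiv ℝ F (ψ p₀, v) (z.1, 0) = fderiv ℝ F (ψ p₀, v) z
      rw [← hT', ← map_add]
      simp
    rw [h2]
    exact h1
  have hΘs : SmoothNear 𝓘(ℝ, Em × Ec) 𝓘(ℝ, Em × Ee) Θ (ψ p₀, v) := by
    rw [smoothNear_iff_contDiff] at hF' ⊢
    filter_upwards [hF'] with z hz
    exact contDiffAt_fst.prodMk hz
  obtain ⟨e, hze, hef, he1, he2⟩ := hΘs.exists_openPartialHomeomorph _ hΘd
  have he2' : SmoothNear ((𝓡 d).prod (𝓡 (d - m))) ((𝓡 d).prod (𝓡 (n' - m'))) e.symm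
      (e (ψ p₀, v)) := by
    have := (contMDiffOn_iff_contDiffOn.2 he2).smoothNear
      (e.open_target.mem_nhds (e.map_source hze))
    rwa [modelWithCornersSelf_prod, modelWithCornersSelf_prod, ← chartedSpaceSelf_prod,
      ← chartedSpaceSelf_prod] at this
  have hez : e (ψ p₀, v) = (ψ p₀, pr₀ q₀) := by
    rw [hef]
    change (ψ p₀, pr₀ (P.actL (κ (P.momL (ψ.symm (ψ p₀)), v)) (ψ.symm (ψ p₀)))) = _
    rw [hψp]
  have hes : e.symm (ψ p₀, pr₀ q₀) = (ψ p₀, v) := by rw [← hez, e.left_inv hze]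
  rw [hez] at he2'
  have hin : SmoothNear ((𝓡 d).prod (𝓡 d)) ((𝓡 d).prod (𝓡 (d - m)))
      (fun x : P.Tot × P.Tot => (ψ x.2, pr₀ x.1)) (q₀, p₀) :=
    SmoothNear.prodMk (SmoothNear.comp (J := 𝓡 d) hψ smoothNear_id.snd)
      (SmoothNear.comp (J := 𝓡 d) hpr₀ smoothNear_id.fst)
  have hv : SmoothNear ((𝓡 d).prod (𝓡 d)) (𝓡 (n' - m'))
      (fun x : P.Tot × P.Tot => (e.symm (ψ x.2, pr₀ x.1)).2) (q₀, p₀) :=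
    (SmoothNear.comp (J := (𝓡 d).prod (𝓡 (d - m))) (g := e.symm)
      (f := fun x : P.Tot × P.Tot => (ψ x.2, pr₀ x.1)) he2' hin).snd
  have hw : SmoothNear ((𝓡 d).prod (𝓡 d)) ((𝓡 m').prod (𝓡 (n' - m')))
      (fun x : P.Tot × P.Tot => (P.momL x.2, (e.symm (ψ x.2, pr₀ x.1)).2)) (q₀, p₀) :=
    (SmoothNear.comp (J := 𝓡 d) (P.momL_smooth.smoothNear _) smoothNear_id.snd).prodMk hv
  have hwx : (P.momL p₀, (e.symm (ψ p₀, pr₀ q₀)).2) = (P.momL p₀, v) := by rw [hes]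
  refine ⟨κ (P.momL p₀, v), hsrc₀,
    fun x => κ (P.momL x.2, (e.symm (ψ x.2, pr₀ x.1)).2), ?_, ?_⟩
  · refine SmoothNear.comp (J := (𝓡 m').prod (𝓡 (n' - m')))
      (f := fun x : P.Tot × P.Tot => (P.momL x.2, (e.symm (ψ x.2, pr₀ x.1)).2)) ?_ hw
    simp only [← hq₀, hes]
    exact hκ
  · have h1 : ∀ᶠ x : P.Tot × P.Tot in 𝓝 (q₀, p₀), (ψ x.2, pr₀ x.1) ∈ e.target :=
      hin.eventually_mem hez.symm (e.open_target.mem_nhds (e.map_source hze))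
    have h2 : ∀ᶠ x : P.Tot × P.Tot in 𝓝 (q₀, p₀), x.2 ∈ ψ.source :=
      continuousAt_snd.eventually (ψ.open_source.mem_nhds hps)
    have h3 : ∀ᶠ x : P.Tot × P.Tot in 𝓝 (q₀, p₀),
        G'.src (κ (P.momL x.2, (e.symm (ψ x.2, pr₀ x.1)).2)) = P.momL x.2 :=
      (hw.tendsto hwx).eventually hsrc
    have h4 : ∀ᶠ x : P.Tot × P.Tot in 𝓝 (q₀, p₀), κ₀ (P.momR x.1, pr₀ x.1) = x.1 :=
      (show Tendsto Prod.fst (𝓝 (q₀, p₀)) (𝓝 q₀) from continuousAt_fst).eventually hκ₀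
    have h5 : ∀ᶠ x : P.Tot × P.Tot in 𝓝 (q₀, p₀),
        κ₀ (P.momR (P.actL (κ (P.momL x.2, (e.symm (ψ x.2, pr₀ x.1)).2)) x.2),
          pr₀ (P.actL (κ (P.momL x.2, (e.symm (ψ x.2, pr₀ x.1)).2)) x.2)) =
          P.actL (κ (P.momL x.2, (e.symm (ψ x.2, pr₀ x.1)).2)) x.2 := by
      have h6 : Tendsto (fun x : P.Tot × P.Tot => (x.2, (e.symm (ψ x.2, pr₀ x.1)).2)) (𝓝 (q₀, p₀))
          (𝓝 (p₀, v)) := by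
        refine Tendsto.prodMk_nhds continuousAt_snd (hv.tendsto ?_)
        simp only [hes]
      exact (hactκ.continuousAt.tendsto.comp h6).eventually hκ₀
    filter_upwards [h1, h2, h3, h4, h5] with x h1 h2 h3 h4 h5 hx
    refine (hP.divL_eq h3 ?_).symm
    have h6 : Θ (e.symm (ψ x.2, pr₀ x.1)) = (ψ x.2, pr₀ x.1) := by rw [← hef, e.right_inv h1]
    have h7 : (e.symm (ψ x.2, pr₀ x.1)).1 = ψ x.2 := congrArg Prod.fst h6
    have h8 : F (e.symm (ψ x.2, pr₀ x.1)) = pr₀ x.1 := congrArg Prod.snd h6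
    simp only [F, h7, ψ.left_inv h2] at h8
    -- The translate of `x.2` and the point `x.1` have the same `momR` and the same fibre
    -- coordinate, so `κ₀` identifies them.
    rw [← h5, h8, P.momR_actL _ _ h3, ← hx, h4]

/-- The division map of a left torsor is smooth. -/
theorem divL_smooth (hP : P.IsLeftTorsor) :
    ContMDiffOn ((𝓡 d).prod (𝓡 d)) (𝓡 n') ∞ (fun x : P.Tot × P.Tot => hP.divL x.1 x.2)
      P.pairs := by
  rintro ⟨q₁, p₀⟩ (hqp : P.momR q₁ = P.momR p₀)
  obtain ⟨g₀, hg₀, D, hD, hDdiv⟩ := hP.exists_smooth_divL_point p₀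
  set g₁ := hP.divL q₁ p₀
  have hg₁ : G'.src g₁ = P.momL p₀ := hP.src_divL hqp
  have hg₁q : P.actL g₁ p₀ = q₁ := hP.actL_divL hqp
  have hc : G'.src g₀ = G'.tgt (G'.inv g₁) := by rw [G'.tgt_inv, hg₀, hg₁]
  -- The section `τ` passes through `g₀ g₁⁻¹`, whose action moves `q₁` to `g₀ p₀`, where division is
  -- already known to be smooth. Near `(q₁, p₀)` the quotient of `q` by `p` is then `τ⁻¹ · D (τ · q,
  -- p)`, with `τ` evaluated at `momL q`.
  obtain ⟨τ, hτ, hτx, hτs⟩ := G'.src_submersion.exists_localSection (G'.mul g₀ (G'.inv g₁))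
  have hs : G'.src (G'.mul g₀ (G'.inv g₁)) = P.momL q₁ := by
    rw [G'.src_mul _ _ hc, G'.src_inv, hP.tgt_divL hqp]
  rw [hs] at hτ hτx hτs
  obtain ⟨O, hO, hOo, hqO⟩ := eventually_nhds_iff.1 (hτ.and hτs)
  have hτq : P.actL (τ (P.momL q₁)) q₁ = P.actL g₀ p₀ := by
    rw [hτx, P.mul_actL _ _ _ hc (by rw [G'.src_inv, hP.tgt_divL hqp])]
    conv_lhs => rw [← hg₁q]
    rw [P.inv_actL hg₁]
  have hτs' : SmoothNear ((𝓡 d).prod (𝓡 d)) (𝓡 n') (fun x : P.Tot × P.Tot => τ (P.momL x.1))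
      (q₁, p₀) :=
    SmoothNear.comp (J := 𝓡 m') (f := fun x : P.Tot × P.Tot => P.momL x.1) hτ
      (SmoothNear.comp (J := 𝓡 d) (P.momL_smooth.smoothNear _) smoothNear_id.fst)
  have hsrc : ∀ᶠ x : P.Tot × P.Tot in 𝓝 (q₁, p₀), G'.src (τ (P.momL x.1)) = P.momL x.1 :=
    (show Tendsto (fun x : P.Tot × P.Tot => P.momL x.1) (𝓝 (q₁, p₀)) (𝓝 (P.momL q₁)) from
      (P.momL_smooth.continuous.comp continuous_fst).continuousAt).eventually hτs
  have hmove : SmoothNear ((𝓡 d).prod (𝓡 d)) ((𝓡 d).prod (𝓡 d))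
      (fun x : P.Tot × P.Tot => (P.actL (τ (P.momL x.1)) x.1, x.2)) (q₁, p₀) :=
    SmoothNear.prodMk (P.actL_smooth.comp_smoothNear
      (f := fun x : P.Tot × P.Tot => (τ (P.momL x.1), x.1)) (hτs'.prodMk smoothNear_id.fst) hsrc)
      smoothNear_id.snd
  have hmovex : (P.actL (τ (P.momL q₁)) q₁, p₀) = (P.actL g₀ p₀, p₀) := by rw [hτq]
  have hDm : SmoothNear ((𝓡 d).prod (𝓡 d)) (𝓡 n')
      (fun x : P.Tot × P.Tot => D (P.actL (τ (P.momL x.1)) x.1, x.2)) (q₁, p₀) := by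
    refine SmoothNear.comp (J := (𝓡 d).prod (𝓡 d)) (g := D)
      (f := fun x : P.Tot × P.Tot => (P.actL (τ (P.momL x.1)) x.1, x.2)) ?_ hmove
    simp only [hmovex]; exact hD
  have hpair : SmoothNear ((𝓡 d).prod (𝓡 d)) ((𝓡 n').prod (𝓡 n'))
      (fun x : P.Tot × P.Tot => (G'.inv (τ (P.momL x.1)),
        D (P.actL (τ (P.momL x.1)) x.1, x.2))) (q₁, p₀) :=
    SmoothNear.prodMk (SmoothNear.comp (J := 𝓡 n') (G'.inv_smooth.smoothNear _) hτs') hDm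
  set f : P.Tot × P.Tot → G'.Arr × G'.Arr := fun x => (G'.inv (τ (P.momL x.1)),
        D (P.actL (τ (P.momL x.1)) x.1, x.2)) with hf
  have hall : ∀ᶠ x : P.Tot × P.Tot in 𝓝 (q₁, p₀), x ∈ P.pairs →
      f x ∈ {y : G'.Arr × G'.Arr | G'.src y.1 = G'.tgt y.2} ∧
      G'.mul (f x).1 (f x).2 = hP.divL x.1 x.2 := by
    filter_upwards [hsrc, (hmove.tendsto hmovex).eventually hDdiv] with x h1 h2 hx
    have h3 : P.momR (P.actL (τ (P.momL x.1)) x.1) = P.momR x.2 := by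
      rw [P.momR_actL _ _ h1]; exact hx
    have h4 := h2 h3
    have h5 : G'.src (f x).1 = G'.tgt (f x).2 := by
      simp only [hf]
      rw [h4, hP.tgt_divL h3, P.momL_actL _ _ h1, G'.src_inv]
    have h6 : G'.src (f x).2 = P.momL x.2 := by
      simp only [hf]; rw [h4]; exact hP.src_divL h3
    refine ⟨h5, (hP.divL_eq (by rw [G'.src_mul _ _ h5, h6]) ?_).symm⟩
    rw [P.mul_actL _ _ _ h5 h6]
    simp only [hf]
    rw [h4, hP.actL_divL h3, P.inv_actL h1]
  obtain ⟨U, hU, hUo, hxU⟩ := eventually_nhds_iff.1 (hall.and hpair)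
  have hxm : (q₁, p₀) ∈ P.pairs := hqp
  have h1 : ContMDiffWithinAt ((𝓡 d).prod (𝓡 d)) (𝓡 n') ∞
      ((fun y : G'.Arr × G'.Arr => G'.mul y.1 y.2) ∘ f) (P.pairs ∩ U) (q₁, p₀) :=
    (G'.mul_smooth (f (q₁, p₀)) ((hU _ hxU).1 hxm).1).comp _
      (hU _ hxU).2.contMDiffWithinAt fun x hx => ((hU x hx.2).1 hx.1).1
  have h2 : ContMDiffWithinAt ((𝓡 d).prod (𝓡 d)) (𝓡 n') ∞
      (fun x : P.Tot × P.Tot => hP.divL x.1 x.2) (P.pairs ∩ U) (q₁, p₀) :=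
    h1.congr (fun x hx => ((hU x hx.2).1 hx.1).2.symm) ((hU _ hxU).1 hxm).2.symm
  exact (contMDiffWithinAt_inter (hUo.mem_nhds hxU)).1 h2

end IsLeftTorsor

end Bibundle

end LieGroupoid

/-! ### Fibre products as manifolds -/

/-- A manifold of dimension `e` with its identification with the fibre product of `f` and `g`. -/
structure FibreProduct {a b m : ℕ} {X : SmoothMfd.{u} a} {Y : SmoothMfd.{u} b}
    {B : SmoothMfd.{u} m} (f : X → B) (g : Y → B) (e : ℕ) where
  Tot : SmoothMfd.{u} e
  fst : Tot → X
  snd : Tot → Y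
  pair : X × Y → Tot
  fst_smooth : ContMDiff (𝓡 e) (𝓡 a) ∞ fst
  snd_smooth : ContMDiff (𝓡 e) (𝓡 b) ∞ snd
  pair_smooth : ContMDiffOn ((𝓡 a).prod (𝓡 b)) (𝓡 e) ∞ pair {z | f z.1 = g z.2}
  comm : ∀ t, f (fst t) = g (snd t)
  fst_pair : ∀ {x y}, f x = g y → fst (pair (x, y)) = x
  snd_pair : ∀ {x y}, f x = g y → snd (pair (x, y)) = y
  pair_eta : ∀ t, pair (fst t, snd t) = t

namespace FibreProduct

variable {a b m e : ℕ} {X : SmoothMfd.{u} a} {Y : SmoothMfd.{u} b} {B : SmoothMfd.{u} m}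
  {f : X → B} {g : Y → B}

/-- `hne` provides a point of the fibre product as soon as `Y` is nonempty, hence default values for
`pair`. The dimension identity is asked only at actual points, since an empty manifold has every
dimension. -/
theorem nonempty (hf : Manifold.IsSubmersion (𝓡 a) (𝓡 m) ∞ f) (hg : ContMDiff (𝓡 b) (𝓡 m) ∞ g)
    (hne : ∀ y, ∃ x, f x = g y) (he : ∀ x y, f x = g y → e + m = a + b) :
    Nonempty (FibreProduct f g e) := by
  obtain ⟨T, ι, h1, h2, mk, h3, -, h5, h6⟩ := exists_fibreProduct X Y B hf hg
    (fun ⟨z⟩ => let ⟨x, hx⟩ := hne z.2; ⟨(x, z.2), hx⟩) he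
  have h7 : ∀ {x y}, f x = g y → ι (mk (x, y)) = (x, y) := fun h => h6 h
  exact ⟨{ Tot := T
           fst := fun t => (ι t).1
           snd := fun t => (ι t).2
           pair := mk
           fst_smooth := (contMDiffOn_univ.1 h1).fst
           snd_smooth := (contMDiffOn_univ.1 h1).snd
           pair_smooth := h3
           comm := fun t => h2 (mem_univ t)
           fst_pair := fun h => by rw [h7 h]
           snd_pair := fun h => by rw [h7 h]
           pair_eta := fun t => h5 (mem_univ t) }⟩

variable (F : FibreProduct f g e)

lemma ext {s t : F.Tot} (h1 : F.fst s = F.fst t) (h2 : F.snd s = F.snd t) : s = t := by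
  rw [← F.pair_eta s, ← F.pair_eta t, h1, h2]

/-- The inclusion of a fibre product into the product. -/
def incl (t : F.Tot) : X × Y := (F.fst t, F.snd t)

lemma incl_smooth : ContMDiff (𝓡 e) ((𝓡 a).prod (𝓡 b)) ∞ F.incl :=
  F.fst_smooth.prodMk F.snd_smooth

lemma isDiffeoOn_incl :
    IsDiffeoOn (𝓡 e) ((𝓡 a).prod (𝓡 b)) F.incl univ {z | f z.1 = g z.2} :=
  ⟨F.incl_smooth.contMDiffOn, fun t _ => F.comm t, F.pair, F.pair_smooth, fun _ _ => mem_univ _,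
    fun t _ => F.pair_eta t, fun _ hz => Prod.ext (F.fst_pair hz) (F.snd_pair hz)⟩

/-- The base change of a submersion is a submersion. -/
lemma snd_submersion (hf : Manifold.IsSubmersion (𝓡 a) (𝓡 m) ∞ f)
    (hg : ContMDiff (𝓡 b) (𝓡 m) ∞ g) : Manifold.IsSubmersion (𝓡 e) (𝓡 b) ∞ F.snd := by
  refine isSubmersion_of_localSections F.snd_smooth fun t => ?_
  obtain ⟨σ, h1, h2, h3⟩ := hf.exists_localSection (F.fst t)
  rw [F.comm t] at h1 h2 h3
  have h4 : ∀ᶠ y in 𝓝 (F.snd t), f (σ (g y)) = g y := hg.continuous.continuousAt.eventually h3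
  refine ⟨fun y => F.pair (σ (g y), y), F.pair_smooth.comp_smoothNear (f := fun y => (σ (g y), y))
    (SmoothNear.prodMk (SmoothNear.comp (J := 𝓡 m) h1 (hg.smoothNear _)) smoothNear_id) h4, ?_, ?_⟩
  · change F.pair (σ (g (F.snd t)), F.snd t) = t
    rw [h2, F.pair_eta]
  · exact h4.mono fun y hy => F.snd_pair hy

end FibreProduct

/-! ### Actions and action groupoids -/

namespace LieGroupoid

variable {k m n : ℕ}

/-- A smooth left action of a Lie groupoid on a manifold. -/
structure LeftAction (G : LieGroupoid.{u} m n) (k : ℕ) where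
  Tot : SmoothMfd.{u} k
  mom : Tot → G.Obj
  act : G.Arr → Tot → Tot
  mom_smooth : ContMDiff (𝓡 k) (𝓡 m) ∞ mom
  act_smooth : ContMDiffOn ((𝓡 n).prod (𝓡 k)) (𝓡 k) ∞
    (fun x : G.Arr × Tot => act x.1 x.2) {x | G.src x.1 = mom x.2}
  mom_act : ∀ {g x}, G.src g = mom x → mom (act g x) = G.tgt g
  unit_act : ∀ x, act (G.unit (mom x)) x = x
  mul_act : ∀ {g h x}, G.src g = G.tgt h → G.src h = mom x → act (G.mul g h) x = act g (act h x)

namespace LeftAction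

variable {G : LieGroupoid.{u} m n} (X : LeftAction G k)

lemma inv_act {g : G.Arr} {x : X.Tot} (h : G.src g = X.mom x) :
    X.act (G.inv g) (X.act g x) = x := by
  rw [← X.mul_act (G.src_inv g) h, G.inv_mul, h, X.unit_act]

lemma act_inv {g : G.Arr} {x : X.Tot} (h : G.tgt g = X.mom x) :
    X.act g (X.act (G.inv g) x) = x := by
  rw [← X.mul_act (G.tgt_inv g).symm (by rw [G.src_inv, h]), G.mul_inv, h, X.unit_act]

/-- The action groupoid of a left action. -/
abbrev groupoid {e : ℕ} (F : FibreProduct G.src X.mom e) : LieGroupoid.{u} k e :=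
  let inv : F.Tot → F.Tot := fun a => F.pair (G.inv (F.fst a), X.act (F.fst a) (F.snd a))
  have inv_comm : ∀ a : F.Tot, G.src (G.inv (F.fst a)) = X.mom (X.act (F.fst a) (F.snd a)) :=
    fun a => by rw [G.src_inv, X.mom_act (F.comm a)]
  have inv_smooth : ContMDiff (𝓡 e) (𝓡 e) ∞ inv := by
    rw [← contMDiffOn_univ]
    exact F.pair_smooth.comp (f := fun a => (G.inv (F.fst a), X.act (F.fst a) (F.snd a)))
      ((G.inv_smooth.comp F.fst_smooth).prodMk (X.act_smooth.comp_contMDiff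
        (f := fun a => (F.fst a, F.snd a)) F.incl_smooth F.comm)).contMDiffOn
      fun a _ => inv_comm a
  have inv_inv : ∀ a, inv (inv a) = a := fun a => F.ext
    (by rw [F.fst_pair (inv_comm _), F.fst_pair (inv_comm _), G.inv_inv])
    (by rw [F.snd_pair (inv_comm _), F.fst_pair (inv_comm _), F.snd_pair (inv_comm _),
      X.inv_act (F.comm a)])
  have src_inv : ∀ a, F.snd (inv a) = X.act (F.fst a) (F.snd a) := fun a => F.snd_pair (inv_comm a)
  have tgt_inv : ∀ a, X.act (F.fst (inv a)) (F.snd (inv a)) = F.snd a := fun a => by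
    rw [← src_inv, inv_inv]
  have unit_comm : ∀ x : X.Tot, G.src (G.unit (X.mom x)) = X.mom x := fun x => G.src_unit _
  have src_sub : Manifold.IsSubmersion (𝓡 e) (𝓡 k) ∞ F.snd :=
    F.snd_submersion G.src_submersion X.mom_smooth
  have comp_iff : ∀ {a b : F.Tot}, F.snd a = X.act (F.fst b) (F.snd b) →
      G.src (F.fst a) = G.tgt (F.fst b) := fun {a b} h => by
    rw [F.comm a, h, X.mom_act (F.comm b)]
  have mul_comm : ∀ {a b : F.Tot}, F.snd a = X.act (F.fst b) (F.snd b) →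
      G.src (G.mul (F.fst a) (F.fst b)) = X.mom (F.snd b) := fun {a b} h => by
    rw [G.src_mul _ _ (comp_iff h), F.comm]
  have tgt_smooth : ContMDiff (𝓡 e) (𝓡 k) ∞ (fun a : F.Tot => X.act (F.fst a) (F.snd a)) :=
    X.act_smooth.comp_contMDiff (f := fun a => (F.fst a, F.snd a)) F.incl_smooth F.comm
  { Obj := X.Tot
    Arr := F.Tot
    src := F.snd
    tgt := fun a => X.act (F.fst a) (F.snd a)
    unit := fun x => F.pair (G.unit (X.mom x), x)
    mul := fun a b => F.pair (G.mul (F.fst a) (F.fst b), F.snd b)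
    inv := inv
    src_submersion := src_sub
    tgt_submersion := by
      refine isSubmersion_of_localSections tgt_smooth fun a => ?_
      -- The target is the source composed with inversion, so inverted sections of the source are
      -- sections of the target.
      obtain ⟨σ, h1, h2, h3⟩ := src_sub.exists_localSection (inv a)
      rw [src_inv] at h1 h2 h3
      refine ⟨fun x => inv (σ x), SmoothNear.comp (J := 𝓡 e) (inv_smooth.smoothNear _) h1, ?_, ?_⟩
      · change inv (σ (X.act (F.fst a) (F.snd a))) = a
        rw [h2, inv_inv]
      · exact h3.mono fun x hx => (tgt_inv _).trans hx
    unit_smooth := by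
      rw [← contMDiffOn_univ]
      exact F.pair_smooth.comp (f := fun x : X.Tot => (G.unit (X.mom x), x))
        ((G.unit_smooth.comp X.mom_smooth).prodMk contMDiff_id).contMDiffOn fun x _ => unit_comm x
    inv_smooth := inv_smooth
    mul_smooth := by
      refine F.pair_smooth.comp
        (f := fun x : F.Tot × F.Tot => (G.mul (F.fst x.1) (F.fst x.2), F.snd x.2))
        (ContMDiffOn.prodMk (G.mul_smooth.comp (f := fun x : F.Tot × F.Tot =>
          (F.fst x.1, F.fst x.2)) ((F.fst_smooth.comp contMDiff_fst).prodMk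
            (F.fst_smooth.comp contMDiff_snd)).contMDiffOn fun x hx => comp_iff hx)
          (F.snd_smooth.comp contMDiff_snd).contMDiffOn) fun x hx => mul_comm hx
    src_unit := fun x => F.snd_pair (unit_comm x)
    tgt_unit := fun x => by rw [F.fst_pair (unit_comm x), F.snd_pair (unit_comm x), X.unit_act]
    src_mul := fun a b h => F.snd_pair (mul_comm h)
    tgt_mul := fun a b h => by
      rw [F.fst_pair (mul_comm h), F.snd_pair (mul_comm h), X.mul_act (comp_iff h) (F.comm b), ← h]
    mul_assoc := fun a b c h1 h2 => by
      have h3 : F.snd (F.pair (G.mul (F.fst a) (F.fst b), F.snd b)) = X.act (F.fst c) (F.snd c) := by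
        rw [F.snd_pair (mul_comm h1), h2]
      have h4 : F.snd a = X.act (F.fst (F.pair (G.mul (F.fst b) (F.fst c), F.snd c)))
          (F.snd (F.pair (G.mul (F.fst b) (F.fst c), F.snd c))) := by
        rw [F.fst_pair (mul_comm h2), F.snd_pair (mul_comm h2), X.mul_act (comp_iff h2) (F.comm c),
          ← h2, h1]
      rw [F.fst_pair (mul_comm h1), F.fst_pair (mul_comm h2), F.snd_pair (mul_comm h2),
        G.mul_assoc _ _ _ (comp_iff h1) (comp_iff h2)]
    unit_mul := fun a => by
      rw [F.fst_pair (unit_comm _), X.mom_act (F.comm a), G.unit_mul, F.pair_eta]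
    mul_unit := fun a => by
      rw [F.fst_pair (unit_comm _), F.snd_pair (unit_comm _), ← F.comm, G.mul_unit, F.pair_eta]
    src_inv := src_inv
    tgt_inv := tgt_inv
    inv_mul := fun a => by rw [F.fst_pair (inv_comm a), G.inv_mul, F.comm]
    mul_inv := fun a => by
      rw [F.fst_pair (inv_comm a), F.snd_pair (inv_comm a), G.mul_inv, X.mom_act (F.comm a)] }

/-- The projection from the action groupoid. -/
abbrev proj {e : ℕ} (F : FibreProduct G.src X.mom e) : Hom (X.groupoid F) G where
  obj := X.mom
  arr := F.fst
  obj_smooth := X.mom_smooth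
  arr_smooth := F.fst_smooth
  src_arr := F.comm
  tgt_arr a := (X.mom_act (F.comm a)).symm
  arr_unit x := F.fst_pair (G.src_unit _)
  arr_mul a b h := F.fst_pair (by
    rw [G.src_mul _ _ (by rw [F.comm a, ← X.mom_act (F.comm b)]; exact congrArg X.mom h), F.comm b])

end LeftAction

/-! ### The action defined by an action morphism -/

namespace Hom

variable {n' : ℕ} {G : LieGroupoid.{u} m n} {H : LieGroupoid.{u} k n'}

/-- `h ↦ (π h, s h)` is a diffeomorphism onto `G ×_M N`. -/
def IsAction (π : Hom H G) : Prop :=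
  IsDiffeoOn (𝓡 n') ((𝓡 n).prod (𝓡 k)) (fun h : H.Arr => (π.arr h, H.src h)) univ
      {x : G.Arr × H.Obj | G.src x.1 = π.obj x.2}

variable {π : Hom H G}

namespace IsAction

/-- The arrow of `H` with source `x` over the arrow `g` of `G`. -/
def lift (hπ : π.IsAction) : G.Arr × H.Obj → H.Arr := hπ.2.2.choose

variable (hπ : π.IsAction) {g : G.Arr} {x : H.Obj}

lemma lift_smooth : ContMDiffOn ((𝓡 n).prod (𝓡 k)) (𝓡 n') ∞ hπ.lift
    {x : G.Arr × H.Obj | G.src x.1 = π.obj x.2} := hπ.2.2.choose_spec.1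

lemma lift_eta (h : H.Arr) : hπ.lift (π.arr h, H.src h) = h :=
  hπ.2.2.choose_spec.2.2.1 (mem_univ h)

lemma lift_spec (h : G.src g = π.obj x) :
    (π.arr (hπ.lift (g, x)), H.src (hπ.lift (g, x))) = (g, x) :=
  hπ.2.2.choose_spec.2.2.2 h

lemma arr_lift (h : G.src g = π.obj x) : π.arr (hπ.lift (g, x)) = g :=
  congrArg Prod.fst (hπ.lift_spec h)

lemma src_lift (h : G.src g = π.obj x) : H.src (hπ.lift (g, x)) = x :=
  congrArg Prod.snd (hπ.lift_spec h)

include hπ in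
-- Injectivity of `h ↦ (π h, s h)`: equations between arrows of `H` can be checked on their images
-- in `G` and on their sources.
lemma arr_ext {h h' : H.Arr} (h1 : π.arr h = π.arr h') (h2 : H.src h = H.src h') : h = h' := by
  rw [← hπ.lift_eta h, ← hπ.lift_eta h', h1, h2]

/-- The action of `G` on the objects of `H`. -/
abbrev leftAction : LeftAction G k where
  Tot := H.Obj
  mom := π.obj
  act g x := H.tgt (hπ.lift (g, x))
  mom_smooth := π.obj_smooth
  act_smooth := H.tgt_submersion.contMDiff.comp_contMDiffOn hπ.lift_smooth
  mom_act h := by rw [← π.tgt_arr, hπ.arr_lift h]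
  unit_act x := by
    have h : hπ.lift (G.unit (π.obj x), x) = H.unit x := hπ.arr_ext
      (by rw [hπ.arr_lift (G.src_unit _), π.arr_unit])
      (by rw [hπ.src_lift (G.src_unit _), H.src_unit])
    rw [h, H.tgt_unit]
  mul_act {g h x} h1 h2 := by
    have h3 : G.src g = π.obj (H.tgt (hπ.lift (h, x))) := by
      rw [← π.tgt_arr, hπ.arr_lift h2, h1]
    have h4 := hπ.src_lift h3
    have h5 : hπ.lift (G.mul g h, x) = H.mul (hπ.lift (g, H.tgt (hπ.lift (h, x))))
        (hπ.lift (h, x)) := by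
      have h6 : G.src (G.mul g h) = π.obj x := by rw [G.src_mul _ _ h1, h2]
      refine hπ.arr_ext ?_ ?_
      · rw [π.arr_mul _ _ h4, hπ.arr_lift h6, hπ.arr_lift h3, hπ.arr_lift h2]
      · rw [H.src_mul _ _ h4, hπ.src_lift h6, hπ.src_lift h2]
    rw [h5, H.tgt_mul _ _ h4]

lemma leftAction_act (h : H.Arr) : hπ.leftAction.act (π.arr h) (H.src h) = H.tgt h :=
  congrArg H.tgt (hπ.lift_eta h)

end IsAction

end Hom

end LieGroupoid

/-! ### Balanced products -/

namespace LieGroupoid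

variable {k m n m' n' d e : ℕ}

namespace Bibundle

variable {G' : LieGroupoid.{u} m' n'} {G : LieGroupoid.{u} m n} {P : Bibundle G' G d}

/-! ### Right division in a right principal bibundle -/

namespace IsRightPrincipal

/-- The division map of a right principal bibundle: `p · divR p q = q`. -/
def divR (h : P.IsRightPrincipal) (p q : P.Tot) : G.Arr := h.isLeftTorsor_op.divL p q

variable (h : P.IsRightPrincipal) {p q r : P.Tot}

lemma src_divR (hpq : P.momL p = P.momL q) : G.src (h.divR p q) = P.momR q :=
  h.isLeftTorsor_op.src_divL hpq

lemma tgt_divR (hpq : P.momL p = P.momL q) : G.tgt (h.divR p q) = P.momR p :=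
  h.isLeftTorsor_op.tgt_divL hpq

lemma actR_divR (hpq : P.momL p = P.momL q) : P.actR p (h.divR p q) = q := by
  have h1 : P.actR q (G.inv (h.divR p q)) = p := h.isLeftTorsor_op.actL_divL hpq
  have h2 := P.actR_inv (p := q) (g := G.inv (h.divR p q))
    (by rw [G.tgt_inv, h.src_divR hpq])
  rwa [h1, G.inv_inv] at h2

lemma divR_eq {g : G.Arr} (hg : P.momR p = G.tgt g) (hpq : P.actR p g = q) : h.divR p q = g := by
  refine h.isLeftTorsor_op.divL_eq ?_ ?_
  · change G.src g = P.momR q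
    rw [← hpq, P.momR_actR _ _ hg]
  · change P.actR q (G.inv g) = p
    rw [← hpq, P.actR_inv hg]

lemma divR_smooth : ContMDiffOn ((𝓡 d).prod (𝓡 d)) (𝓡 n) ∞
    (fun x : P.Tot × P.Tot => h.divR x.1 x.2) {x | P.momL x.1 = P.momL x.2} :=
  h.isLeftTorsor_op.divL_smooth

lemma divR_self (p : P.Tot) : h.divR p p = G.unit (P.momR p) :=
  h.divR_eq (G.tgt_unit _).symm (P.actR_unit p)

/-- The cocycle identity of division. Transitivity of the balanced relation and constancy of the
local retractions on its classes both rest on it. -/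
lemma divR_mul (hpq : P.momL p = P.momL q) (hqr : P.momL q = P.momL r) :
    G.mul (h.divR p q) (h.divR q r) = h.divR p r := by
  have h1 : G.src (h.divR p q) = G.tgt (h.divR q r) := by rw [h.src_divR hpq, h.tgt_divR hqr]
  refine (h.divR_eq ?_ ?_).symm
  · rw [G.tgt_mul _ _ h1, h.tgt_divR hpq]
  · rw [P.actR_mul _ _ _ (h.tgt_divR hpq).symm h1, h.actR_divR hpq, h.actR_divR hqr]

/-- The two actions commute, so right division does not see a common left translation; hence the
left action descends to the balanced product. -/
lemma divR_actL {g : G'.Arr} (hpq : P.momL p = P.momL q) (hg : G'.src g = P.momL p) :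
    h.divR (P.actL g p) (P.actL g q) = h.divR p q := by
  refine h.divR_eq ?_ ?_
  · rw [P.momR_actL _ _ hg, h.tgt_divR hpq]
  · rw [P.act_comm _ _ _ hg (h.tgt_divR hpq).symm, h.actR_divR hpq]

end IsRightPrincipal

/-- Two points of `P ×_M X` are equivalent if they differ by the diagonal action. -/
def balanced (h : P.IsRightPrincipal) (X : LeftAction G k) (F : FibreProduct P.momR X.mom e) :
    Setoid F.Tot where
  r q q' := P.momL (F.fst q) = P.momL (F.fst q') ∧
    X.act (h.divR (F.fst q) (F.fst q')) (F.snd q') = F.snd q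
  iseqv :=
    { refl := fun q => ⟨rfl, by rw [h.divR_self, F.comm, X.unit_act]⟩
      symm := fun {q q'} ⟨h1, h2⟩ => by
        refine ⟨h1.symm, ?_⟩
        have h3 := h.src_divR h1
        have h4 := h.tgt_divR h1
        rw [← h2, ← X.mul_act (by rw [h.src_divR h1.symm, h4]) (by rw [h3, F.comm]),
          h.divR_mul h1.symm h1, h.divR_self, F.comm, X.unit_act]
      trans := fun {q q' q''} ⟨h1, h2⟩ ⟨h3, h4⟩ => by
        refine ⟨h1.trans h3, ?_⟩
        rw [← h.divR_mul h1 h3, X.mul_act (by rw [h.src_divR h1, h.tgt_divR h3])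
          (by rw [h.src_divR h3, F.comm]), h4, h2] }

/-! ### The topology of the balanced quotient -/

variable {h : P.IsRightPrincipal} {X : LeftAction G k} {F : FibreProduct P.momR X.mom e}

/-- Freeness makes the connecting arrow unique, equal to the value of the division map. The form
with division serves for continuity and smoothness, the existential one for exhibiting related
points. -/
lemma balanced_iff {q q' : F.Tot} : balanced h X F q q' ↔
    ∃ g, P.momR (F.fst q) = G.tgt g ∧ P.actR (F.fst q) g = F.fst q' ∧
      X.act g (F.snd q') = F.snd q := by
  constructor
  · rintro ⟨h1, h2⟩
    exact ⟨_, (h.tgt_divR h1).symm, h.actR_divR h1, h2⟩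
  · rintro ⟨g, h1, h2, h3⟩
    have h4 : P.momL (F.fst q) = P.momL (F.fst q') := by rw [← h2, P.momL_actR _ _ h1]
    exact ⟨h4, by rw [h.divR_eq h1 h2, h3]⟩

/-- Over the closed set of pairs with equal image in `M'`, the relation is an equality between
continuous functions, because division is continuous. -/
lemma isClosed_balanced : IsClosed {x : F.Tot × F.Tot | balanced h X F x.1 x.2} := by
  have hC : IsClosed {x : F.Tot × F.Tot | P.momL (F.fst x.1) = P.momL (F.fst x.2)} :=
    isClosed_eq (P.momL_smooth.continuous.comp (F.fst_smooth.continuous.comp continuous_fst))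
      (P.momL_smooth.continuous.comp (F.fst_smooth.continuous.comp continuous_snd))
  have hf : ContinuousOn (fun x : F.Tot × F.Tot =>
      (X.act (h.divR (F.fst x.1) (F.fst x.2)) (F.snd x.2), F.snd x.1))
      {x : F.Tot × F.Tot | P.momL (F.fst x.1) = P.momL (F.fst x.2)} := by
    have h1 : ContinuousOn (fun x : F.Tot × F.Tot => h.divR (F.fst x.1) (F.fst x.2))
        {x : F.Tot × F.Tot | P.momL (F.fst x.1) = P.momL (F.fst x.2)} :=
      h.divR_smooth.continuousOn.comp (f := fun x : F.Tot × F.Tot => (F.fst x.1, F.fst x.2))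
        ((F.fst_smooth.continuous.comp continuous_fst).prodMk
          (F.fst_smooth.continuous.comp continuous_snd)).continuousOn fun x hx => hx
    refine ContinuousOn.prodMk (X.act_smooth.continuousOn.comp (f := fun x : F.Tot × F.Tot =>
      (h.divR (F.fst x.1) (F.fst x.2), F.snd x.2)) (h1.prodMk
        (F.snd_smooth.continuous.comp continuous_snd).continuousOn) fun x hx => ?_)
      (F.snd_smooth.continuous.comp continuous_fst).continuousOn
    exact (h.src_divR hx).trans (F.comm x.2)
  exact hf.preimage_isClosed_of_isClosed hC isClosed_diagonal

/-- If an arrow `g` relates `q` to a point of `O`, a local section of the target map through `g`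
moves all points near `q` into `O` within their classes, so the saturation of `O` is open. -/
lemma isOpenMap_balanced_mk : IsOpenMap (Quotient.mk (balanced h X F)) := by
  intro O hO
  change IsOpen (Quotient.mk (balanced h X F) ⁻¹' (Quotient.mk (balanced h X F) '' O))
  refine isOpen_iff_mem_nhds.2 ?_
  rintro q ⟨q₀, hq₀, hqq⟩
  obtain ⟨g, h1, h2, h3⟩ := balanced_iff.1 (Quotient.exact hqq.symm : balanced h X F q q₀)
  obtain ⟨τ, hτ, hτx, hτt⟩ := G.tgt_submersion.exists_localSection g
  rw [← h1] at hτ hτx hτt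
  have hm : Continuous fun q : F.Tot => P.momR (F.fst q) :=
    P.momR_smooth.continuous.comp F.fst_smooth.continuous
  have hT : ∀ᶠ q' in 𝓝 q, G.tgt (τ (P.momR (F.fst q'))) = P.momR (F.fst q') :=
    hm.continuousAt.eventually hτt
  have hτ' : SmoothNear (𝓡 e) (𝓡 n) (fun q' : F.Tot => τ (P.momR (F.fst q'))) q :=
    SmoothNear.comp (J := 𝓡 m) (f := fun q' : F.Tot => P.momR (F.fst q')) hτ
      ((P.momR_smooth.comp F.fst_smooth).smoothNear _)
  have h4 : ∀ {q' : F.Tot} {g}, G.tgt g = P.momR (F.fst q') →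
      G.src (G.inv g) = X.mom (F.snd q') := fun hg => by rw [G.src_inv, hg, F.comm]
  have h5 : ∀ {q' : F.Tot} {g}, G.tgt g = P.momR (F.fst q') →
      P.momR (P.actR (F.fst q') g) = X.mom (X.act (G.inv g) (F.snd q')) := fun hg => by
    rw [P.momR_actR _ _ hg.symm, X.mom_act (h4 hg), G.tgt_inv]
  have hs : SmoothNear (𝓡 e) (𝓡 e) (fun q' => F.pair (P.actR (F.fst q') (τ (P.momR (F.fst q'))),
      X.act (G.inv (τ (P.momR (F.fst q')))) (F.snd q'))) q := by
    refine F.pair_smooth.comp_smoothNear (f := fun q' => (P.actR (F.fst q') (τ (P.momR (F.fst q'))),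
      X.act (G.inv (τ (P.momR (F.fst q')))) (F.snd q'))) (SmoothNear.prodMk
      (P.actR_smooth.comp_smoothNear (f := fun q' => (F.fst q', τ (P.momR (F.fst q'))))
        ((F.fst_smooth.smoothNear _).prodMk hτ') (hT.mono fun _ h => h.symm))
      (X.act_smooth.comp_smoothNear (f := fun q' => (G.inv (τ (P.momR (F.fst q'))), F.snd q'))
        ((SmoothNear.comp (J := 𝓡 n) (G.inv_smooth.smoothNear _) hτ').prodMk
          (F.snd_smooth.smoothNear _)) (hT.mono fun _ h => h4 h))) (hT.mono fun _ h => h5 h)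
  have hsq : F.pair (P.actR (F.fst q) (τ (P.momR (F.fst q))),
      X.act (G.inv (τ (P.momR (F.fst q)))) (F.snd q)) = q₀ := by
    have h6 : G.src g = X.mom (F.snd q₀) := by rw [← P.momR_actR _ _ h1, h2, F.comm]
    rw [hτx, h2, ← h3, X.inv_act h6, F.pair_eta]
  filter_upwards [hs.eventually_mem hsq (hO.mem_nhds hq₀), hT] with q' hq' ht
  refine ⟨_, hq', Quotient.sound ((balanced h X F).symm' (balanced_iff.2 ⟨_, ht.symm, ?_, ?_⟩))⟩
  · rw [F.fst_pair (h5 ht)]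
  · rw [F.snd_pair (h5 ht), X.act_inv (by rw [ht, F.comm])]

/-- The image of an open quotient map is Hausdorff exactly when the relation is closed. -/
lemma t2Space_balanced : T2Space (Quotient (balanced h X F)) := by
  have h1 : IsOpenQuotientMap (Quotient.mk (balanced h X F)) :=
    ⟨Quotient.mk_surjective, continuous_quotient_mk', isOpenMap_balanced_mk⟩
  rw [t2Space_iff_of_isOpenQuotientMap h1]
  convert isClosed_balanced (h := h) (X := X) (F := F) using 3
  exact Quotient.eq

/-- The balanced product `P ×_G X`, a manifold of dimension `k'`, as a quotient of `P ×_M X`. -/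
structure BalancedProduct (h : P.IsRightPrincipal) (X : LeftAction G k)
    (F : FibreProduct P.momR X.mom e) (k' : ℕ) where
  Tot : SmoothMfd.{u} k'
  cl : F.Tot → Tot
  cl_smooth : ContMDiff (𝓡 e) (𝓡 k') ∞ cl
  cl_surjective : Function.Surjective cl
  cl_eq_iff : ∀ {q q'}, cl q = cl q' ↔ balanced h X F q q'
  localSection : ∀ q, ∃ σ : Tot → F.Tot, SmoothNear (𝓡 k') (𝓡 e) σ (cl q) ∧ σ (cl q) = q ∧
    ∀ᶠ t in 𝓝 (cl q), cl (σ t) = t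

/-- The balanced product exists if the moment map of `X` is a diffeomorphism near the points of a
dense set. -/
theorem BalancedProduct.nonempty (hL : Manifold.IsSubmersion (𝓡 d) (𝓡 m) ∞ P.momR)
    (hX : Dense {x : X.Tot | ∃ ν : G.Obj → X.Tot, SmoothNear (𝓡 m) (𝓡 k) ν (X.mom x) ∧
      ∀ᶠ w in 𝓝 (X.mom x), X.mom (ν w) = w ∧ ∀ x', X.mom x' = w → x' = ν w}) :
    Nonempty (BalancedProduct h X F m') := by
  have := t2Space_balanced (h := h) (X := X) (F := F)
  have hc : ContMDiff (𝓡 e) (𝓡 m') ∞ (fun q : F.Tot => P.momL (F.fst q)) :=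
    P.momL_smooth.comp F.fst_smooth
  obtain ⟨T, q, h1, h2, h3, h4⟩ := exists_quotient F.Tot (balanced h X F) isOpenMap_balanced_mk
    -- Over the domain `V` of a section `σ` of `P → M'`, each class has exactly one representative
    -- whose first component is a value of `σ`. The map `ρ` sends a point to this representative; it
    -- fixes `y₀` because `σ` passes through the first component of `y₀`.
    (fun y₀ => by
      obtain ⟨σ, hσ, hσx, hσs⟩ := h.submersion.exists_localSection (F.fst y₀)
      obtain ⟨V, hV, hVo, hyV⟩ := eventually_nhds_iff.1 (hσ.and hσs)
      have h1 : ∀ {y : F.Tot}, P.momL (F.fst y) ∈ V →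
          P.momL (σ (P.momL (F.fst y))) = P.momL (F.fst y) := fun hy => (hV _ hy).2
      have h2 : ∀ {y : F.Tot}, P.momL (F.fst y) ∈ V →
          G.src (h.divR (σ (P.momL (F.fst y))) (F.fst y)) = X.mom (F.snd y) := fun hy => by
        rw [h.src_divR (h1 hy), F.comm]
      have h3 : ∀ {y : F.Tot}, P.momL (F.fst y) ∈ V → P.momR (σ (P.momL (F.fst y))) =
          X.mom (X.act (h.divR (σ (P.momL (F.fst y))) (F.fst y)) (F.snd y)) := fun hy => by
        rw [X.mom_act (h2 hy), h.tgt_divR (h1 hy)]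
      have hσ' : ContMDiffOn (𝓡 m') (𝓡 d) ∞ σ V := fun v hv =>
        (hV v hv).1.contMDiffWithinAt
      have hσ'' : ContMDiffOn (𝓡 e) (𝓡 d) ∞ (fun y : F.Tot => σ (P.momL (F.fst y)))
          {y | P.momL (F.fst y) ∈ V} := hσ'.comp hc.contMDiffOn fun y hy => hy
      refine ⟨{y | P.momL (F.fst y) ∈ V},
        fun y => F.pair (σ (P.momL (F.fst y)),
          X.act (h.divR (σ (P.momL (F.fst y))) (F.fst y)) (F.snd y)),
        hVo.preimage hc.continuous, hyV, fun y y' hyy hy => ?_, ?_, fun y hy => ?_,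
        fun y hy y' hyy => ?_, ?_⟩
      · change P.momL (F.fst y') ∈ V
        rwa [← hyy.1]
      · refine F.pair_smooth.comp (f := fun y => (σ (P.momL (F.fst y)),
          X.act (h.divR (σ (P.momL (F.fst y))) (F.fst y)) (F.snd y))) (hσ''.prodMk
          (X.act_smooth.comp (f := fun y => (h.divR (σ (P.momL (F.fst y))) (F.fst y), F.snd y))
            (ContMDiffOn.prodMk (h.divR_smooth.comp (f := fun y => (σ (P.momL (F.fst y)), F.fst y))
              (hσ''.prodMk F.fst_smooth.contMDiffOn) fun y hy => h1 hy) F.snd_smooth.contMDiffOn)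
            fun y hy => h2 hy)) fun y hy => h3 hy
      · refine ⟨?_, ?_⟩
        · rw [F.fst_pair (h3 hy), h1 hy]
        · rw [F.fst_pair (h3 hy), F.snd_pair (h3 hy)]
      · have h4 : P.momL (F.fst y) ∈ V := hy
        have h5 : h.divR (σ (P.momL (F.fst y))) (F.fst y') =
            G.mul (h.divR (σ (P.momL (F.fst y))) (F.fst y)) (h.divR (F.fst y) (F.fst y')) :=
          (h.divR_mul (h1 hy) hyy.1).symm
        change F.pair _ = F.pair _
        rw [← hyy.1, h5, X.mul_act (by rw [h.src_divR (h1 hy), h.tgt_divR hyy.1])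
          (by rw [h.src_divR hyy.1, F.comm]), hyy.2]
      · change F.pair _ = _
        rw [hσx, h.divR_self, F.comm, X.unit_act, F.pair_eta])
    G'.Obj hc (fun y y' hy => hy.1)
    (D := F.snd ⁻¹' {x : X.Tot | ∃ ν : G.Obj → X.Tot, SmoothNear (𝓡 m) (𝓡 k) ν (X.mom x) ∧
      ∀ᶠ w in 𝓝 (X.mom x), X.mom (ν w) = w ∧ ∀ x', X.mom x' = w → x' = ν w})
    (hX.preimage (F.snd_submersion hL X.mom_smooth).isOpenMap)
    (by
      rintro y ⟨ν, hν, hνs⟩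
      obtain ⟨σ, hσ, hσx, hσs⟩ := h.submersion.exists_localSection (F.fst y)
      rw [← F.comm] at hν hνs
      have hσm : SmoothNear (𝓡 m') (𝓡 m) (fun v => P.momR (σ v)) (P.momL (F.fst y)) :=
        SmoothNear.comp (J := 𝓡 d) (P.momR_smooth.smoothNear _) hσ
      have hσmx : P.momR (σ (P.momL (F.fst y))) = P.momR (F.fst y) := by rw [hσx]
      have hν' := (hσm.tendsto hσmx).eventually hνs
      -- Where the moment map of `X` has the local inverse `ν`, a class is determined by its image
      -- `v` in `M'`, and this is a representative of it.
      refine ⟨fun v => F.pair (σ v, ν (P.momR (σ v))), ?_, ?_⟩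
      · refine F.pair_smooth.comp_smoothNear (f := fun v => (σ v, ν (P.momR (σ v))))
          (hσ.prodMk (SmoothNear.comp (J := 𝓡 m) (f := fun v => P.momR (σ v)) ?_ hσm))
          (hν'.mono fun v hv => hv.1.symm)
        simp only [hσx]; exact hν
      · filter_upwards [hσs, hν'] with v h1 ⟨h2, h3⟩
        refine ⟨?_, fun y' hy' => (balanced h X F).symm' ⟨?_, ?_⟩⟩
        · rw [F.fst_pair h2.symm, h1]
        · rw [F.fst_pair h2.symm, h1, hy']
        · rw [F.fst_pair h2.symm, F.snd_pair h2.symm]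
          have h4 : P.momL (σ v) = P.momL (F.fst y') := h1.trans hy'.symm
          refine h3 _ ?_
          rw [X.mom_act (by rw [h.src_divR h4, F.comm]), h.tgt_divR h4])
  exact ⟨{ Tot := T
           cl := q
           cl_smooth := h1
           cl_surjective := h2
           cl_eq_iff := h3 _ _
           localSection := h4 }⟩

namespace BalancedProduct

variable {k' : ℕ} (B : BalancedProduct h X F k')

lemma cl_submersion : Manifold.IsSubmersion (𝓡 e) (𝓡 k') ∞ B.cl :=
  isSubmersion_of_localSections B.cl_smooth B.localSection

/-- A representative of a class. -/
def rep (y : B.Tot) : F.Tot := Function.surjInv B.cl_surjective y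

lemma cl_rep (y : B.Tot) : B.cl (B.rep y) = y := Function.surjInv_eq B.cl_surjective y

lemma balanced_rep (q : F.Tot) : balanced h X F (B.rep (B.cl q)) q :=
  B.cl_eq_iff.1 (B.cl_rep _)

/-- The moment map of the balanced product. -/
def mom (y : B.Tot) : G'.Obj := P.momL (F.fst (B.rep y))

lemma mom_cl (q : F.Tot) : B.mom (B.cl q) = P.momL (F.fst q) := (B.balanced_rep q).1

/-- The left action on a representative. -/
def actPair (_ : BalancedProduct h X F k') (g : G'.Arr) (q : F.Tot) : F.Tot :=
  F.pair (P.actL g (F.fst q), F.snd q)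

lemma actPair_comm {g : G'.Arr} {q : F.Tot} (hg : G'.src g = P.momL (F.fst q)) :
    P.momR (P.actL g (F.fst q)) = X.mom (F.snd q) := by rw [P.momR_actL _ _ hg, F.comm]

lemma fst_actPair {g : G'.Arr} {q : F.Tot} (hg : G'.src g = P.momL (F.fst q)) :
    F.fst (B.actPair g q) = P.actL g (F.fst q) := F.fst_pair (actPair_comm hg)

lemma snd_actPair {g : G'.Arr} {q : F.Tot} (hg : G'.src g = P.momL (F.fst q)) :
    F.snd (B.actPair g q) = F.snd q := F.snd_pair (actPair_comm hg)

lemma actPair_smooth : ContMDiffOn ((𝓡 n').prod (𝓡 e)) (𝓡 e) ∞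
    (fun x : G'.Arr × F.Tot => B.actPair x.1 x.2) {x | G'.src x.1 = P.momL (F.fst x.2)} := by
  refine F.pair_smooth.comp (f := fun x : G'.Arr × F.Tot => (P.actL x.1 (F.fst x.2), F.snd x.2))
    (ContMDiffOn.prodMk (P.actL_smooth.comp (f := fun x : G'.Arr × F.Tot => (x.1, F.fst x.2))
      (contMDiff_fst.prodMk (F.fst_smooth.comp contMDiff_snd)).contMDiffOn fun x hx => hx)
      (F.snd_smooth.comp contMDiff_snd).contMDiffOn) fun x hx => actPair_comm hx

lemma balanced_actPair {g : G'.Arr} {q q' : F.Tot} (hg : G'.src g = P.momL (F.fst q))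
    (hq : balanced h X F q q') : balanced h X F (B.actPair g q) (B.actPair g q') := by
  have hg' : G'.src g = P.momL (F.fst q') := hg.trans hq.1
  refine ⟨?_, ?_⟩
  · rw [B.fst_actPair hg, B.fst_actPair hg', P.momL_actL _ _ hg, P.momL_actL _ _ hg']
  · rw [B.fst_actPair hg, B.fst_actPair hg', B.snd_actPair hg, B.snd_actPair hg',
      h.divR_actL hq.1 hg, hq.2]

/-- The action on classes. -/
def act (g : G'.Arr) (y : B.Tot) : B.Tot := B.cl (B.actPair g (B.rep y))

/-- Independence of the representative lets `act`, defined by an arbitrary choice, be computed with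
smooth local sections. -/
lemma act_cl {g : G'.Arr} {q : F.Tot} (hg : G'.src g = P.momL (F.fst q)) :
    B.act g (B.cl q) = B.cl (B.actPair g q) :=
  B.cl_eq_iff.2 (B.balanced_actPair (hg.trans (B.balanced_rep q).1.symm) (B.balanced_rep q))

/-- The left action on a balanced product. -/
abbrev leftAction : LeftAction G' k' where
  Tot := B.Tot
  mom := B.mom
  act := B.act
  mom_smooth := contMDiff_of_smoothNear fun y => by
    obtain ⟨q, rfl⟩ := B.cl_surjective y
    obtain ⟨σ, h1, h2, h3⟩ := B.localSection q
    refine SmoothNear.congr (SmoothNear.comp (J := 𝓡 e) (g := fun q => P.momL (F.fst q))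
      ((P.momL_smooth.comp F.fst_smooth).smoothNear _) h1) ?_
    filter_upwards [h3] with y hy
    rw [← B.mom_cl, hy]
  act_smooth := by
    refine contMDiffOn_of_locally_contMDiffOn ?_
    rintro ⟨g, y⟩ -
    obtain ⟨q, rfl⟩ := B.cl_surjective y
    obtain ⟨σ, h1, h2, h3⟩ := B.localSection q
    obtain ⟨V, hV, hVo, hyV⟩ := eventually_nhds_iff.1 (h1.and h3)
    have hσ : ContMDiffOn (𝓡 k') (𝓡 e) ∞ σ V := fun v hv =>
        (hV v hv).1.contMDiffWithinAt
    have h4 : ∀ x : G'.Arr × B.Tot, G'.src x.1 = B.mom x.2 → x.2 ∈ V →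
        G'.src x.1 = P.momL (F.fst (σ x.2)) := fun x hx hxV => by
      rw [hx, ← B.mom_cl, (hV _ hxV).2]
    refine ⟨univ ×ˢ V, isOpen_univ.prod hVo, ⟨mem_univ _, hyV⟩, ?_⟩
    refine ContMDiffOn.congr (f := fun x : G'.Arr × B.Tot => B.cl (B.actPair x.1 (σ x.2)))
      (B.cl_smooth.comp_contMDiffOn (B.actPair_smooth.comp
        (f := fun x : G'.Arr × B.Tot => (x.1, σ x.2)) (contMDiffOn_fst.prodMk
          (hσ.comp contMDiffOn_snd fun x hx => hx.2.2)) fun x hx => h4 x hx.1 hx.2.2)) ?_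
    rintro x ⟨hx, -, hxV⟩
    rw [← B.act_cl (h4 x hx hxV), (hV _ hxV).2]
  mom_act {g y} hg := by
    obtain ⟨q, rfl⟩ := B.cl_surjective y
    rw [B.mom_cl] at hg
    rw [B.act_cl hg, B.mom_cl, B.fst_actPair hg, P.momL_actL _ _ hg]
  unit_act y := by
    obtain ⟨q, rfl⟩ := B.cl_surjective y
    rw [B.act_cl (by rw [G'.src_unit, B.mom_cl])]
    congr 1
    rw [actPair, B.mom_cl, P.unit_actL, F.pair_eta]
  mul_act {g g' y} h1 h2 := by
    obtain ⟨q, rfl⟩ := B.cl_surjective y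
    rw [B.mom_cl] at h2
    have h3 : G'.src (G'.mul g g') = P.momL (F.fst q) := by rw [G'.src_mul _ _ h1, h2]
    have h4 : G'.src g = P.momL (F.fst (B.actPair g' q)) := by
      rw [B.fst_actPair h2, P.momL_actL _ _ h2, h1]
    rw [B.act_cl h2, B.act_cl h3, B.act_cl h4]
    congr 1
    rw [actPair, actPair, B.fst_actPair h2, B.snd_actPair h2, P.mul_actL _ _ _ h1 h2]

end BalancedProduct

end Bibundle

end LieGroupoid

/-! ### Properness from continuous division -/

/-- The data present `f` as a homeomorphism onto a closed subset followed by its inclusion, and both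
are proper. -/
lemma isProperMap_of_continuous_inverse {A B : Type*} [TopologicalSpace A] [TopologicalSpace B]
    {f : A → B} (hf : Continuous f) {C : Set B} (hC : IsClosed C) (hfC : ∀ a, f a ∈ C) {g : C → A}
    (hg : Continuous g) (hgf : ∀ a, g ⟨f a, hfC a⟩ = a) (hfg : ∀ c, f (g c) = c) :
    IsProperMap f := by
  let e : A ≃ₜ C :=
    { toFun := fun a => ⟨f a, hfC a⟩
      invFun := g
      left_inv := hgf
      right_inv := fun c => Subtype.ext (hfg c)
      continuous_toFun := hf.subtype_mk hfC
      continuous_invFun := hg }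
  exact hC.isProperMap_subtypeVal.comp e.isProperMap

namespace LieGroupoid

variable {k m n m' n' d e : ℕ}

namespace Bibundle

variable {G' : LieGroupoid.{u} m' n'} {G : LieGroupoid.{u} m n} {P : Bibundle G' G d}

lemma isClosed_pairs (P : Bibundle G' G d) : IsClosed P.pairs :=
  isClosed_eq (P.momR_smooth.continuous.comp continuous_fst)
    (P.momR_smooth.continuous.comp continuous_snd)

/-- A torsor is principal: its division map is continuous, hence its action is proper. -/
theorem IsLeftTorsor.isLeftPrincipal (h : P.IsLeftTorsor) (hs : Function.Surjective P.momR) :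
    P.IsLeftPrincipal where
  surjective := hs
  submersion := h.submersion
  free := h.free
  orbit := h.orbit
  proper := by
    refine isProperMap_of_continuous_inverse (C := P.pairs)
      (g := fun c => ⟨(h.divL c.1.1 c.1.2, c.1.2), h.src_divL c.2⟩) ?_ P.isClosed_pairs
      (fun x => P.momR_actL _ _ x.2) ?_ (fun x => ?_) fun c => ?_
    · refine Continuous.prodMk ?_ (continuous_snd.comp continuous_subtype_val)
      exact P.actL_smooth.continuousOn.domRestrict
    · refine Continuous.subtype_mk (Continuous.prodMk ?_
        (continuous_snd.comp continuous_subtype_val)) _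
      exact h.divL_smooth.continuousOn.domRestrict
    · exact Subtype.ext (Prod.ext (h.divL_eq x.2 rfl) rfl)
    · exact Prod.ext (h.actL_divL c.2) rfl

/-- The mirror image of the previous theorem; arrows are inverted when passing between the two
sides. -/
theorem IsLeftTorsor.isRightPrincipal_of_op (h : P.op.IsLeftTorsor)
    (hs : Function.Surjective P.momL) : P.IsRightPrincipal where
  surjective := hs
  submersion := h.submersion
  free p g hg hp := by
    have h1 := h.free (G.inv g) p ((G.src_inv g).trans hg.symm) (by
      change P.actR p (G.inv (G.inv g)) = p
      rw [G.inv_inv, hp])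
    rw [← G.inv_inv g, h1, G.inv_unit]
  orbit p q hpq := by
    obtain ⟨g, h1, h2⟩ := h.orbit p q hpq
    exact ⟨G.inv g, by rw [G.tgt_inv]; exact h1.symm, h2⟩
  proper := by
    have h1 : ∀ {p q : P.Tot}, P.momL p = P.momL q → P.momR p = G.tgt (h.divL p q) :=
      fun hpq => (h.tgt_divL hpq).symm
    have h2 : ∀ {p q : P.Tot}, P.momL p = P.momL q → P.actR p (h.divL p q) = q := fun {p q} hpq => by
      have h3 : P.actR q (G.inv (h.divL p q)) = p := h.actL_divL hpq
      have h4 := P.actR_inv (p := q) (g := G.inv (h.divL p q))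
        (by rw [G.tgt_inv]; exact (h.src_divL hpq).symm)
      rwa [h3, G.inv_inv] at h4
    refine isProperMap_of_continuous_inverse (C := P.op.pairs)
      (g := fun c => ⟨(c.1.1, h.divL c.1.1 c.1.2), h1 c.2⟩) ?_ P.op.isClosed_pairs
      (fun x => (P.momL_actR _ _ x.2).symm) ?_ (fun x => ?_) fun c => ?_
    · refine Continuous.prodMk (continuous_fst.comp continuous_subtype_val) ?_
      exact P.actR_smooth.continuousOn.domRestrict
    · refine Continuous.subtype_mk (Continuous.prodMk
        (continuous_fst.comp continuous_subtype_val) ?_) _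
      exact h.divL_smooth.continuousOn.domRestrict
    · refine Subtype.ext (Prod.ext rfl (h.divL_eq ?_ ?_))
      · exact (P.momR_actR _ _ x.2).symm
      · exact P.actR_inv x.2
    · exact Prod.ext rfl (h2 c.2)

/-- The groupoid on the left of a Morita equivalence is the quotient of the fibre square. -/
theorem IsMoritaEquivalence.isPairQuotient (hP : P.IsMoritaEquivalence) :
    P.IsPairQuotient (fun x => hP.2.isLeftTorsor.divL x.1 x.2) := by
  set h := hP.2.isLeftTorsor
  exact
  { smooth := h.divL_smooth
    surjective := fun g => by
      obtain ⟨p, hp⟩ := hP.1.surjective (G'.src g)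
      exact ⟨(P.actL g p, p), P.momR_actL _ _ hp.symm, h.divL_eq hp.symm rfl⟩
    localSection := by
      rintro ⟨q₂, q₁⟩ hq
      obtain ⟨σ, h1, h2, h3⟩ := hP.1.submersion.exists_localSection q₁
      obtain ⟨V, hV, hVo, hqV⟩ := eventually_nhds_iff.1 (h1.and h3)
      have hs : G'.src (h.divL q₂ q₁) = P.momL q₁ := h.src_divL hq
      have hσ : ContMDiffOn (𝓡 m') (𝓡 d) ∞ σ V := fun v hv => (hV v hv).1.contMDiffWithinAt
      have hσ' : ContMDiffOn (𝓡 n') (𝓡 d) ∞ (fun g => σ (G'.src g)) (G'.src ⁻¹' V) :=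
        hσ.comp G'.src_submersion.contMDiff.contMDiffOn fun g hg => hg
      refine ⟨G'.src ⁻¹' V, fun g => (P.actL g (σ (G'.src g)), σ (G'.src g)),
        hVo.preimage G'.src_submersion.contMDiff.continuous, ?_, ?_, ?_, fun g hg => ⟨?_, ?_⟩⟩
      · change G'.src (h.divL q₂ q₁) ∈ V
        rwa [hs]
      · exact ContMDiffOn.prodMk (P.actL_smooth.comp (f := fun g => (g, σ (G'.src g)))
          (contMDiffOn_id.prodMk hσ') fun g hg => (hV _ hg).2.symm) hσ'
      · simp only [hs, h2, h.actL_divL hq]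
      · exact P.momR_actL _ _ (hV _ hg).2.symm
      · exact h.divL_eq (hV _ hg).2.symm rfl
    fibre := by
      rintro ⟨x₂, x₁⟩ hx ⟨y₂, y₁⟩ hy
      constructor
      · intro hxy
        have h1 : P.momL x₁ = P.momL y₁ := by
          rw [← h.src_divL hx, ← h.src_divL hy]; exact congrArg G'.src hxy
        obtain ⟨g, h2, h3⟩ := hP.1.orbit x₁ y₁ h1
        have h4 : P.momR x₂ = G.tgt g := Eq.trans hx h2
        refine ⟨g, h4, Prod.ext ?_ h3.symm⟩
        change y₂ = P.actR x₂ g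
        have h5 : P.actL (h.divL x₂ x₁) x₁ = x₂ := h.actL_divL hx
        have h6 : P.actL (h.divL y₂ y₁) y₁ = y₂ := h.actL_divL hy
        rw [← h6, ← h5, P.act_comm _ _ _ (h.src_divL hx) h2, h3]
        exact congrArg (fun a => P.actL a y₁) hxy.symm
      · rintro ⟨g, h1, h2⟩
        obtain ⟨rfl, rfl⟩ := Prod.mk.inj h2
        have h3 : P.momR x₁ = G.tgt g := Eq.trans (Eq.symm hx) h1
        refine (h.divL_eq ?_ ?_).symm
        · rw [P.momL_actR _ _ h3]; exact h.src_divL hx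
        · change P.actL (h.divL x₂ x₁) (P.actR x₁ g) = P.actR x₂ g
          rw [← P.act_comm _ _ _ (h.src_divL hx) h3, h.actL_divL hx]
    src_eq := fun x hx => h.src_divL hx
    tgt_eq := fun x hx => h.tgt_divL hx
    mul_eq := fun p₃ p₂ p₁ h32 h21 => by
      have h1 : G'.src (h.divL p₃ p₂) = G'.tgt (h.divL p₂ p₁) := by
        rw [h.src_divL h32, h.tgt_divL h21]
      refine (h.divL_eq ?_ ?_).symm
      · rw [G'.src_mul _ _ h1, h.src_divL h21]
      · rw [P.mul_actL _ _ _ h1 (h.src_divL h21), h.actL_divL h21, h.actL_divL h32]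
    act_eq := fun x hx => h.actL_divL hx }

/-! ### The pulled back bibundle -/

namespace BalancedProduct

variable {k' l l' : ℕ} {H : LieGroupoid.{u} k l} {π : Hom H G} {hπ : π.IsAction}
  {h : P.IsRightPrincipal} {F : FibreProduct P.momR hπ.leftAction.mom e}
  (B : BalancedProduct h hπ.leftAction F k') (F' : FibreProduct G'.src B.leftAction.mom l')

/-- The groupoid `G' ⋉ (P ×_G N)`. -/
abbrev groupoid : LieGroupoid.{u} k' l' := B.leftAction.groupoid F'

/-- The projection `G' ⋉ (P ×_G N) → G'`. -/
abbrev proj : Hom (B.groupoid F') G' := B.leftAction.proj F'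

variable {F'} in
lemma src_fst {a : F'.Tot} {q : F.Tot} (ha : F'.snd a = B.cl q) :
    G'.src (F'.fst a) = P.momL (F.fst q) := by
  rw [F'.comm, ha]; exact B.mom_cl q

omit B in
lemma momR_fst {q : F.Tot} {a : H.Arr} (ha : F.snd q = H.tgt a) :
    P.momR (F.fst q) = G.tgt (π.arr a) := by
  rw [F.comm, ha, π.tgt_arr]

omit B in
lemma actR_comm {q : F.Tot} {a : H.Arr} (ha : F.snd q = H.tgt a) :
    P.momR (P.actR (F.fst q) (π.arr a)) = hπ.leftAction.mom (H.src a) := by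
  rw [P.momR_actR _ _ (momR_fst ha), π.src_arr]

/-- The fibre product `P ×_M N` as a bibundle. -/
abbrev bibundle : Bibundle (B.groupoid F') H e where
  Tot := F.Tot
  momL := B.cl
  momR := F.snd
  actL a q := B.actPair (F'.fst a) q
  actR q a := F.pair (P.actR (F.fst q) (π.arr a), H.src a)
  momL_smooth := B.cl_smooth
  momR_smooth := F.snd_smooth
  actL_smooth := B.actPair_smooth.comp (f := fun x : F'.Tot × F.Tot => (F'.fst x.1, x.2))
    ((F'.fst_smooth.comp contMDiff_fst).prodMk contMDiff_snd).contMDiffOn fun x hx => B.src_fst hx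
  actR_smooth := F.pair_smooth.comp
    (f := fun x : F.Tot × H.Arr => (P.actR (F.fst x.1) (π.arr x.2), H.src x.2))
    (ContMDiffOn.prodMk (P.actR_smooth.comp
      (f := fun x : F.Tot × H.Arr => (F.fst x.1, π.arr x.2))
      ((F.fst_smooth.comp contMDiff_fst).prodMk (π.arr_smooth.comp contMDiff_snd)).contMDiffOn
      fun x hx => momR_fst hx) (H.src_submersion.contMDiff.comp contMDiff_snd).contMDiffOn)
    fun x hx => actR_comm hx
  momL_actL a q ha := by
    change B.cl (B.actPair (F'.fst a) q) = B.act (F'.fst a) (F'.snd a)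
    rw [show F'.snd a = B.cl q from ha, B.act_cl (B.src_fst ha)]
  momR_actL a q ha := B.snd_actPair (B.src_fst ha)
  momR_actR q a ha := F.snd_pair (actR_comm ha)
  momL_actR q a ha := by
    refine B.cl_eq_iff.2 ((balanced _ _ _).symm' (balanced_iff.2 ⟨π.arr a, momR_fst ha, ?_, ?_⟩))
    · rw [F.fst_pair (actR_comm ha)]
    · rw [F.snd_pair (actR_comm ha), hπ.leftAction_act]; exact ha.symm
  unit_actL q := by
    have h1 : F'.fst ((B.groupoid F').unit (B.cl q)) = G'.unit (P.momL (F.fst q)) :=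
      (F'.fst_pair (G'.src_unit _)).trans (congrArg G'.unit (B.mom_cl q))
    rw [h1, actPair, P.unit_actL, F.pair_eta]
  actR_unit q := by
    rw [π.arr_unit, H.src_unit]
    have h1 : π.obj (F.snd q) = P.momR (F.fst q) := (F.comm q).symm
    rw [h1, P.actR_unit, F.pair_eta]
  mul_actL a b q hab hb := by
    have h1 := B.src_fst hb
    have h2 : G'.src (F'.fst a) = G'.tgt (F'.fst b) := by
      rw [F'.comm, show F'.snd a = B.leftAction.act (F'.fst b) (F'.snd b) from hab,
        B.leftAction.mom_act (F'.comm b)]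
    have h3 : F'.fst ((B.groupoid F').mul a b) = G'.mul (F'.fst a) (F'.fst b) :=
      (B.proj F').arr_mul a b hab
    rw [h3]
    change F.pair _ = F.pair _
    rw [B.fst_actPair h1, B.snd_actPair h1, P.mul_actL _ _ _ h2 h1]
  actR_mul q a b ha hab := by
    rw [F.fst_pair (actR_comm ha), H.src_mul _ _ hab, π.arr_mul _ _ hab,
      P.actR_mul _ _ _ (momR_fst ha) (by rw [π.src_arr, π.tgt_arr, hab])]
  act_comm a q b ha hb := by
    have h1 := B.src_fst ha
    rw [B.fst_actPair h1, P.act_comm _ _ _ h1 (momR_fst hb), actPair, F.fst_pair (actR_comm hb),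
      F.snd_pair (actR_comm hb)]

/-- The orbits of `H` in `Q` are the balanced classes, because arrows of `G` lift uniquely to `H`,
and freeness comes from that of `G` on `P`. On the other side, `G'` moves only the component in `P`,
so freeness and transitivity on the fibres of `Q → N` are those of `P`. Properness comes from the
torsor theorems. -/
lemma bibundle_isMoritaEquivalence (hL : P.IsLeftPrincipal) :
    (B.bibundle F').IsMoritaEquivalence := by
  refine ⟨IsLeftTorsor.isRightPrincipal_of_op ⟨B.cl_submersion, ?_, ?_⟩ B.cl_surjective,
    IsLeftTorsor.isLeftPrincipal ⟨F.snd_submersion hL.submersion hπ.leftAction.mom_smooth, ?_, ?_⟩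
      fun x => ?_⟩
  · intro a (q : F.Tot) (ha : H.src a = F.snd q)
      (hq : F.pair (P.actR (F.fst q) (π.arr (H.inv a)), H.src (H.inv a)) = q)
    have ha' : F.snd q = H.tgt (H.inv a) := by rw [H.tgt_inv, ha]
    have h1 := congrArg F.fst hq
    rw [F.fst_pair (actR_comm ha')] at h1
    have h2 := h.free _ _ (momR_fst ha') h1
    have h3 : H.inv a = H.unit (F.snd q) := by
      refine hπ.arr_ext ?_ ?_
      · rw [h2, π.arr_unit, F.comm]
      · have := congrArg F.snd hq
        rwa [F.snd_pair (actR_comm ha'), ← H.src_unit (F.snd q)] at this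
    rw [← H.inv_inv a, h3, H.inv_unit]
  · intro (q : F.Tot) (q' : F.Tot) hqq
    obtain ⟨g, h1, h2, h3⟩ := balanced_iff.1 (B.cl_eq_iff.1 hqq)
    have h4 : G.src g = π.obj (F.snd q') := by rw [← P.momR_actR _ _ h1, h2, F.comm]
    refine ⟨H.inv (hπ.lift (g, F.snd q')), ?_, ?_⟩
    · rw [H.src_inv]; exact h3
    · change F.pair (P.actR (F.fst q) (π.arr (H.inv (H.inv (hπ.lift (g, F.snd q'))))),
        H.src (H.inv (H.inv (hπ.lift (g, F.snd q'))))) = q'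
      rw [H.inv_inv, hπ.arr_lift h4, hπ.src_lift h4, h2, F.pair_eta]
  · intro a (q : F.Tot) (ha : F'.snd a = B.cl q) (hq : B.actPair (F'.fst a) q = q)
    have h1 := B.src_fst ha
    have h2 := hL.free _ _ h1 (by rw [← B.fst_actPair h1, hq])
    have h3 : G'.src (G'.unit (B.mom (B.cl q))) = B.mom (B.cl q) := G'.src_unit _
    refine F'.ext ?_ ?_
    · exact h2.trans ((congrArg G'.unit (B.mom_cl q).symm).trans (F'.fst_pair h3).symm)
    · exact ha.trans (F'.snd_pair h3).symm
  · intro (q : F.Tot) (q' : F.Tot) (hqq : F.snd q = F.snd q')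
    obtain ⟨g, h1, h2⟩ := hL.orbit (F.fst q) (F.fst q') (by rw [F.comm, F.comm, hqq])
    have h3 : G'.src g = B.leftAction.mom (B.cl q) := h1.trans (B.mom_cl q).symm
    refine ⟨F'.pair (g, B.cl q), F'.snd_pair h3, ?_⟩
    change B.actPair (F'.fst (F'.pair (g, B.cl q))) q = q'
    rw [F'.fst_pair h3, actPair, h2, hqq, F.pair_eta]
  · obtain ⟨p, hp⟩ := hL.surjective (π.obj x)
    exact ⟨F.pair (p, x), F.snd_pair hp⟩

lemma bibundle_isPullback :
    IsPullback P π (B.proj F') (B.bibundle F') F.incl where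
  diffeo := F.isDiffeoOn_incl
  momR_eq _ := rfl
  actR_eq _ _ ha := Prod.ext (F.fst_pair (actR_comm ha)) (F.snd_pair (actR_comm ha))
  momL_eq := B.mom_cl
  actL_eq _ _ ha := B.fst_actPair (B.src_fst ha)

end BalancedProduct

end Bibundle

end LieGroupoid

/-! ### Dimensions of leaves under Morita equivalence -/

section Derivative

variable {a b c : ℕ} {X Y Z : Type*} [TopologicalSpace X]
  [ChartedSpace (EuclideanSpace ℝ (Fin a)) X] [TopologicalSpace Y]
  [ChartedSpace (EuclideanSpace ℝ (Fin b)) Y] [TopologicalSpace Z]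
  [ChartedSpace (EuclideanSpace ℝ (Fin c)) Z]

/-- The derivative in preferred charts, as a map of Euclidean spaces. -/
def chartDeriv (a b : ℕ) {X Y : Type*} [TopologicalSpace X]
    [ChartedSpace (EuclideanSpace ℝ (Fin a)) X] [TopologicalSpace Y]
    [ChartedSpace (EuclideanSpace ℝ (Fin b)) Y] (f : X → Y) (x : X) :
    EuclideanSpace ℝ (Fin a) →L[ℝ] EuclideanSpace ℝ (Fin b) := mfderiv (𝓡 a) (𝓡 b) f x

lemma chartDeriv_comp {f : X → Y} {g : Y → Z} {x : X} (hg : SmoothNear (𝓡 b) (𝓡 c) g (f x))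
    (hf : SmoothNear (𝓡 a) (𝓡 b) f x) (v : EuclideanSpace ℝ (Fin a)) :
    chartDeriv a c (fun y => g (f y)) x v = chartDeriv b c g (f x) (chartDeriv a b f x v) :=
  congrArg (fun L : EuclideanSpace ℝ (Fin a) →L[ℝ] EuclideanSpace ℝ (Fin c) => L v)
    (mfderiv_comp x (hg.contMDiffAt.mdifferentiableAt (by simp))
      (hf.contMDiffAt.mdifferentiableAt (by simp)))

lemma chartDeriv_congr {f g : X → Y} {x : X} (h : f =ᶠ[𝓝 x] g) :
    chartDeriv a b f x = chartDeriv a b g x := h.mfderiv_eq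

lemma chartDeriv_const {x : X} {y : Y} : chartDeriv a b (fun _ : X => y) x = 0 := mfderiv_const

lemma chartDeriv_id {x : X} (v : EuclideanSpace ℝ (Fin a)) :
    chartDeriv a a (fun y : X => y) x v = v :=
  congrArg (fun L : EuclideanSpace ℝ (Fin a) →L[ℝ] EuclideanSpace ℝ (Fin a) => L v)
    (mfderiv_id (I := 𝓡 a) (x := x))

/-- Differentiating a local section shows that the derivative is onto; the rest is rank and nullity.
-/
lemma Manifold.IsSubmersion.finrank_ker [IsManifold (𝓡 a) ∞ X] [IsManifold (𝓡 b) ∞ Y] {f : X → Y}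
    (hf : IsSubmersion (𝓡 a) (𝓡 b) ∞ f) (x : X) :
    Module.finrank ℝ (LinearMap.ker (chartDeriv a b f x).toLinearMap) + b = a := by
  obtain ⟨σ, h1, h2, h3⟩ := hf.exists_localSection x
  have hs : LinearMap.range (chartDeriv a b f x).toLinearMap = ⊤ := by
    refine LinearMap.range_eq_top.2 fun v => ⟨chartDeriv b a σ (f x) v, ?_⟩
    have h4 := chartDeriv_comp (g := f) (hf.contMDiff.smoothNear _) h1 v
    rw [chartDeriv_congr (g := fun y => y) h3, chartDeriv_id, h2] at h4
    exact h4.symm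
  have h5 := LinearMap.finrank_range_add_finrank_ker (chartDeriv a b f x).toLinearMap
  rw [hs, finrank_top, finrank_euclideanSpace_fin, finrank_euclideanSpace_fin] at h5
  omega

/-- A parametrization of the fibre of a submersion. -/
lemma Manifold.IsSubmersion.exists_fibre_parametrization [IsManifold (𝓡 a) ∞ X]
    [IsManifold (𝓡 b) ∞ Y] {f : X → Y} (hf : IsSubmersion (𝓡 a) (𝓡 b) ∞ f) (x : X) :
    ∃ (r : ℕ) (γ : EuclideanSpace ℝ (Fin r) → X) (v₀ : EuclideanSpace ℝ (Fin r)),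
      SmoothNear (𝓡 r) (𝓡 a) γ v₀ ∧ γ v₀ = x ∧ (∀ᶠ v in 𝓝 v₀, f (γ v) = f x) ∧
      ∀ w, chartDeriv a b f x w = 0 → ∃ v, chartDeriv r a γ v₀ v = w := by
  obtain ⟨hab, pr, κ, h⟩ := (hf.isSubmersionAt x).exists_isLocalProduct
  have hi : SmoothNear (𝓡 (a - b)) ((𝓡 b).prod (𝓡 (a - b)))
      (fun v : EuclideanSpace ℝ (Fin (a - b)) => (f x, v)) (pr x) :=
    smoothNear_const.prodMk smoothNear_id
  have hγ : SmoothNear (𝓡 (a - b)) (𝓡 a) (fun v => κ (f x, v)) (pr x) :=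
    SmoothNear.comp (J := (𝓡 b).prod (𝓡 (a - b))) (f := fun v => (f x, v)) h.smooth_κ hi
  have hr : ∀ᶠ v in 𝓝 (pr x), f (κ (f x, v)) = f x ∧ pr (κ (f x, v)) = v :=
    hi.continuousAt.eventually h.right_inv
  refine ⟨a - b, fun v => κ (f x, v), pr x, hγ, h.κ_apply, hr.mono fun _ h => h.1, ?_⟩
  have h1 : ∀ v, chartDeriv (a - b) b (fun v => f (κ (f x, v))) (pr x) v =
      chartDeriv a b f x (chartDeriv (a - b) a (fun v => κ (f x, v)) (pr x) v) := fun v => by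
    rw [chartDeriv_comp (g := f) (f := fun v => κ (f x, v)) (hf.contMDiff.smoothNear _) hγ,
      h.κ_apply]
  have h2 : ∀ v, chartDeriv (a - b) (a - b) (fun v => pr (κ (f x, v))) (pr x) v =
      chartDeriv a (a - b) pr x (chartDeriv (a - b) a (fun v => κ (f x, v)) (pr x) v) := fun v => by
    rw [chartDeriv_comp (g := pr) (f := fun v => κ (f x, v)) (by
      rw [h.κ_apply]; exact h.smooth_pr) hγ, h.κ_apply]
  have hle : LinearMap.range (chartDeriv (a - b) a (fun v => κ (f x, v)) (pr x)).toLinearMap ≤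
      LinearMap.ker (chartDeriv a b f x).toLinearMap := by
    rintro _ ⟨v, rfl⟩
    have h3 := h1 v
    rw [chartDeriv_congr (g := fun _ => f x) (hr.mono fun _ h => h.1), chartDeriv_const] at h3
    exact h3.symm
  have hinj : Function.Injective
      (chartDeriv (a - b) a (fun v => κ (f x, v)) (pr x)).toLinearMap := by
    intro v v' hv
    have h3 : ∀ v, chartDeriv a (a - b) pr x
        (chartDeriv (a - b) a (fun v => κ (f x, v)) (pr x) v) = v := fun v => by
      rw [← h2, chartDeriv_congr (g := fun v => v) (hr.mono fun _ h => h.2), chartDeriv_id]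
    rw [← h3 v, ← h3 v']
    exact congrArg (chartDeriv a (a - b) pr x) hv
  -- The derivative of the parametrization is injective with image in the kernel, and both have
  -- dimension `a - b`.
  have heq := Submodule.eq_of_le_of_finrank_eq hle (by
    rw [LinearMap.finrank_range_of_inj hinj, finrank_euclideanSpace_fin]
    have := hf.finrank_ker x
    omega)
  intro w hw
  have h4 : w ∈ LinearMap.ker (chartDeriv a b f x).toLinearMap := hw
  rw [← heq] at h4
  exact h4

end Derivative

/-- Rank and nullity for `f` on `ker g`. What matters is that the term `ker g ⊓ ker f` is symmetric,
so it cancels when `f` and `g` are exchanged. -/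
lemma finrank_map_ker_add {V W W' : Type*} [AddCommGroup V] [Module ℝ V] [FiniteDimensional ℝ V]
    [AddCommGroup W] [Module ℝ W] [AddCommGroup W'] [Module ℝ W'] (f : V →ₗ[ℝ] W)
    (g : V →ₗ[ℝ] W') :
    Module.finrank ℝ (Submodule.map f (LinearMap.ker g)) +
      Module.finrank ℝ (LinearMap.ker g ⊓ LinearMap.ker f : Submodule ℝ V) =
      Module.finrank ℝ (LinearMap.ker g) := by
  have h1 := LinearMap.finrank_range_add_finrank_ker (f.domRestrict (LinearMap.ker g))
  have h2 : LinearMap.ker (f.domRestrict (LinearMap.ker g)) =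
      (LinearMap.ker f).comap (LinearMap.ker g).subtype := rfl
  rw [LinearMap.range_domRestrict, h2, ← Submodule.finrank_map_subtype_eq,
    Submodule.map_comap_subtype] at h1
  exact h1

namespace LieGroupoid

variable {m n m' n' d : ℕ}

namespace Bibundle

variable {G' : LieGroupoid.{u} m' n'} {G : LieGroupoid.{u} m n} {P : Bibundle G' G d}

/-- The leaf through `momL p` is the image of the fibre of `momR` through `p`. -/
theorem IsLeftTorsor.leafDim_momL (h : P.IsLeftTorsor) (p : P.Tot) :
    G'.leafDim (P.momL p) =
      Module.finrank ℝ (Submodule.map (chartDeriv d m' P.momL p).toLinearMap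
        (LinearMap.ker (chartDeriv d m P.momR p).toLinearMap)) := by
  -- Acting on `p` sends the source fibre at the unit to the fibre of `momR`, and division by `p`
  -- goes back. Both maps intertwine `tgt` with `momL`; their derivatives give the two inclusions.
  have key : Submodule.map (chartDeriv n' m' G'.tgt (G'.unit (P.momL p))).toLinearMap
      (LinearMap.ker (chartDeriv n' m' G'.src (G'.unit (P.momL p))).toLinearMap) =
      Submodule.map (chartDeriv d m' P.momL p).toLinearMap
        (LinearMap.ker (chartDeriv d m P.momR p).toLinearMap) := by
    apply le_antisymm
    · rintro _ ⟨w, hw, rfl⟩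
      obtain ⟨r, γ, v₀, hγ, hγx, hγs, hγw⟩ :=
        G'.src_submersion.exists_fibre_parametrization (G'.unit (P.momL p))
      obtain ⟨v, rfl⟩ := hγw w hw
      rw [G'.src_unit] at hγs
      have hβ : SmoothNear (𝓡 r) (𝓡 d) (fun v => P.actL (γ v) p) v₀ :=
        P.actL_smooth.comp_smoothNear (f := fun v => (γ v, p)) (hγ.prodMk smoothNear_const) hγs
      have hβx : P.actL (γ v₀) p = p := by rw [hγx, P.unit_actL]
      refine ⟨chartDeriv r d (fun v => P.actL (γ v) p) v₀ v, ?_, ?_⟩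
      · change chartDeriv d m P.momR p (chartDeriv r d (fun v => P.actL (γ v) p) v₀ v) = 0
        have h1 := chartDeriv_comp (g := P.momR) (P.momR_smooth.smoothNear _) hβ v
        rw [hβx, chartDeriv_congr (g := fun _ => P.momR p)
          (hγs.mono fun v hv => P.momR_actL _ _ hv), chartDeriv_const] at h1
        exact h1.symm
      · change chartDeriv d m' P.momL p (chartDeriv r d (fun v => P.actL (γ v) p) v₀ v) =
          chartDeriv n' m' G'.tgt (G'.unit (P.momL p)) (chartDeriv r n' γ v₀ v)
        have h1 := chartDeriv_comp (g := P.momL) (P.momL_smooth.smoothNear _) hβ v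
        have h2 := chartDeriv_comp (g := G'.tgt) (G'.tgt_submersion.contMDiff.smoothNear _) hγ v
        rw [hβx] at h1
        rw [hγx] at h2
        rw [← h1, ← h2, chartDeriv_congr (hγs.mono fun v hv => P.momL_actL _ _ hv)]
    · rintro _ ⟨w, hw, rfl⟩
      obtain ⟨r, γ, v₀, hγ, hγx, hγs, hγw⟩ := h.submersion.exists_fibre_parametrization p
      obtain ⟨v, rfl⟩ := hγw w hw
      have hβ : SmoothNear (𝓡 r) (𝓡 n') (fun v => h.divL (γ v) p) v₀ :=
        h.divL_smooth.comp_smoothNear (f := fun v => (γ v, p)) (hγ.prodMk smoothNear_const) hγs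
      have hβx : h.divL (γ v₀) p = G'.unit (P.momL p) := by
        rw [hγx]
        exact h.divL_eq (G'.src_unit _) (P.unit_actL p)
      refine ⟨chartDeriv r n' (fun v => h.divL (γ v) p) v₀ v, ?_, ?_⟩
      · change chartDeriv n' m' G'.src _ (chartDeriv r n' (fun v => h.divL (γ v) p) v₀ v) = 0
        have h1 := chartDeriv_comp (g := G'.src) (G'.src_submersion.contMDiff.smoothNear _) hβ v
        rw [hβx, chartDeriv_congr (g := fun _ => P.momL p)
          (hγs.mono fun v hv => h.src_divL hv), chartDeriv_const] at h1
        exact h1.symm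
      · change chartDeriv n' m' G'.tgt (G'.unit (P.momL p))
          (chartDeriv r n' (fun v => h.divL (γ v) p) v₀ v) =
          chartDeriv d m' P.momL p (chartDeriv r d γ v₀ v)
        have h1 := chartDeriv_comp (g := G'.tgt) (G'.tgt_submersion.contMDiff.smoothNear _) hβ v
        have h2 := chartDeriv_comp (g := P.momL) (P.momL_smooth.smoothNear _) hγ v
        rw [hβx] at h1
        rw [hγx] at h2
        rw [← h1, ← h2, chartDeriv_congr (hγs.mono fun v hv => h.tgt_divL hv)]
  rw [← key]
  rfl

/-- Leaves corresponding under a Morita equivalence have the same codimension. -/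
theorem IsMoritaEquivalence.leafDim_add (hP : P.IsMoritaEquivalence) (p : P.Tot) :
    G'.leafDim (P.momL p) + m = G.leafDim (P.momR p) + m' := by
  have h1 := hP.2.isLeftTorsor.leafDim_momL p
  have h2 : G.leafDim (P.momR p) =
      Module.finrank ℝ (Submodule.map (chartDeriv d m P.momR p).toLinearMap
        (LinearMap.ker (chartDeriv d m' P.momL p).toLinearMap)) :=
    hP.1.isLeftTorsor_op.leafDim_momL p
  have h3 := finrank_map_ker_add (chartDeriv d m' P.momL p).toLinearMap
    (chartDeriv d m P.momR p).toLinearMap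
  have h4 := finrank_map_ker_add (chartDeriv d m P.momR p).toLinearMap
    (chartDeriv d m' P.momL p).toLinearMap
  rw [inf_comm] at h4
  have h5 := hP.2.submersion.finrank_ker p
  have h6 := hP.1.submersion.finrank_ker p
  omega

theorem IsMoritaEquivalence.isRegular (hP : P.IsMoritaEquivalence) (hG : G.IsRegular) :
    G'.IsRegular := by
  intro x y
  obtain ⟨p, rfl⟩ := hP.1.surjective x
  obtain ⟨q, rfl⟩ := hP.1.surjective y
  have h1 := hP.leafDim_add p
  have h2 := hP.leafDim_add q
  have h3 := hG (P.momR p) (P.momR q)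
  omega

end Bibundle

end LieGroupoid

/-! ### Properness and isomorphisms almost everywhere -/

lemma SmoothMfd.IsNull.mono {d : ℕ} {X : SmoothMfd.{u} d} {S T : Set X} (hT : X.IsNull T)
    (h : S ⊆ T) : X.IsNull S := fun x =>
  MeasureTheory.measure_mono_null (inter_subset_inter_right _ (preimage_mono h)) (hT x)

/-- The base change of a proper map is proper. -/
lemma FibreProduct.isProperMap_fst {a b m e : ℕ} {X : SmoothMfd.{u} a} {Y : SmoothMfd.{u} b}
    {B : SmoothMfd.{u} m} {f : X → B} {g : Y → B} (F : FibreProduct f g e) (hf : Continuous f)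
    (hg : IsProperMap g) : IsProperMap F.fst := by
  rw [isProperMap_iff_ultrafilter]
  refine ⟨F.fst_smooth.continuous, fun 𝒰 x hx => ?_⟩
  have h1 : Tendsto g (𝒰.map F.snd) (𝓝 (f x)) := by
    have h2 : Tendsto (fun t => f (F.fst t)) 𝒰 (𝓝 (f x)) := (hf.tendsto x).comp hx
    simp only [F.comm] at h2
    exact h2
  -- Properness of `g` yields a limit `y` of the second components over `f x`; continuity of `pair`
  -- on the fibre product assembles the limits.
  obtain ⟨y, hy, h2⟩ := hg.ultrafilter_le_nhds_of_tendsto h1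
  have h3 : Tendsto (fun t => (F.fst t, F.snd t)) 𝒰 (𝓝[{z | f z.1 = g z.2}] (x, y)) :=
    tendsto_nhdsWithin_iff.2 ⟨Tendsto.prodMk_nhds hx h2, Eventually.of_forall F.comm⟩
  have h4 : Tendsto (fun t => F.pair (F.fst t, F.snd t)) 𝒰 (𝓝 (F.pair (x, y))) :=
    Tendsto.comp (F.pair_smooth.continuousOn (x, y) hy.symm) h3
  simp only [F.pair_eta] at h4
  exact ⟨F.pair (x, y), F.fst_pair hy.symm, h4⟩

namespace LieGroupoid

variable {k m n m' n' d e : ℕ}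

/-- The unit map of `H` is proper, being a section of the source. Hence `G.unit ∘ π.obj = π.arr ∘
H.unit` is proper, and the first factor of a proper composite through a Hausdorff space is proper.
-/
lemma Hom.isProperMap_obj {H : LieGroupoid.{u} k n'} {G : LieGroupoid.{u} m n} (π : Hom H G)
    (h : IsProperMap π.arr) : IsProperMap π.obj := by
  have h1 : IsProperMap H.unit := by
    refine isProperMap_of_comp_of_t2 H.unit_smooth.continuous
      H.src_submersion.contMDiff.continuous ?_
    rw [show H.src ∘ H.unit = id from funext H.src_unit]
    exact isProperMap_id
  refine isProperMap_of_comp_of_t2 π.obj_smooth.continuous G.unit_smooth.continuous ?_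
  rw [show G.unit ∘ π.obj = π.arr ∘ H.unit from funext fun x => (π.arr_unit x).symm]
  exact h.comp h1

lemma Hom.obj_surjective {H : LieGroupoid.{u} k n'} {G : LieGroupoid.{u} m n} (π : Hom H G)
    (h : Function.Surjective π.arr) : Function.Surjective π.obj := fun x => by
  obtain ⟨a, ha⟩ := h (G.unit x)
  exact ⟨H.src a, by rw [← π.src_arr, ha, G.src_unit]⟩

/-- The projection of an action groupoid is an isomorphism where the moment map is a
diffeomorphism. -/
lemma LeftAction.isDiffeoOn_proj {G : LieGroupoid.{u} m n} (X : LeftAction G k)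
    (F : FibreProduct G.src X.mom e) {U : Set G.Obj}
    (hU : IsDiffeoOn (𝓡 k) (𝓡 m) X.mom (X.mom ⁻¹' U) U) :
    IsDiffeoOn (𝓡 e) (𝓡 n) (X.proj F).arr ((X.groupoid F).restrict (X.mom ⁻¹' U))
      (G.restrict U) := by
  obtain ⟨-, -, ν, h1, h2, h3, h4⟩ := hU
  have h5 : ∀ {g}, g ∈ G.restrict U → G.src g = X.mom (ν (G.src g)) := fun hg => (h4 hg.1).symm
  refine ⟨F.fst_smooth.contMDiffOn, fun a ha => ⟨?_, ?_⟩, fun g => F.pair (g, ν (G.src g)), ?_,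
    fun g hg => ⟨?_, ?_⟩, fun a ha => F.ext ?_ ?_, fun g hg => F.fst_pair (h5 hg)⟩
  · change G.src (F.fst a) ∈ U
    rw [F.comm]; exact ha.1
  · change G.tgt (F.fst a) ∈ U
    rw [← X.mom_act (F.comm a)]; exact ha.2
  · exact F.pair_smooth.comp (f := fun g => (g, ν (G.src g))) (contMDiffOn_id.prodMk
      (h1.comp G.src_submersion.contMDiff.contMDiffOn fun g hg => hg.1)) fun g hg => h5 hg
  · change X.mom (F.snd _) ∈ U
    rw [F.snd_pair (h5 hg), ← h5 hg]; exact hg.1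
  · change X.mom (X.act (F.fst _) (F.snd _)) ∈ U
    rw [F.fst_pair (h5 hg), F.snd_pair (h5 hg), X.mom_act (h5 hg)]; exact hg.2
  · have h6 : F.fst a ∈ G.restrict U :=
      ⟨by rw [F.comm]; exact ha.1, by rw [← X.mom_act (F.comm a)]; exact ha.2⟩
    exact F.fst_pair (h5 h6)
  · have h6 : F.fst a ∈ G.restrict U :=
      ⟨by rw [F.comm]; exact ha.1, by rw [← X.mom_act (F.comm a)]; exact ha.2⟩
    refine (F.snd_pair (h5 h6)).trans ?_
    rw [F.comm]
    exact h3 ha.1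

/-! ### The moment map of the balanced product -/

namespace Bibundle

namespace BalancedProduct

variable {G' : LieGroupoid.{u} m' n'} {G : LieGroupoid.{u} m n} {P : Bibundle G' G d}
  {h : P.IsRightPrincipal} {X : LeftAction G k} {F : FibreProduct P.momR X.mom e} {k' : ℕ}
  (B : BalancedProduct h X F k')

/-- Division moves the first component of any representative to the prescribed `p` in the same fibre
of `momL`. So `Q → P` covers the pullback of `N' → M'` to `P`. -/
lemma exists_fst_eq {p : P.Tot} {y : B.Tot} (hp : P.momL p = B.mom y) :
    ∃ q, F.fst q = p ∧ B.cl q = y := by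
  obtain ⟨q, rfl⟩ := B.cl_surjective y
  rw [B.mom_cl] at hp
  have h1 : G.src (h.divR p (F.fst q)) = X.mom (F.snd q) := by rw [h.src_divR hp, F.comm]
  have h2 : P.momR p = X.mom (X.act (h.divR p (F.fst q)) (F.snd q)) := by
    rw [X.mom_act h1, h.tgt_divR hp]
  refine ⟨F.pair (p, X.act (h.divR p (F.fst q)) (F.snd q)), F.fst_pair h2,
    B.cl_eq_iff.2 ⟨?_, ?_⟩⟩
  · rw [F.fst_pair h2, hp]
  · rw [F.fst_pair h2, F.snd_pair h2]

lemma mom_surjective (hX : Function.Surjective X.mom) : Function.Surjective B.mom := fun v => by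
  obtain ⟨p, rfl⟩ := h.surjective v
  obtain ⟨x, hx⟩ := hX (P.momR p)
  exact ⟨B.cl (F.pair (p, x)), by rw [B.mom_cl, F.fst_pair hx.symm]⟩

/-- The map `Q → P` is a base change of the proper map `X.mom`. An ultrafilter on `N'` whose image
converges in `M'` is lifted to `Q` along a local section of `P → M'`; it converges there, and the
limit is projected back. -/
lemma isProperMap_mom (hX : IsProperMap X.mom) : IsProperMap B.mom := by
  have hF := F.isProperMap_fst P.momR_smooth.continuous hX
  rw [isProperMap_iff_ultrafilter]
  refine ⟨B.leftAction.mom_smooth.continuous, fun 𝒰 v hv => ?_⟩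
  obtain ⟨p, rfl⟩ := h.surjective v
  obtain ⟨σ, h1, h2, h3⟩ := h.submersion.exists_localSection p
  -- The implication allows an arbitrary representative where `σ` fails to be a section, which the
  -- ultrafilter eventually avoids.
  have h4 : ∀ y, ∃ q, P.momL (σ (B.mom y)) = B.mom y → F.fst q = σ (B.mom y) ∧ B.cl q = y := by
    intro y
    by_cases hy : P.momL (σ (B.mom y)) = B.mom y
    · obtain ⟨q, hq⟩ := B.exists_fst_eq hy
      exact ⟨q, fun _ => hq⟩
    · exact ⟨B.rep y, fun h => (hy h).elim⟩
  choose r hr using h4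
  have h5 : ∀ᶠ y in (𝒰 : Filter B.Tot), F.fst (r y) = σ (B.mom y) ∧ B.cl (r y) = y :=
    (hv.eventually h3).mono fun y hy => hr y hy
  have h6 : Tendsto (fun y => F.fst (r y)) 𝒰 (𝓝 p) :=
    ((h1.tendsto h2).comp hv).congr' (h5.mono fun y hy => hy.1.symm)
  obtain ⟨q, hq, h7⟩ := hF.ultrafilter_le_nhds_of_tendsto
    (show Tendsto F.fst (𝒰.map r) (𝓝 p) from h6)
  refine ⟨B.cl q, by rw [B.mom_cl, hq], ?_⟩
  have h8 : Tendsto (fun y => B.cl (r y)) 𝒰 (𝓝 (B.cl q)) :=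
    (B.cl_smooth.continuous.tendsto q).comp h7
  exact h8.congr' (h5.mono fun y hy => hy.2)

/-- A class over `momL p` with `momR p ∈ U` has a representative `(p, x)` with `x` over `U`, and
such an `x` is unique; so the moment map is injective there. Its inverse is locally `v ↦ [σ v, ν
(momR (σ v))]` with `σ` a section of `P → M'`, hence smooth. -/
lemma isDiffeoOn_mom (hX : Function.Surjective X.mom) {U : Set G.Obj} (hUo : IsOpen U)
    (hU : IsDiffeoOn (𝓡 k) (𝓡 m) X.mom (X.mom ⁻¹' U) U) :
    IsDiffeoOn (𝓡 k') (𝓡 m') B.mom (B.mom ⁻¹' (P.momL '' (P.momR ⁻¹' U)))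
      (P.momL '' (P.momR ⁻¹' U)) := by
  obtain ⟨-, -, ν, h1, h2, h3, h4⟩ := hU
  have hinj : ∀ {y y'}, B.mom y ∈ P.momL '' (P.momR ⁻¹' U) → B.mom y = B.mom y' → y = y' := by
    rintro y y' ⟨p, hp, hpy⟩ hyy
    obtain ⟨q, hq, rfl⟩ := B.exists_fst_eq hpy
    obtain ⟨q', hq', rfl⟩ := B.exists_fst_eq (hpy.trans hyy)
    have h5 : X.mom (F.snd q) ∈ U := by rw [← F.comm, hq]; exact hp
    have h6 : X.mom (F.snd q') = X.mom (F.snd q) := by rw [← F.comm, ← F.comm, hq, hq']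
    have h7 : F.snd q = F.snd q' := by
      rw [← h3 (show F.snd q ∈ X.mom ⁻¹' U from h5),
        ← h3 (show F.snd q' ∈ X.mom ⁻¹' U from mem_preimage.2 (h6.symm ▸ h5)), h6]
    rw [F.ext (hq.trans hq'.symm) h7]
  have hs := B.mom_surjective hX
  have hsr : ∀ v, B.mom (Function.surjInv hs v) = v := Function.surjInv_eq hs
  refine ⟨B.leftAction.mom_smooth.contMDiffOn, fun y hy => hy, Function.surjInv hs, ?_,
    fun v hv => ?_, fun y hy => (hinj hy (hsr _).symm).symm, fun v _ => hsr v⟩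
  · refine contMDiffOn_of_smoothNear ?_
    rintro _ ⟨p, hp, rfl⟩
    obtain ⟨σ, hσ, hσx, hσs⟩ := h.submersion.exists_localSection p
    have hσm : SmoothNear (𝓡 m') (𝓡 m) (fun v => P.momR (σ v)) (P.momL p) :=
      SmoothNear.comp (J := 𝓡 d) (P.momR_smooth.smoothNear _) hσ
    have hσU : ∀ᶠ v in 𝓝 (P.momL p), P.momR (σ v) ∈ U :=
      hσm.eventually_mem (y := P.momR p) (by rw [hσx]) (hUo.mem_nhds hp)
    refine ⟨fun v => B.cl (F.pair (σ v, ν (P.momR (σ v)))), ?_, ?_⟩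
    · refine SmoothNear.comp (J := 𝓡 e) (B.cl_smooth.smoothNear _)
        (F.pair_smooth.comp_smoothNear (f := fun v => (σ v, ν (P.momR (σ v))))
          (hσ.prodMk (h1.comp_smoothNear hσm hσU)) (hσU.mono fun v hv => (h4 hv).symm))
    · filter_upwards [hσs, hσU] with v hv hvU hvU'
      refine hinj ?_ ?_ <;>
        rw [B.mom_cl, F.fst_pair (h4 hvU).symm, hv]
      · exact hvU'
      · exact (hsr v).symm
  · rwa [mem_preimage, hsr]

/-- Nullity is tested on `Q`: the preimage there of the exceptional subset of `N'` lies in the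
preimage of the exceptional subset of `N`. -/
lemma isNull_mom_preimage (hL : Manifold.IsSubmersion (𝓡 d) (𝓡 m) ∞ P.momR) {U : Set G.Obj}
    (hU : X.Tot.IsNull (X.mom ⁻¹' U)ᶜ) :
    B.Tot.IsNull (B.mom ⁻¹' (P.momL '' (P.momR ⁻¹' U)))ᶜ := by
  refine SmoothMfd.IsNull.of_preimage B.cl_submersion B.cl_surjective
    ((SmoothMfd.IsNull.preimage (F.snd_submersion hL X.mom_smooth) hU).mono fun q hq hq' => hq ?_)
  refine ⟨F.fst q, ?_, (B.mom_cl q).symm⟩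
  change P.momR (F.fst q) ∈ U
  rw [F.comm]; exact hq'

end BalancedProduct

end Bibundle

end LieGroupoid

end

/-! ### The resolution carried across the Morita equivalence -/

theorem mainTheorem9 {m n m' n' d k : ℕ}
    (G : LieGroupoid.{u} m n) (G' : LieGroupoid.{u} m' n')
    (P : LieGroupoid.Bibundle G' G d) (hP : P.IsMoritaEquivalence)
    (H : LieGroupoid.{u} k n) (π : LieGroupoid.Hom H G) (hπ : π.IsActionResolution) :
    ∃ (k' e : ℕ) (H' : LieGroupoid.{u} k' n') (π' : LieGroupoid.Hom H' G')
      (Q : LieGroupoid.Bibundle H' H e) (ι : Q.Tot → P.Tot × H.Obj)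
      (δ : Q.Tot × Q.Tot → H'.Arr),
      π'.IsActionResolution ∧ Q.IsMoritaEquivalence ∧
        P.IsPullback π π' Q ι ∧ Q.IsPairQuotient δ := by
  obtain ⟨⟨hreg, hsurj, hprop, U, hUo, hUn, hUn', hUd, -⟩, hact⟩ := hπ
  have hact : π.IsAction := hact
  obtain ⟨-, -, ν, hν, hνU, hνl, hνr⟩ := id hUd
  have hobj := π.obj_surjective hsurj
  have hVo : IsOpen (π.obj ⁻¹' U) := hUo.preimage π.obj_smooth.continuous
  have hV : Dense (π.obj ⁻¹' U) := by
    have := hUn'.dense_compl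
    rwa [compl_compl] at this
  -- If `N` is nonempty, a point of the dense set over `U` has a neighbourhood diffeomorphic to one
  -- in `M`, so `k = m` and `Q` has dimension `d`. An empty `N` gives no relation between `k` and
  -- `m`, hence the argument `x`.
  have hdim : H.Obj → d + m = d + k := fun x => by
    obtain ⟨x₀, hx₀⟩ := hV.nonempty_iff.2 ⟨x⟩
    have h1 : SmoothNear (𝓡 m) (𝓡 k) ν (π.obj x₀) := hν.smoothNear (hUo.mem_nhds hx₀)
    have h2 : ∀ᶠ w in 𝓝 (π.obj x₀), π.obj (ν w) = w :=
      Eventually.mono (hUo.mem_nhds hx₀) fun w hw => hνr hw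
    have h3 : ∀ᶠ w in 𝓝 (ν (π.obj x₀)), ν (π.obj w) = w := by
      rw [hνl hx₀]
      exact Eventually.mono (hVo.mem_nhds hx₀) fun w hw => hνl hw
    have h4 : ν (π.obj x₀) = x₀ := hνl hx₀
    rw [le_antisymm (le_of_localSection (π.obj_smooth.smoothNear x₀) h1 h4 h2)
      (le_of_localSection h1 (π.obj_smooth.smoothNear _) (by rw [h4]) h3)]
  obtain ⟨F⟩ := FibreProduct.nonempty (e := d) hP.2.submersion hact.leftAction.mom_smooth
    (fun x => hP.2.surjective _) (fun _ x _ => hdim x)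
  obtain ⟨B⟩ := LieGroupoid.Bibundle.BalancedProduct.nonempty (h := hP.1) (F := F)
    hP.2.submersion (hV.mono fun x hx => ⟨ν, hν.smoothNear (hUo.mem_nhds hx),
      Eventually.mono (hUo.mem_nhds hx) fun w hw => ⟨hνr hw, fun x' hx' => by
        have h1 : x' ∈ π.obj ⁻¹' U := by rw [mem_preimage, show π.obj x' = w from hx']; exact hw
        rw [← hx']; exact (hνl h1).symm⟩⟩)
  obtain ⟨F'⟩ := FibreProduct.nonempty (e := n') G'.src_submersion B.leftAction.mom_smooth
    (fun y => ⟨G'.unit _, G'.src_unit _⟩) (fun _ _ _ => rfl)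
  have hQ := B.bibundle_isMoritaEquivalence F' hP.2
  have hmom := B.isDiffeoOn_mom hobj hUo hUd
  -- The good open set of `M'` is the image of the preimage of `U` in `P`. Over it the isomorphism
  -- on arrows follows from the one on objects, as for every action groupoid; regularity is
  -- transported from `H` along `Q`.
  refine ⟨m', d, B.groupoid F', B.proj F', B.bibundle F', F.incl, _,
    ⟨⟨hQ.isRegular hreg, fun g => ?_, ?_, P.momL '' (P.momR ⁻¹' U), ?_, ?_, ?_, hmom,
      B.leftAction.isDiffeoOn_proj F' hmom⟩, F'.isDiffeoOn_incl⟩, hQ, B.bibundle_isPullback F',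
    hQ.isPairQuotient⟩
  · obtain ⟨y, hy⟩ := B.mom_surjective hobj (G'.src g)
    exact ⟨F'.pair (g, y), F'.fst_pair hy.symm⟩
  · exact F'.isProperMap_fst G'.src_submersion.contMDiff.continuous
      (B.isProperMap_mom (π.isProperMap_obj hprop))
  · exact hP.1.submersion.isOpenMap _ (hUo.preimage P.momR_smooth.continuous)
  · refine SmoothMfd.IsNull.of_preimage hP.1.submersion hP.1.surjective
      ((SmoothMfd.IsNull.preimage hP.2.submersion hUn).mono fun p hp hp' => hp ⟨p, hp', rfl⟩)
  · exact B.isNull_mom_preimage hP.2.submersion hUn'
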